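/- Conventions. $\mathbb T=[-\infty,\infty)$ with the order topology and $\mathbb T^n$ has the product topology; for a set $I$ of coordinates, $H_I^\times\subset\mathbb T^n$ is the stratum of points $x$ with $x_a=-\infty$ exactly for $a\in I$, so $H_I^\times\cong\mathbb R^{n-|I|}$. A tropical $k$-cycle of sedentarity $I$ in $\mathbb T^n$ is (the closure of) a finite, pure $k$-dimensional, integer-weighted, rational polyhedral complex in $H_I^\times$ that is balanced at each face of dimension $k-1$; it is effective if all facet weights are positive. Cycles in $\mathbb T^n$ are finite sums of such cycles, and two of them are identified when their weights agree outside finitely many polyhedra of smaller dimension. For a $k$-cycle $A$ of sedentarity $I$ and a coordinate $i\notin I$, the cycle $A.H_i$ is the sum, over all facets $\sigma$ of $A$ (with weight $w_\sigma$) and all $J\supseteq I\cup\{i\}$ for which $F=\overline\sigma\cap H_J^\times$ is nonempty of dimension $k-1$, of $F$ with weight $w_\sigma\cdot[\mathbb Z\times\Lambda_F:\{(u_i,\pi_J u):u\in\Lambda_\sigma\}]$, where $\Lambda$ denotes the lattice of integer vectors parallel to a polyhedron and $\pi_J$ forgets the coordinates in $J$. Let $C\subset\mathbb T^n$ be an effective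 $k$-cycle of sedentarity $I$ and let $f=P-Q$, where $P,Q$ are tropical polynomials on $\mathbb T^n$ that are finite on $H_I^\times$. Choose the polyhedral structure of $C$ so that $P$ and $Q$ are affine on each polyhedron. For $g\in\{f,P,Q\}$ let $\tilde C_g\subset\mathbb T^{n+1}$ be the closure of the weighted complex formed by the graph of $g$ over $C$, with the weights of $C$, together with the facets $F_E=\{(x,t):x\in E,\ t\le g(x)\}$ for the $(k-1)$-dimensional faces $E$ of $C$, with the unique integer weights that make the result balanced along the graph of each $E$. Let $\delta:\mathbb T^{n+1}\to\mathbb T^n$ forget the last coordinate. The divisor of a polynomial is $\operatorname{div}_C(P)=\delta(\tilde C_P.H_{n+1})$, and $\operatorname{div}_C(f)=\operatorname{div}_C(P)-\operatorname{div}_C(Q)$. If $\operatorname{div}_C(f)$ is effective (possibly zero), then $\delta:\tilde C_f\to C$ is called the elementary tropical modification of $C$ along $f$, with divisor $\operatorname{div}_C(f)$. For a finite set $E$, let $\mathbb{TP}^E=(\mathbb T^E\setminus\{(-\infty,\dots,-\infty)\})/\mathbb R(1,\dots,1)$, with charts $U_j=\{x_j\ne-\infty\}\cong\mathbb T^{E\setminus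 j}$ (normalise $x_j=0$). For a matroid $N$ on $E$ with set of loops $L$, the Bergman fan $B(N)\subset\mathbb{TP}^E$ is the closure of the set of classes of the points $y$ with $y_a=-\infty$ for $a\in L$ and $(y_a)_{a\notin L}=-\sum_l c_l\mathbf 1_{F_l}$, for all chains $\emptyset\ne F_1\subsetneq\dots\subsetneq F_m\ne E\setminus L$ of flats of $N\setminus L$ and all $c_l\ge0$ (if every element is a loop, $B(N)=\emptyset$). It is considered with all facet weights equal to one. **Proposition.** Let $M$ be a matroid of rank $k+1$ on a finite ground set $E$, and let $i\in E$ be neither a loop nor a coloop. Then for every $j\in E\setminus\{i\}$ the projection $\mathbb T^{E\setminus\{j\}}\to\mathbb T^{E\setminus\{i,j\}}$ forgetting $x_i$ restricts to a map $$\delta_j: B(M)\cap U_j\longrightarrow B(M\setminus i)\cap U_j,$$ and this is an elementary tropical modification of the effective $k$-cycle $B(M\setminus i)\cap U_j$ along some tropical rational function, with divisor $B(M/i)\cap U_j$. -/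

import Mathlib

open scoped Matroid

noncomputable section

namespace TropMod

/-! ### Tropical affine space -/

/-- The tropical numbers `[-∞, ∞)`, with the order topology of Mathlib. -/
abbrev TT : Type := WithBot ℝ

/-- The set of coordinates in which a point of `𝕋^κ` equals `-∞`. -/
def sedentarity {κ : Type*} (z : κ → TT) : Set κ := {a | z a = ⊥}

/-- The inclusion of the stratum `H_I^× = ℝ^{κ \ I}` (the points of sedentarity exactly `I`)
into `𝕋^κ`. -/
def toT {κ : Type*} (I : Set κ) (x : {a // a ∉ I} → ℝ) : κ → TT := by
  classical exact fun a => if h : a ∈ I then ⊥ else ((x ⟨a, h⟩ : ℝ) : TT)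

/-! ### Polyhedra, polyhedral complexes and tropical cycles in `ℝ^κ` -/

/-- A rational polyhedron: finitely many inequalities `⟨v, x⟩ ≤ c` with `v` integral, `c` real. -/
def IsRationalPolyhedron {κ : Type*} (σ : Set (κ → ℝ)) : Prop :=
  ∃ L : Finset ((κ →₀ ℤ) × ℝ),
    σ = {x | ∀ p ∈ L, (p.1.sum fun a m => (m : ℝ) * x a) ≤ p.2}

/-- `τ` is a (nonempty) face of `σ`: the locus where some linear form attains its maximum. -/
def IsFace {κ : Type*} (τ σ : Set (κ → ℝ)) : Prop :=
  τ.Nonempty ∧ ∃ (ℓ : (κ → ℝ) →ₗ[ℝ] ℝ) (c : ℝ),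
    (∀ x ∈ σ, ℓ x ≤ c) ∧ τ = {x ∈ σ | ℓ x = c}

/-- The dimension of a polyhedron. -/
def dim {κ : Type*} (σ : Set (κ → ℝ)) : ℕ := Module.finrank ℝ (vectorSpan ℝ σ)

/-- A finite rational polyhedral complex. -/
structure IsComplex {κ : Type*} (K : Finset (Set (κ → ℝ))) : Prop where
  polyhedron : ∀ σ ∈ K, IsRationalPolyhedron σ ∧ σ.Nonempty
  face_mem : ∀ σ ∈ K, ∀ τ, IsFace τ σ → τ ∈ K
  inter : ∀ σ ∈ K, ∀ τ ∈ K, (σ ∩ τ).Nonempty → IsFace (σ ∩ τ) σ ∧ IsFace (σ ∩ τ) τ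

/-- Finite formal integer combinations of subsets of `ℝ^κ`; used for weighted facets. -/
abbrev Chain (κ : Type*) : Type _ := Set (κ → ℝ) →₀ ℤ

/-- The lattice `Λ_σ` of integer vectors parallel to `σ`. -/
def lattice {κ : Type*} (σ : Set (κ → ℝ)) : AddSubgroup (κ → ℤ) where
  carrier := {u | (fun a => (u a : ℝ)) ∈ vectorSpan ℝ σ}
  zero_mem' := by
    have h : (fun a : κ => (((0 : κ → ℤ) a : ℤ) : ℝ)) = 0 := by ext a; simp
    simp only [Set.mem_ofPred_eq, h]
    exact Submodule.zero_mem _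
  add_mem' := by
    intro u v hu hv
    have h : (fun a : κ => (((u + v) a : ℤ) : ℝ))
        = (fun a => (u a : ℝ)) + (fun a => (v a : ℝ)) := by ext a; simp
    simp only [Set.mem_ofPred_eq, h]
    exact Submodule.add_mem _ hu hv
  neg_mem' := by
    intro u hu
    have h : (fun a : κ => (((-u) a : ℤ) : ℝ)) = -(fun a => (u a : ℝ)) := by ext a; simp
    simp only [Set.mem_ofPred_eq, h]
    exact Submodule.neg_mem _ hu

/-- `v` is a primitive integer vector pointing from the codimension one face `E` into `F`:
`v` generates `Λ_F` modulo `Λ_E`, and `x + ε v ∈ F` for some `x ∈ E` and `ε > 0`. -/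
def IsPrimitiveVector {κ : Type*} (E F : Set (κ → ℝ)) (v : κ → ℤ) : Prop :=
  lattice F = lattice E ⊔ AddSubgroup.zmultiples v ∧
    ∃ x ∈ E, ∃ ε : ℝ, 0 < ε ∧ (fun a => x a + ε * (v a : ℝ)) ∈ F

open Classical in
/-- The balancing condition at `E` for the weighted facets `A`: the weighted sum of the primitive
vectors into the facets adjacent to `E` is parallel to `E`. -/
def BalancedAt {κ : Type*} (A : Chain κ) (E : Set (κ → ℝ)) : Prop :=
  ∃ v : Set (κ → ℝ) → κ → ℤ,
    (∀ F ∈ A.support, E ⊆ F → IsPrimitiveVector E F (v F)) ∧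
    (A.sum fun F n => if E ⊆ F then n • v F else 0) ∈ lattice E

/-- `K` with facet weights `w` is an effective tropical `k`-cycle in `ℝ^κ`: a rational polyhedral
complex of pure dimension `k`, with positive weights on the facets, balanced at every face of
dimension `k - 1`. -/
structure IsEffectiveCycle {κ : Type*} (k : ℕ) (K : Finset (Set (κ → ℝ))) (w : Chain κ) :
    Prop where
  isComplex : IsComplex K
  pure : ∀ σ ∈ K, ∃ τ ∈ K, dim τ = k ∧ σ ⊆ τ
  weight_mem : ∀ τ ∈ w.support, τ ∈ K ∧ dim τ = k
  weight_pos : ∀ τ ∈ K, dim τ = k → 0 < w τ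
  balanced : ∀ E ∈ K, dim E + 1 = k → BalancedAt w E

/-! ### Cycles in `𝕋^κ` as weight functions -/

open Classical in
/-- The weight function on `𝕋^κ` of weighted facets lying in the stratum `H_I^×`. -/
def chainWeight {κ : Type*} (I : Set κ) (A : Chain {a // a ∉ I}) : (κ → TT) → ℤ :=
  fun z => A.sum fun σ n => if z ∈ toT I '' σ then n else 0

/-- Two weight functions on `𝕋^κ` define the same `d`-cycle: in every stratum they differ only
inside finitely many rational polyhedra of dimension less than `d`. This identifies weighted
complexes up to refinement, up to facets of weight zero, and up to the lower dimensional pieces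
of the topological closure that lie in deeper strata. (For `d = 0` it is equality.) -/
def SameCycle {κ : Type*} (d : ℕ) (W W' : (κ → TT) → ℤ) : Prop :=
  ∀ J : Set κ, ∃ L : Finset (Set ({a // a ∉ J} → ℝ)),
    (∀ τ ∈ L, IsRationalPolyhedron τ ∧ dim τ < d) ∧
    ∀ x : {a // a ∉ J} → ℝ, W (toT J x) ≠ W' (toT J x) → ∃ τ ∈ L, x ∈ τ

open Classical in
/-- The weight function equal to one on `S` and to zero elsewhere. -/
def unitWeight {κ : Type*} (S : Set (κ → TT)) : (κ → TT) → ℤ :=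
  fun z => if z ∈ S then 1 else 0

/-! ### Intersection with a boundary hyperplane -/

/-- The part in the stratum `H_J^×` of the closure in `𝕋^κ` of a polyhedron of
sedentarity `I`. -/
def boundaryFace {κ : Type*} (I J : Set κ) (σ : Set ({a // a ∉ I} → ℝ)) :
    Set ({a // a ∉ J} → ℝ) :=
  {y | toT J y ∈ closure (toT I '' σ)}

open Classical in
/-- A vector of `ℤ^{κ \ I}`, extended by zero. -/
def extendZero {κ : Type*} (I : Set κ) : ({a // a ∉ I} → ℤ) →+ (κ → ℤ) where
  toFun u := fun a => if h : a ∈ I then 0 else u ⟨a, h⟩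
  map_zero' := by ext a; simp
  map_add' u v := by ext a; by_cases h : a ∈ I <;> simp [h]

/-- The homomorphism `u ↦ (u_i, π_J u)` from `ℤ^{κ \ I}` to `ℤ × ℤ^{κ \ J}`, where `π_J` forgets
the coordinates in `J`. -/
def coordProj {κ : Type*} (I J : Set κ) (i : κ) :
    ({a // a ∉ I} → ℤ) →+ ℤ × ({a // a ∉ J} → ℤ) where
  toFun u := (extendZero I u i, fun b => extendZero I u b.1)
  map_zero' := by ext <;> simp
  map_add' u v := by ext <;> simp

/-- The multiplicity with which a facet `σ` of sedentarity `I` contributes to the intersection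
with `H_i` along its boundary face `F` in `H_J^×`: the index of the image of `Λ_σ` in
`ℤ × Λ_F` under `u ↦ (u_i, π_J u)`. It is the product of the transversal index
`[ℤ^κ : Λ_σ + Λ_i^⊥]` and the degree `[Λ_F : π_J (Λ_σ ∩ Λ_i^⊥)]` of the projection of
`σ ∩ {x_i = const}` onto `F`; the second factor is one if `J = I ∪ {i}`. -/
def boundaryIndex {κ : Type*} (I J : Set κ) (i : κ) (σ : Set ({a // a ∉ I} → ℝ)) : ℕ :=
  ((lattice σ).map (coordProj I J i)).relIndex
    ((⊤ : AddSubgroup ℤ).prod (lattice (boundaryFace I J σ)))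

open Classical in
/-- The intersection `A.H_i` of a `k`-cycle `A` of sedentarity `I` with the hyperplane
`H_i = {x_i = -∞}`, as a weight function: at a point `z` of `H_i`, sum over the facets of `A`
having a boundary face of dimension `k - 1` through `z` in the stratum of `z`. -/
def hyperplaneWeight {κ : Type*} (k : ℕ) (i : κ) (I : Set κ) (A : Chain {a // a ∉ I}) :
    (κ → TT) → ℤ :=
  fun z => if i ∉ I ∧ i ∈ sedentarity z then
    A.sum fun σ n =>
      if z ∈ closure (toT I '' σ) ∧ dim (boundaryFace I (sedentarity z) σ) + 1 = k then
        n * (boundaryIndex I (sedentarity z) i σ : ℤ)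
      else 0
  else 0

/-! ### Tropical polynomials and rational functions -/

/-- A tropical polynomial in the variables `ι`; monomials not listed have coefficient `-∞`. -/
structure TropPoly (ι : Type*) where
  monomials : Finset (ι →₀ ℕ)
  coeff : (ι →₀ ℕ) → ℝ

/-- The regular function on `𝕋^ι` of a tropical polynomial,
`x ↦ max_m (c_m + ∑ a, m_a x_a)`, where `0 • (-∞) = 0`. -/
def TropPoly.eval {ι : Type*} (P : TropPoly ι) (x : ι → TT) : TT :=
  P.monomials.sup fun m => ((P.coeff m : ℝ) : TT) + m.sum fun a n => n • x a

/-- The restriction of a regular function to the stratum `H_I^×`, as a real function; used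
only where the function is not `-∞`. -/
def TropPoly.onStratum {ι : Type*} (P : TropPoly ι) (I : Set ι) (x : {a // a ∉ I} → ℝ) : ℝ :=
  (P.eval (toT I x)).unbotD 0

/-- On every polyhedron of `K`, in the stratum `H_I^×`, the regular function `P` is finite and
affine. -/
def TropPoly.IsAdapted {ι : Type*} (P : TropPoly ι) (I : Set ι)
    (K : Finset (Set ({a // a ∉ I} → ℝ))) : Prop :=
  ∀ σ ∈ K, ∃ ℓ : ({a // a ∉ I} → ℝ) →ᵃ[ℝ] ℝ,
    ∀ x ∈ σ, P.eval (toT I x) = ((ℓ x : ℝ) : TT)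

/-! ### Graph, undergraph, divisor and modification -/

/-- Coordinates of `𝕋^{n+1} = 𝕋^n × 𝕋`: the new last coordinate is `none`. The map
`δ : 𝕋^{n+1} → 𝕋^n` forgets it. -/
def delta {ι : Type*} (z : Option ι → TT) : ι → TT := fun a => z (some a)

/-- The projection `δ` on the stratum `ℝ^{ι \ I} × ℝ`. -/
def base {ι : Type*} {I : Set ι} (y : {b : Option ι // b ∉ some '' I} → ℝ) :
    {a // a ∉ I} → ℝ :=
  fun a => y ⟨some a.1, by simpa using a.2⟩

/-- The last coordinate on the stratum `ℝ^{ι \ I} × ℝ`. -/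
def height {ι : Type*} {I : Set ι} (y : {b : Option ι // b ∉ some '' I} → ℝ) : ℝ :=
  y ⟨none, by simp⟩

/-- The graph of `g` over `σ`. -/
def graphOver {ι : Type*} {I : Set ι} (g : ({a // a ∉ I} → ℝ) → ℝ)
    (σ : Set ({a // a ∉ I} → ℝ)) : Set ({b : Option ι // b ∉ some '' I} → ℝ) :=
  {y | base y ∈ σ ∧ height y = g (base y)}

/-- The set `F_σ` of points lying below the graph of `g` over `σ`. -/
def underGraph {ι : Type*} {I : Set ι} (g : ({a // a ∉ I} → ℝ) → ℝ)
    (σ : Set ({a // a ∉ I} → ℝ)) : Set ({b : Option ι // b ∉ some '' I} → ℝ) :=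
  {y | base y ∈ σ ∧ height y ≤ g (base y)}

/-- `A` is the modification `Γ_g ∪ 𝒰(Γ_g)` of the weighted `k`-dimensional complex `(K, w)` of
sedentarity `I` along the function `g` (affine on the polyhedra of `K`): the graph with the
weights of `w`, together with the facets `F_E` below the codimension one faces `E` of `K`, with
the weights `ω E` that make the result balanced along the graph of each `E`. -/
def IsGraphModification {ι : Type*} {I : Set ι} (k : ℕ) (K : Finset (Set ({a // a ∉ I} → ℝ)))
    (w : Chain {a // a ∉ I}) (g : ({a // a ∉ I} → ℝ) → ℝ)
    (A : Chain {b : Option ι // b ∉ some '' I}) : Prop :=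
  ∃ ω : Chain {a // a ∉ I},
    (∀ E ∈ ω.support, E ∈ K ∧ dim E + 1 = k) ∧
    A = w.mapDomain (graphOver g) + ω.mapDomain (underGraph g) ∧
    ∀ E ∈ K, dim E + 1 = k → BalancedAt A (graphOver g E)

/-- The cycle `δ(A.H_{n+1})` in `𝕋^n`, as a weight function. -/
def lastHyperplaneWeight {ι : Type*} {I : Set ι} (k : ℕ)
    (A : Chain {b : Option ι // b ∉ some '' I}) : (ι → TT) → ℤ :=
  fun x => hyperplaneWeight k none (some '' I) A (fun b => b.elim ⊥ x)

/-- `D` is the divisor of the regular function `P` on the cycle `(K, w)` of sedentarity `I`,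
the complex `K` being adapted to `P`. -/
def IsRegularDivisor {ι : Type*} {I : Set ι} (k : ℕ) (K : Finset (Set ({a // a ∉ I} → ℝ)))
    (w : Chain {a // a ∉ I}) (P : TropPoly ι) (D : (ι → TT) → ℤ) : Prop :=
  P.IsAdapted I K ∧
    ∃ A, IsGraphModification k K w (P.onStratum I) A ∧ D = lastHyperplaneWeight k A

/-- `δ : C' → C` is an elementary modification of the effective `k`-cycle `C` in `𝕋^ι`, with
effective divisor `D`: for a suitable sedentarity `I`, polyhedral structure `(K, w)` of `C`, and
rational function `P / Q` on `𝕋^ι` restricted to `C`, the divisor `div P - div Q` is `D` and the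
modification of `C` along `P / Q` is `C'`. -/
def IsElementaryModification {ι : Type*} (k : ℕ) (C' : (Option ι → TT) → ℤ)
    (C D : (ι → TT) → ℤ) : Prop :=
  ∃ (I : Set ι) (K : Finset (Set ({a // a ∉ I} → ℝ))) (w : Chain {a // a ∉ I})
    (P Q : TropPoly ι) (DP DQ : (ι → TT) → ℤ) (A : Chain {b : Option ι // b ∉ some '' I}),
    IsEffectiveCycle k K w ∧
    SameCycle k C (chainWeight I w) ∧
    IsRegularDivisor k K w P DP ∧
    IsRegularDivisor k K w Q DQ ∧
    SameCycle (k - 1) D (fun x => DP x - DQ x) ∧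
    (∀ x, 0 ≤ D x) ∧
    IsGraphModification k K w (fun x => P.onStratum I x - Q.onStratum I x) A ∧
    SameCycle k C' (chainWeight (some '' I) A)

/-! ### Tropical projective space and Bergman fans -/

/-- Homogeneous coordinates: points of `𝕋^E` other than `(-∞, …, -∞)`. -/
abbrev HomCoord (E : Type*) : Type _ := {y : E → TT // ∃ a, y a ≠ ⊥}

/-- Homogeneous coordinates up to a common real shift. -/
def homSetoid (E : Type*) : Setoid (HomCoord E) where
  r x y := ∃ t : ℝ, ∀ a, y.1 a = x.1 a + (t : TT)
  iseqv :=
    { refl := fun x => ⟨0, fun a => by simp⟩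
      symm := by
        rintro x y ⟨t, h⟩
        refine ⟨-t, fun a => ?_⟩
        rw [h a, add_assoc, ← WithBot.coe_add]
        simp
      trans := by
        rintro x y z ⟨s, h⟩ ⟨t, h'⟩
        refine ⟨s + t, fun a => ?_⟩
        rw [h' a, h a, add_assoc, ← WithBot.coe_add] }

/-- Tropical projective space with homogeneous coordinates indexed by `E`. -/
def TProj (E : Type*) : Type _ := Quotient (homSetoid E)

/-- The point with given homogeneous coordinates. -/
def TProj.mk {E : Type*} (y : HomCoord E) : TProj E := Quotient.mk (homSetoid E) y

/-- The quotient topology. -/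
instance (E : Type*) : TopologicalSpace (TProj E) :=
  inferInstanceAs (TopologicalSpace (Quotient (homSetoid E)))

open Classical in
/-- The homogeneous vector `- ∑ l, c_l 1_{F_l}`, with the loops of `M` sent to `-∞`. -/
def coneVector {α : Type*} (M : Matroid α) {m : ℕ} (F : Fin m → Set α) (c : Fin m → ℝ) :
    M.E → TT :=
  fun a => if a.1 ∈ M.loops then ⊥
    else ((-∑ l, (if a.1 ∈ F l then c l else 0) : ℝ) : TT)

/-- The Bergman fan of `M` in tropical projective space: the closure of the union of the cones
spanned by the vectors `v_{F_l} = ∑ a ∈ F_l, v_a`, where `v_a` is the class of `-e_a`, for all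
chains `∅ ≠ F_1 ⊂ … ⊂ F_m` of proper flats of the matroid obtained by deleting the loops of `M`;
it lies in the boundary stratum where the loop coordinates are `-∞`. -/
def bergmanFan {α : Type*} (M : Matroid α) : Set (TProj M.E) :=
  closure {p | ∃ (m : ℕ) (F : Fin m → Set α) (c : Fin m → ℝ) (y : HomCoord M.E),
    StrictMono F ∧
    (∀ l, (M ＼ M.loops).IsFlat (F l) ∧ (F l).Nonempty ∧ F l ≠ (M ＼ M.loops).E) ∧
    (∀ l, 0 ≤ c l) ∧
    y.1 = coneVector M F c ∧ p = TProj.mk y}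

/-- The coordinates on the chart `U_j` of tropical projective space. -/
abbrev ChartIndex {α : Type*} (E : Set α) (j : α) : Type _ := {a : α // a ∈ E ∧ a ≠ j}

open Classical in
/-- The point of the chart `U_j = {x_j = 0}` with given affine coordinates. -/
def chartPoint {α : Type*} {E : Set α} {j : α} (hj : j ∈ E) (x : ChartIndex E j → TT) :
    TProj E :=
  TProj.mk ⟨fun a => if h : a.1 = j then 0 else x ⟨a.1, a.2, h⟩, ⟨⟨j, hj⟩, by simp⟩⟩

/-- `B(M) ∩ U_j` as a subset of the affine space `U_j = 𝕋^{E \ j}`. -/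
def bergmanChart {α : Type*} (M : Matroid α) {j : α} (hj : j ∈ M.E) :
    Set (ChartIndex M.E j → TT) :=
  {x | chartPoint hj x ∈ bergmanFan M}

open Classical in
/-- A point of `𝕋^{E \ {i, j}} × 𝕋` as a point of `𝕋^{E \ j}`, the last coordinate being the one
of index `i`. -/
def joinCoord {α : Type*} {E : Set α} (i j : α) (z : Option (ChartIndex (E \ {i}) j) → TT) :
    ChartIndex E j → TT :=
  fun a => if h : a.1 = i then z none else z (some ⟨a.1, ⟨a.2.1, h⟩, a.2.2⟩)

end TropMod
end

noncomputable section

namespace TropMod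

/-! ### Cones attached to weak orderings -/

section Cones

variable {κ : Type*}

/-! In homogeneous coordinates the Bergman fan is cut out by the tropical incidence relations `X e ≤
max_{a ∈ S} X a` for `e` in the closure of `S` (`mk_mem_bergmanFan_iff`). On the stratum where
exactly the loops are `-∞`, this says that the sublevel sets of the coordinates are flats (`IsLev`).
That stratum is subdivided by the weak order of the coordinates, with `none` standing for the
element `j` of the chart. A cone has one level more than its dimension, and facets are maximal
chains of flats. Around a cone of codimension one a facet arises by splitting a level at which the
rank jumps by two; the lower halves of the possible splittings partition that level. Hence the sum
of the primitive vectors is constant on levels, which is balancing (`isEffectiveCycle_levFan`).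

Fix a point `x` of the fan of `M ＼ {i}`. The circuits through `i` bound the coordinate of `i` by the
threshold `f x = min_S max_{s ∈ S} x_s`, over all `S` spanning `i`; such `S` exist because `i` is
not a coloop. The value `f x` itself is always allowed, and a smaller one exactly when `x` lies in
the fan of `M ／ {i}` (`isLev_option_iff`). So the fan of `M` is the graph of `f` together with what
lies below it over the fan of `M ／ {i}`. With `g_S = max_{s ∈ S} x_s` one has `min_S g_S = ∑_S g_S -
max_S ∑_{S' ≠ S} g_{S'}`, a difference of two tropical polynomials, and on every cone `f` is a
single coordinate (`exists_threshold_forms`).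

The weights remain. Balancing forces the weight below a ridge (`ridgeWeight`); counting the facets
in which the threshold coordinate falls into the lower half gives one on the ridges in the fan of `M
／ {i}` and zero on the others (`ridgeWeight_threshold`). The divisor has two sources. Facets below
ridges contribute their weights in the original stratum. Graph facets contribute in deeper strata,
with multiplicity the slope of the linear form towards infinity (`boundaryIndex_graphOver`); for `P
- Q` this is one exactly if the threshold coordinate tends to `-∞`. The second source matters when
`i` has parallel elements, since these become loops of `M ／ {i}` and push its fan into the boundary
(`sameCycle_contract`). All comparisons ignore points with too few levels
(`sameCycle_of_forall_levels`). -/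

/-- Homogeneous coordinates of an affine point, the coordinate `none` being normalised to zero. -/
def homog {R : Type*} [Zero R] (x : κ → R) : Option κ → R := fun o => o.elim 0 x

/-- Affine coordinates of a homogeneous vector. -/
def dehomog {R : Type*} [Sub R] (h : Option κ → R) : κ → R := fun a => h (some a) - h none

@[simp] lemma homog_none {R : Type*} [Zero R] (x : κ → R) : homog x none = 0 := rfl

@[simp] lemma homog_some {R : Type*} [Zero R] (x : κ → R) (a : κ) : homog x (some a) = x a := rfl

lemma homog_dehomog {R : Type*} [AddGroup R] (h : Option κ → R) (a : Option κ) :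
    homog (dehomog h) a = h a - h none := by
  cases a <;> simp [dehomog]

lemma homog_add {R : Type*} [AddMonoid R] (x y : κ → R) (a : Option κ) :
    homog (x + y) a = homog x a + homog y a := by
  cases a <;> simp

lemma homog_sub {R : Type*} [AddGroup R] (x y : κ → R) (a : Option κ) :
    homog (x - y) a = homog x a - homog y a := by
  cases a <;> simp

lemma homog_smul {R : Type*} [MulZeroClass R] (c : R) (x : κ → R) (a : Option κ) :
    homog (fun b => c * x b) a = c * homog x a := by
  cases a <;> simp

lemma homog_intCast (u : κ → ℤ) (a : Option κ) :
    homog (fun b => (u b : ℝ)) a = ((homog u a : ℤ) : ℝ) := by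
  cases a <;> simp

/-- The closed cone of the vectors that are weakly ordered as `y`. -/
def cone (y : κ → ℝ) : Set (κ → ℝ) :=
  {x | ∀ a b, homog y a ≤ homog y b → homog x a ≤ homog x b}

/-- The number of different homogeneous coordinates. -/
def levels (y : κ → ℝ) : ℕ := (Set.range (homog y)).ncard

lemma mem_cone_self (y : κ → ℝ) : y ∈ cone y := fun _ _ h => h

lemma zero_mem_cone (y : κ → ℝ) : (0 : κ → ℝ) ∈ cone y := by
  intro a b _
  cases a <;> cases b <;> simp

lemma cone_subset {x y : κ → ℝ} (h : x ∈ cone y) : cone x ⊆ cone y :=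
  fun _ hz a b hab => hz a b (h a b hab)

lemma cone_subset_iff {x y : κ → ℝ} : cone x ⊆ cone y ↔ x ∈ cone y :=
  ⟨fun h => h (mem_cone_self x), cone_subset⟩

lemma cone_eq_of_iff {x y : κ → ℝ}
    (h : ∀ a b, homog x a ≤ homog x b ↔ homog y a ≤ homog y b) : cone x = cone y :=
  (cone_subset fun a b => (h a b).2).antisymm (cone_subset fun a b => (h a b).1)

lemma homog_eq_of_mem_cone {x y : κ → ℝ} (h : x ∈ cone y) {a b : Option κ}
    (hab : homog y a = homog y b) : homog x a = homog x b :=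
  le_antisymm (h a b hab.le) (h b a hab.ge)

lemma add_mem_cone {x x' y : κ → ℝ} (h : x ∈ cone y) (h' : x' ∈ cone y) : x + x' ∈ cone y := by
  intro a b hab
  rw [homog_add, homog_add]
  exact add_le_add (h a b hab) (h' a b hab)

/-- A monotone map between total preorders with as many classes reflects the order. -/
lemma le_of_ncard_range_le {T A B : Type*} [Finite T] [LinearOrder A] [LinearOrder B]
    {f : T → A} {g : T → B} (h : ∀ a b, f a ≤ f b → g a ≤ g b)
    (hc : (Set.range f).ncard ≤ (Set.range g).ncard) {a b : T} (hab : g a ≤ g b) :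
    f a ≤ f b := by
  by_contra hlt
  have hgeq : g a = g b := le_antisymm hab (h b a (not_le.1 hlt).le)
  have hfac : ∀ a b, f a = f b → g a = g b := fun a b e =>
    le_antisymm (h a b e.le) (h b a e.ge)
  -- `g` factors through `f` by `φ`, which maps the values of `f` onto those of `g`. There are no
  -- fewer of the latter, so `φ` is injective on the values of `f`.
  let φ : A → B := Function.extend f g fun _ => g a
  have hφ : ∀ a, φ (f a) = g a :=
    fun a => Function.FactorsThrough.extend_apply (fun a b e => hfac a b e) _ a
  have him : φ '' Set.range f = Set.range g := by
    rw [← Set.range_comp]; congr 1; funext a; exact hφ a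
  have hinj : Set.InjOn φ (Set.range f) := by
    apply Set.injOn_of_ncard_image_eq _ (Set.toFinite _)
    exact le_antisymm (Set.ncard_image_le (Set.toFinite _)) (him ▸ hc)
  have := hinj ⟨a, rfl⟩ ⟨b, rfl⟩ (by rw [hφ, hφ, hgeq])
  exact hlt this.le

lemma ncard_range_le {T A B : Type*} [Finite T] [LinearOrder A] [LinearOrder B]
    {f : T → A} {g : T → B} (h : ∀ a b, f a ≤ f b → g a ≤ g b) :
    (Set.range g).ncard ≤ (Set.range f).ncard := by
  rcases isEmpty_or_nonempty T with hT | ⟨⟨t⟩⟩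
  · simp [Set.range_eq_empty]
  let φ : A → B := Function.extend f g fun _ => g t
  have hφ : ∀ a, φ (f a) = g a :=
    fun a => Function.FactorsThrough.extend_apply (fun a b e =>
      le_antisymm (h a b e.le) (h b a e.ge)) _ a
  have him : φ '' Set.range f = Set.range g := by
    rw [← Set.range_comp]; congr 1; funext a; exact hφ a
  rw [← him]
  exact Set.ncard_image_le (Set.toFinite _)

variable [Finite κ]

lemma levels_le {x y : κ → ℝ} (h : x ∈ cone y) : levels x ≤ levels y := ncard_range_le h

lemma le_iff_of_levels_le {x y : κ → ℝ} (h : x ∈ cone y) (hl : levels y ≤ levels x)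
    (a b : Option κ) : homog x a ≤ homog x b ↔ homog y a ≤ homog y b :=
  ⟨fun hab => le_of_ncard_range_le h hl hab, h a b⟩

/-- Passing from `y` to a point of its cone only merges levels; if none is lost, the weak orders
agree. -/
lemma cone_eq_of_levels_le {x y : κ → ℝ} (h : x ∈ cone y) (hl : levels y ≤ levels x) :
    cone x = cone y := cone_eq_of_iff (le_iff_of_levels_le h hl)

lemma levels_eq_of_cone_eq {x y : κ → ℝ} (h : cone x = cone y) : levels x = levels y :=
  le_antisymm (levels_le (h ▸ mem_cone_self x)) (levels_le (h ▸ mem_cone_self y))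

/-- There are finitely many cones. -/
lemma finite_range_cone : (Set.range (cone : (κ → ℝ) → Set (κ → ℝ))).Finite := by
  have : Set.range (cone : (κ → ℝ) → Set (κ → ℝ)) ⊆
      Set.range (fun r : Option κ → Option κ → Prop =>
        {x : κ → ℝ | ∀ a b, r a b → homog x a ≤ homog x b}) := by
    rintro _ ⟨y, rfl⟩
    exact ⟨fun a b => homog y a ≤ homog y b, rfl⟩
  exact (Set.finite_range _).subset this

/-- The integral linear form of a homogeneous coordinate. -/
def coordForm (a : Option κ) : κ →₀ ℤ := a.elim 0 fun a => Finsupp.single a 1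

omit [Finite κ] in
lemma coordForm_sum (a : Option κ) (x : κ → ℝ) :
    ((coordForm a).sum fun b m => (m : ℝ) * x b) = homog x a := by
  cases a <;> simp [coordForm]

lemma isRationalPolyhedron_cone (y : κ → ℝ) : IsRationalPolyhedron (cone y) := by
  classical
  have : Fintype κ := Fintype.ofFinite κ
  refine ⟨(Finset.univ.filter fun p : Option κ × Option κ => homog y p.1 ≤ homog y p.2).image
    fun p => (coordForm p.1 - coordForm p.2, 0), ?_⟩
  ext x
  simp only [cone, Set.mem_ofPred_eq, Finset.mem_image, Finset.mem_filter, Finset.mem_univ,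
    true_and, forall_exists_index, and_imp, Prod.forall]
  have key : ∀ a b : Option κ, ((coordForm a - coordForm b).sum fun c m => (m : ℝ) * x c)
      = homog x a - homog x b := by
    intro a b
    rw [Finsupp.sum_sub_index (by intros; push_cast; ring), coordForm_sum, coordForm_sum]
  constructor
  · rintro h v c a b hab hv
    cases hv
    rw [key]
    linarith [h a b hab]
  · intro h a b hab
    have := h _ _ a b hab rfl
    rw [key] at this
    linarith

/-- The vectors that are constant on the levels of `y`. -/
def levelSpace (y : κ → ℝ) : Submodule ℝ (κ → ℝ) where
  carrier := {x | ∀ a b, homog y a = homog y b → homog x a = homog x b}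
  zero_mem' := by
    intro a b _
    cases a <;> cases b <;> simp
  add_mem' := by
    intro x x' hx hx' a b hab
    rw [homog_add, homog_add, hx a b hab, hx' a b hab]
  smul_mem' := by
    intro c x hx a b hab
    have := homog_smul c x
    change homog (fun b => c * x b) a = homog (fun b => c * x b) b
    rw [this, this, hx a b hab]

omit [Finite κ] in
lemma mem_levelSpace {x y : κ → ℝ} :
    x ∈ levelSpace y ↔ ∀ a b, homog y a = homog y b → homog x a = homog x b := Iff.rfl

/-- Small perturbations of `y` in a direction constant on its levels, or breaking ties of `y`
according to `y'`, stay in a cone. -/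
lemma exists_pos_add_smul_mem_cone {y y' w : κ → ℝ} (hy : y ∈ cone y')
    (hw : ∀ a b, homog y a = homog y b → homog y' a ≤ homog y' b → homog w a ≤ homog w b) :
    ∃ ε : ℝ, 0 < ε ∧ (fun a => y a + ε * w a) ∈ cone y' := by
  -- The finitely many strict inequalities of `y` survive a small perturbation; the ties are
  -- governed by `hw`.
  have : ∀ᶠ ε : ℝ in nhds 0, ∀ a b : Option κ, homog y a < homog y b →
      homog y a + ε * homog w a < homog y b + ε * homog w b := by
    rw [Filter.eventually_all]; intro a
    rw [Filter.eventually_all]; intro b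
    by_cases hab : homog y a < homog y b
    · have h1 : Filter.Tendsto (fun ε : ℝ => homog y b + ε * homog w b
          - (homog y a + ε * homog w a)) (nhds 0) (nhds (homog y b + 0 * homog w b
          - (homog y a + 0 * homog w a))) := by
        apply Continuous.tendsto' (by fun_prop)
        rfl
      have h2 := h1.eventually (lt_mem_nhds (a := 0) (by simpa using hab))
      filter_upwards [h2] with ε hε _
      linarith
    · exact Filter.Eventually.of_forall fun ε h => absurd h hab
  have h3 : ∀ᶠ ε : ℝ in nhdsWithin 0 (Set.Ioi 0), ∀ a b : Option κ, homog y a < homog y b →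
      homog y a + ε * homog w a < homog y b + ε * homog w b := this.filter_mono nhdsWithin_le_nhds
  obtain ⟨ε, h4, hε⟩ := (h3.and self_mem_nhdsWithin).exists
  refine ⟨ε, hε, fun a b hab => ?_⟩
  have he : ∀ a, homog (fun a => y a + ε * w a) a = homog y a + ε * homog w a := by
    intro a
    cases a <;> simp
  rw [he, he]
  rcases (hy a b hab).lt_or_eq with h | h
  · exact (h4 a b h).le
  · rw [h]
    have := hw a b h hab
    have hε' : (0 : ℝ) < ε := hε
    gcongr

/-- `y` is a relative interior point of its cone: one can move a little from it in every direction
that is constant on levels. -/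
lemma vectorSpan_cone (y : κ → ℝ) : vectorSpan ℝ (cone y) = levelSpace y := by
  apply le_antisymm
  · rw [vectorSpan_def, Submodule.span_le]
    rintro _ ⟨x, hx, x', hx', rfl⟩ a b hab
    change homog (x - x') a = homog (x - x') b
    rw [homog_sub, homog_sub, homog_eq_of_mem_cone hx hab,
      homog_eq_of_mem_cone hx' hab]
  · intro w hw
    obtain ⟨ε, hε, h⟩ := exists_pos_add_smul_mem_cone (w := w) (mem_cone_self y)
      (fun a b hab _ => (hw a b hab).le)
    have h1 := vsub_mem_vectorSpan ℝ h (mem_cone_self y)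
    have h2 : w = ε⁻¹ • ((fun a => y a + ε * w a) -ᵥ y) := by
      ext a
      simp
      field_simp
    rw [h2]
    exact Submodule.smul_mem _ _ h1

/-- One free value for each level, except that the level of `none` has value zero; this is the
difference of one. -/
lemma finrank_levelSpace (y : κ → ℝ) : Module.finrank ℝ (levelSpace y) + 1 = levels y := by
  classical
  have hfin : Finite (Set.range (homog y)) := Set.toFinite _
  have : Fintype κ := Fintype.ofFinite κ
  let V := {v : Set.range (homog y) // v.1 ≠ 0}
  have : Fintype V := Fintype.ofFinite V
  let e : (V → ℝ) ≃ₗ[ℝ] levelSpace y :=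
    { toFun := fun φ => ⟨fun a => if h : y a ≠ 0 then φ ⟨⟨y a, some a, rfl⟩, h⟩ else 0, by
        have key : ∀ a : Option κ, homog (fun a => if h : y a ≠ 0 then φ ⟨⟨y a, some a, rfl⟩, h⟩
            else 0) a = if h : homog y a ≠ 0 then φ ⟨⟨homog y a, a, rfl⟩, h⟩ else 0 := by
          intro a
          cases a
          · simp
          · rfl
        intro a b hab
        rw [key, key]
        simp only [hab]⟩
      map_add' := by
        intro φ ψ
        ext a
        by_cases h : y a = 0 <;> simp [h]
      map_smul' := by
        intro c φ
        ext a
        by_cases h : y a = 0 <;> simp [h]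
      invFun := fun w v => homog w.1 v.1.2.choose
      left_inv := by
        intro φ
        funext v
        obtain ⟨⟨v, hv⟩, hv0⟩ := v
        have h1 := hv.choose_spec
        simp only
        generalize hv.choose = o at h1
        subst h1
        cases o with
        | none => simp at hv0
        | some a =>
          simp only [homog_some] at hv0 ⊢
          rw [dif_pos hv0]
      right_inv := by
        intro w
        ext a
        by_cases h : y a = 0
        · have := w.2 (some a) none (by simpa using h)
          simp only [homog_some, homog_none] at this
          simp [h, this]
        · simp only [ne_eq, h, not_false_eq_true, dif_pos]
          have hv : ∃ o, homog y o = y a := ⟨some a, rfl⟩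
          exact w.2 _ (some a) hv.choose_spec }
  rw [← e.finrank_eq, Module.finrank_fintype_fun_eq_card, levels, Set.ncard_def,
    Set.encard_eq_coe_toFinset_card, Set.toFinset_card, ENat.toNat_natCast]
  have h0 : Fintype.card V = Fintype.card (Set.range (homog y)) - 1 := by
    have := Fintype.card_subtype_compl (fun v : Set.range (homog y) => v.1 = 0)
    have h1 : Fintype.card {v : Set.range (homog y) // v.1 = 0} = 1 := by
      rw [Fintype.card_eq_one_iff]
      exact ⟨⟨⟨0, none, rfl⟩, rfl⟩, fun v => Subtype.ext (Subtype.ext v.2)⟩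
    rw [h1] at this
    rw [← this]
  have h2 : 0 < Fintype.card (Set.range (homog y)) := Fintype.card_pos_iff.2 ⟨⟨0, none, rfl⟩⟩
  rw [h0]
  omega

lemma dim_cone (y : κ → ℝ) : dim (cone y) + 1 = levels y := by
  rw [dim, vectorSpan_cone, finrank_levelSpace]

lemma mem_lattice_cone {y : κ → ℝ} {u : κ → ℤ} :
    u ∈ lattice (cone y) ↔ ∀ a b, homog y a = homog y b → homog u a = homog u b := by
  change (fun a => (u a : ℝ)) ∈ vectorSpan ℝ (cone y) ↔ _
  rw [vectorSpan_cone, mem_levelSpace]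
  simp only [homog_intCast, Int.cast_inj]

/-- The coordinate `a` as a linear form. -/
def coordLin (a : Option κ) : (κ → ℝ) →ₗ[ℝ] ℝ := a.elim 0 fun a => LinearMap.proj a

omit [Finite κ] in
@[simp] lemma coordLin_apply (a : Option κ) (x : κ → ℝ) : coordLin a x = homog x a := by
  cases a <;> simp [coordLin]

/-- The faces of a cone are cones. -/
lemma exists_cone_of_isFace {y : κ → ℝ} {τ : Set (κ → ℝ)} (h : IsFace τ (cone y)) :
    ∃ x ∈ cone y, τ = cone x := by
  obtain ⟨⟨p, hp⟩, ℓ, c, hc, rfl⟩ := h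
  have hsmul : ∀ t : ℝ, 0 ≤ t → ∀ x ∈ cone y, t • x ∈ cone y := by
    intro t ht x hx a b hab
    have := homog_smul t x
    change homog (fun b => t * x b) a ≤ homog (fun b => t * x b) b
    rw [this, this]
    exact mul_le_mul_of_nonneg_left (hx a b hab) ht
  -- The maximum of a linear form on a set that contains the origin and is stable under scaling by
  -- two.
  have hc0 : c = 0 := by
    apply le_antisymm
    · have := hc _ (hsmul 2 (by norm_num) p hp.1)
      rw [map_smul, hp.2, smul_eq_mul] at this
      linarith
    · simpa using hc _ (zero_mem_cone y)
  subst hc0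
  -- A relative interior point of the face is found as one with the most strict inequalities: if
  -- another point of the face broke a tie of `x`, adding it to `x` would give more.
  let S : (κ → ℝ) → Set (Option κ × Option κ) := fun x => {q | homog x q.1 < homog x q.2}
  obtain ⟨x, ⟨hx, hxℓ⟩, hmax⟩ : ∃ x ∈ {x ∈ cone y | ℓ x = 0}, ∀ z ∈ {x ∈ cone y | ℓ x = 0},
      (S z).ncard ≤ (S x).ncard := by
    have hfin : ((fun z => (S z).ncard) '' {x ∈ cone y | ℓ x = 0}).Finite := by
      apply (Set.finite_Iic (Set.univ : Set (Option κ × Option κ)).ncard).subset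
      rintro _ ⟨z, -, rfl⟩
      exact Set.ncard_le_ncard (Set.subset_univ _) (Set.toFinite _)
    obtain ⟨x, hx, hm⟩ := Set.Finite.exists_maximalFor' (fun z => (S z).ncard) _ hfin ⟨p, hp⟩
    exact ⟨x, hx, fun z hz => (le_total _ _).elim id (fun h => hm hz h)⟩
  refine ⟨x, hx, Set.Subset.antisymm ?_ ?_⟩
  · rintro z ⟨hz, hzℓ⟩ a b hab
    by_contra hlt
    rw [not_le] at hlt
    have hyab : homog y b ≤ homog y a := by
      by_contra hcon
      exact absurd (hz a b (not_le.1 hcon).le) (not_le.2 hlt)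
    have hsub : S x ⊂ S (x + z) := by
      refine ⟨fun q hq => ?_, fun hcon => ?_⟩
      · have hq' : homog x q.1 < homog x q.2 := hq
        have h1 : homog y q.1 ≤ homog y q.2 := by
          by_contra hcon
          exact absurd (hx _ _ (not_le.1 hcon).le) (not_le.2 hq')
        change homog (x + z) q.1 < homog (x + z) q.2
        rw [homog_add, homog_add]
        linarith [hz _ _ h1]
      · have h1 : ((b, a) : Option κ × Option κ) ∈ S (x + z) := by
          change homog (x + z) b < homog (x + z) a
          rw [homog_add, homog_add]
          linarith [hx _ _ hyab]
        exact absurd hab (not_le.2 (hcon h1))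
    have h2 := hmax (x + z) ⟨add_mem_cone hx hz, by rw [map_add, hxℓ, hzℓ, add_zero]⟩
    exact absurd h2 (not_le.2 (Set.ncard_lt_ncard hsub (Set.toFinite _)))
  · intro z hz
    refine ⟨cone_subset hx hz, le_antisymm (hc z (cone_subset hx hz)) ?_⟩
    -- `x - ε z` is still in the cone of `y`, so the form is nonpositive there, which means `ℓ z ≥
    -- 0`.
    obtain ⟨ε, hε, h⟩ := exists_pos_add_smul_mem_cone (y := x) (y' := y) (w := -z) hx (by
      intro a b hab _
      have h1 := hz b a hab.ge
      have h2 : ∀ a, homog (-z) a = - homog z a := by intro a; cases a <;> simp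
      rw [h2, h2]
      linarith)
    have h1 := hc _ h
    have h2 : (fun a => x a + ε * (-z) a) = x - ε • z := by
      ext a
      simp [sub_eq_add_neg]
    rw [h2, map_sub, map_smul, hxℓ, smul_eq_mul] at h1
    nlinarith

/-- On the cone of `y` every difference `x_a - x_b` with `y_a ≤ y_b` is nonpositive. The sum of
those whose order is reversed or tied in `y'` attains its maximum zero exactly where all of them
vanish, that is, on the intersection. -/
lemma isFace_inter_cone (y y' : κ → ℝ) : IsFace (cone y ∩ cone y') (cone y) := by
  classical
  have : Fintype κ := Fintype.ofFinite κ
  refine ⟨⟨0, zero_mem_cone y, zero_mem_cone y'⟩, ?_⟩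
  let S := Finset.univ.filter fun q : Option κ × Option κ =>
    homog y q.1 ≤ homog y q.2 ∧ homog y' q.2 ≤ homog y' q.1
  refine ⟨∑ q ∈ S, (coordLin q.1 - coordLin q.2), 0, ?_, ?_⟩
  · intro x hx
    rw [LinearMap.sum_apply]
    apply Finset.sum_nonpos
    intro q hq
    have := hx _ _ (Finset.mem_filter.1 hq).2.1
    simp only [LinearMap.sub_apply, coordLin_apply]
    linarith
  · ext x
    simp only [Set.mem_inter_iff, Set.mem_ofPred_eq, LinearMap.sum_apply, LinearMap.sub_apply,
      coordLin_apply]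
    refine and_congr_right fun hx => ?_
    rw [Finset.sum_eq_zero_iff_of_nonpos (by
      intro q hq
      have := hx _ _ (Finset.mem_filter.1 hq).2.1
      linarith)]
    constructor
    · intro h q hq
      have h1 := hx _ _ (Finset.mem_filter.1 hq).2.1
      have h2 := h _ _ (Finset.mem_filter.1 hq).2.2
      linarith
    · intro h a b hab
      rcases le_total (homog y a) (homog y b) with h1 | h1
      · exact hx _ _ h1
      · have := h (b, a) (Finset.mem_filter.2 ⟨Finset.mem_univ _, h1, hab⟩)
        simp only at this
        linarith

/-- The fan of the cones of the points of `B`. -/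
def coneFan (B : Set (κ → ℝ)) : Finset (Set (κ → ℝ)) :=
  ((finite_range_cone (κ := κ)).subset (Set.image_subset_range cone B)).toFinset

lemma mem_coneFan {B : Set (κ → ℝ)} {σ : Set (κ → ℝ)} :
    σ ∈ coneFan B ↔ ∃ y ∈ B, cone y = σ := by
  simp [coneFan]

lemma isComplex_coneFan {B : Set (κ → ℝ)} (hB : ∀ y ∈ B, cone y ⊆ B) :
    IsComplex (coneFan B) where
  polyhedron := by
    intro σ hσ
    obtain ⟨y, -, rfl⟩ := mem_coneFan.1 hσ
    exact ⟨isRationalPolyhedron_cone y, y, mem_cone_self y⟩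
  face_mem := by
    intro σ hσ τ hτ
    obtain ⟨y, hy, rfl⟩ := mem_coneFan.1 hσ
    obtain ⟨x, hx, rfl⟩ := exists_cone_of_isFace hτ
    exact mem_coneFan.2 ⟨x, hB y hy hx, rfl⟩
  inter := by
    intro σ hσ τ hτ _
    obtain ⟨y, -, rfl⟩ := mem_coneFan.1 hσ
    obtain ⟨y', -, rfl⟩ := mem_coneFan.1 hτ
    refine ⟨isFace_inter_cone y y', ?_⟩
    rw [Set.inter_comm]
    exact isFace_inter_cone y' y

/-- Points with few different coordinates are negligible. -/
lemma sameCycle_of_forall_levels {ι : Type*} [Finite ι] {d : ℕ} {W W' : (ι → TT) → ℤ}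
    (h : ∀ (J : Set ι) (x : {a // a ∉ J} → ℝ), d < levels x → W (toT J x) = W' (toT J x)) :
    SameCycle d W W' := by
  intro J
  -- The number of levels is the dimension plus one, so these cones have dimension less than `d`.
  refine ⟨coneFan {x | levels x ≤ d}, ?_, ?_⟩
  · intro τ hτ
    obtain ⟨y, hy, rfl⟩ := mem_coneFan.1 hτ
    refine ⟨isRationalPolyhedron_cone y, ?_⟩
    have := dim_cone y
    have : levels y ≤ d := hy
    omega
  · intro x hx
    refine ⟨cone x, mem_coneFan.2 ⟨x, ?_, rfl⟩, mem_cone_self x⟩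
    by_contra hcon
    exact hx (h J x (not_le.1 hcon))

end Cones

end TropMod
end

noncomputable section

namespace TropMod

/-! ### Functions whose sublevel sets are flats -/

section Levels

variable {α T : Type*} {A : Type*} [LinearOrder A] {M : Matroid α} {lab : T → α}

/-- The sublevel sets of `h`, on a set `T` labelled by elements of `M`, are traces of flats. -/
def IsLev (M : Matroid α) (lab : T → α) (h : T → A) : Prop :=
  ∀ (S : Set T) (e : T), lab e ∈ M.closure (lab '' S) → ∃ a ∈ S, h e ≤ h a

lemma IsLev.coarsen {B : Type*} [LinearOrder B] {h : T → A} {g : T → B} (hh : IsLev M lab h)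
    (hg : ∀ a b, h a ≤ h b → g a ≤ g b) : IsLev M lab g := by
  intro S e he
  obtain ⟨a, ha, hea⟩ := hh S e he
  exact ⟨a, ha, hg _ _ hea⟩

omit [LinearOrder A] in
lemma exists_transversal [Finite T] (h : T → A) :
    ∃ S : Set T, Set.InjOn h S ∧ h '' S = Set.range h := by
  obtain ⟨S, -, hS⟩ := Set.SurjOn.exists_bijOn_subset (Set.surjOn_image h Set.univ)
  exact ⟨S, hS.injOn, by rw [hS.image_eq, Set.image_univ]⟩

/-- One element from each level gives an independent set: in a circuit, the element of largest value
would be in the closure of strictly lower ones. -/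
lemma IsLev.ncard_range_le [Finite T] {h : T → A} (hh : IsLev M lab h)
    (hlab : ∀ a, lab a ∈ M.E) : ((Set.range h).ncard : ℕ∞) ≤ M.eRank := by
  obtain ⟨S, hinj, him⟩ := exists_transversal h
  have hind : M.Indep (lab '' S) := by
    rw [Matroid.indep_iff_forall_subset_not_isCircuit
      (by rintro _ ⟨a, -, rfl⟩; exact hlab a)]
    intro C hCS hC
    have hne : (S ∩ lab ⁻¹' C).Nonempty := by
      obtain ⟨c, hc⟩ := hC.nonempty
      obtain ⟨s, hs, rfl⟩ := hCS hc
      exact ⟨s, hs, hc⟩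
    obtain ⟨s, hs, hmax⟩ := Set.exists_max_image _ h (Set.toFinite (S ∩ lab ⁻¹' C)) hne
    have hcl := hC.mem_closure_sdiff_singleton_of_mem hs.2
    have hsub : C \ {lab s} ⊆ lab '' ((S ∩ lab ⁻¹' C) \ {s}) := by
      rintro c ⟨hc, hcs⟩
      obtain ⟨t, ht, rfl⟩ := hCS hc
      exact ⟨t, ⟨⟨ht, hc⟩, fun hts => hcs (by rw [hts]; rfl)⟩, rfl⟩
    obtain ⟨a, ⟨ha, hne⟩, hle⟩ := hh _ s (M.closure_subset_closure hsub hcl)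
    exact hne (hinj ha.1 hs.1 (le_antisymm (hmax a ha) hle))
  have hlinj : Set.InjOn lab S := by
    intro a ha b hb hab
    apply hinj ha hb
    have key : ∀ a b : T, lab a = lab b → h a ≤ h b := by
      intro a b hab
      obtain ⟨c, hc, hle⟩ := hh {b} a
        (by rw [Set.image_singleton, hab]; exact M.mem_closure_self _ (hlab b))
      rwa [← Set.mem_singleton_iff.1 hc]
    exact le_antisymm (key a b hab) (key b a hab.symm)
  rw [← him, hinj.ncard_image, ← hlinj.ncard_image, (Set.toFinite _).cast_ncard_eq]
  exact hind.encard_le_eRank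

/-- The elements strictly below the level of `a`. -/
def below (h : T → A) (a : T) : Set T := {c | h c < h a}

/-- The elements on the level of `a` in the flat spanned by `a` and the lower levels. -/
def lowSet (M : Matroid α) (lab : T → α) (h : T → A) (a : T) : Set T :=
  {b | h b = h a ∧ lab b ∈ M.closure (lab '' insert a (below h a))}

/-- The rank increases by one at the level of `a`. -/
def IsTight (M : Matroid α) (lab : T → α) (h : T → A) (a : T) : Prop :=
  ∀ b, h b = h a → lab b ∈ M.closure (lab '' insert a (below h a))

lemma below_congr {h : T → A} {a b : T} (hab : h a = h b) : below h a = below h b := by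
  rw [below, below, hab]

lemma IsLev.notMem_closure_below {h : T → A} (hh : IsLev M lab h) {a b : T} (hab : h b ≤ h a) :
    lab a ∉ M.closure (lab '' below h b) := by
  intro hcon
  obtain ⟨c, hc, hle⟩ := hh _ _ hcon
  exact absurd (hab.trans hle) (not_le.2 hc)

lemma subset_closure_image (hlab : ∀ a, lab a ∈ M.E) (S : Set T) :
    lab '' S ⊆ M.closure (lab '' S) :=
  M.subset_closure _ (by rintro _ ⟨a, -, rfl⟩; exact hlab a)

lemma mem_lowSet_self (hlab : ∀ a, lab a ∈ M.E) (h : T → A) (a : T) : a ∈ lowSet M lab h a :=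
  ⟨rfl, subset_closure_image hlab _ ⟨a, Set.mem_insert _ _, rfl⟩⟩

/-- Exchange: `b` is in the flat spanned by `a` and the lower levels, but not in the one spanned by
the lower levels alone. Consequently the low sets partition each level. -/
lemma IsLev.closure_insert_eq {h : T → A} (hh : IsLev M lab h) {a b : T}
    (hb : b ∈ lowSet M lab h a) :
    M.closure (lab '' insert b (below h b)) = M.closure (lab '' insert a (below h a)) := by
  have h1 := hb.2
  have h2 := hh.notMem_closure_below (a := b) (b := a) hb.1.ge
  rw [below_congr hb.1]
  rw [Set.image_insert_eq] at h1 ⊢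
  rw [Set.image_insert_eq]
  exact M.closure_insert_congr ⟨h1, h2⟩

lemma IsLev.lowSet_eq {h : T → A} (hh : IsLev M lab h) {a b : T}
    (hb : b ∈ lowSet M lab h a) : lowSet M lab h b = lowSet M lab h a := by
  ext c
  rw [lowSet, lowSet, Set.mem_ofPred_eq, Set.mem_ofPred_eq, hh.closure_insert_eq hb, hb.1]

lemma IsLev.isTight_of_mem_lowSet {h : T → A} (hh : IsLev M lab h) {a b : T}
    (hb : b ∈ lowSet M lab h a) (ht : IsTight M lab h b) : IsTight M lab h a := by
  intro c hc
  rw [← hh.closure_insert_eq hb]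
  exact ht c (hc.trans hb.1.symm)

lemma IsLev.isTight_congr {h : T → A} (hh : IsLev M lab h) (hlab : ∀ a, lab a ∈ M.E) {a b : T}
    (hab : h a = h b) : IsTight M lab h a ↔ IsTight M lab h b := by
  have key : ∀ a b, h a = h b → IsTight M lab h a → IsTight M lab h b := by
    intro a b hab ht
    have hb : b ∈ lowSet M lab h a := ⟨hab.symm, ht b hab.symm⟩
    have ha : a ∈ lowSet M lab h b := by
      rw [hh.lowSet_eq hb]
      exact mem_lowSet_self hlab h a
    exact hh.isTight_of_mem_lowSet ha ht
  exact ⟨key a b hab, key b a hab.symm⟩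

/-- If every level were tight, a set of one representative per level would span, by induction along
the levels, and the rank would not exceed the number of levels. -/
lemma exists_not_isTight [Finite T] (h : T → A)
    (hspan : M.E ⊆ M.closure (Set.range lab)) (hr : ((Set.range h).ncard : ℕ∞) < M.eRank) :
    ∃ a, ¬ IsTight M lab h a := by
  by_contra! hcon
  obtain ⟨S, hinj, him⟩ := exists_transversal h
  have hmem : ∀ a, lab a ∈ M.E → lab a ∈ M.closure (lab '' S) := by
    have hwf : WellFounded (fun a b : T => h a < h b) :=
      @Finite.wellFounded_of_trans_of_irrefl _ _ _ ⟨fun _ _ _ => lt_trans⟩ ⟨fun _ => lt_irrefl _⟩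
    intro a
    induction a using hwf.induction with
    | _ a ih =>
      intro _
      obtain ⟨s, hs, hsa⟩ : h a ∈ h '' S := him ▸ ⟨a, rfl⟩
      have h1 := hcon s a hsa.symm
      rw [← M.closure_inter_ground] at h1
      refine M.closure_subset_closure_of_subset_closure ?_ h1
      rintro _ ⟨⟨c, hc, rfl⟩, hcE⟩
      rcases hc with rfl | hc
      · exact M.mem_closure_of_mem' ⟨c, hs, rfl⟩ hcE
      · exact ih c (lt_of_lt_of_eq hc hsa) hcE
  have h1 : M.E ⊆ M.closure (lab '' S) := by
    refine hspan.trans ?_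
    rw [← M.closure_inter_ground]
    apply M.closure_subset_closure_of_subset_closure
    rintro _ ⟨⟨c, rfl⟩, hcE⟩
    exact hmem c hcE
  have h2 : M.eRank ≤ (lab '' S).encard := by
    rw [← M.eRk_ground]
    refine (M.eRk_mono h1).trans ?_
    rw [M.eRk_closure_eq]
    exact M.eRk_le_encard _
  have h3 : (lab '' S).encard ≤ S.encard := Set.encard_image_le _ _
  rw [← him, hinj.ncard_image, (Set.toFinite S).cast_ncard_eq] at hr
  exact absurd (h2.trans h3) (not_le.2 hr)

/-- The order that refines `h` by putting the members of `L` below the others on their level. -/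
def RefinesBy {B : Type*} [LinearOrder B] (h : T → A) (L : Set T) (g : T → B) : Prop :=
  ∀ p q, g p ≤ g q ↔ h p < h q ∨ (h p = h q ∧ (q ∈ L → p ∈ L))

lemma RefinesBy.le {B : Type*} [LinearOrder B] {h : T → A} {L : Set T} {g : T → B}
    (hg : RefinesBy h L g) {p q : T} (hpq : g p ≤ g q) : h p ≤ h q :=
  ((hg p q).1 hpq).elim le_of_lt fun h => h.1.le

lemma exists_refinesBy [Finite T] (h : T → ℝ) (L : Set T) : ∃ g : T → ℝ, RefinesBy h L g := by
  classical
  have : ∀ᶠ ε : ℝ in nhdsWithin 0 (Set.Ioi 0), ∀ p q, h p < h q → h p + ε < h q := by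
    rw [Filter.eventually_all]; intro p
    rw [Filter.eventually_all]; intro q
    by_cases hpq : h p < h q
    · filter_upwards [nhdsWithin_le_nhds (Iio_mem_nhds (sub_pos.2 hpq))] with ε hε _
      have : ε < h q - h p := hε
      linarith
    · exact Filter.Eventually.of_forall fun ε h => absurd h hpq
  obtain ⟨ε, hε, hε0⟩ := (this.and self_mem_nhdsWithin).exists
  have hε0 : 0 < ε := hε0
  -- `ε` is smaller than every gap between values of `h`, so lowering `L` by it breaks ties only.
  refine ⟨fun p => h p - if p ∈ L then ε else 0, fun p q => ?_⟩
  rcases lt_trichotomy (h p) (h q) with hpq | hpq | hpq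
  · simp only [hpq, true_or, iff_true]
    have := hε p q hpq
    split_ifs <;> linarith
  · simp only [hpq, lt_irrefl, true_and, false_or]
    by_cases hp : p ∈ L <;> by_cases hq : q ∈ L <;> simp [hp, hq] <;> linarith
  · have := hε q p hpq
    simp only [hpq.not_gt, hpq.ne', false_and, or_false, iff_false, not_le]
    split_ifs <;> linarith

/-- The only new sublevel set is the trace of the flat spanned by `a` and the levels below it. -/
lemma IsLev.refine {B : Type*} [LinearOrder B] {h : T → A} (hh : IsLev M lab h)
    (hlab : ∀ a, lab a ∈ M.E) {a : T} {g : T → B} (hg : RefinesBy h (lowSet M lab h a) g) :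
    IsLev M lab g := by
  intro S e he
  by_contra! hcon
  have hlt : ∀ s ∈ S, h s < h e ∨ (h s = h e ∧ s ∈ lowSet M lab h a ∧ e ∉ lowSet M lab h a) := by
    intro s hs
    have h1 := hcon s hs
    rw [← not_le, hg] at h1
    push Not at h1
    rcases h1.1.lt_or_eq with h2 | h2
    · exact Or.inl h2
    · exact Or.inr ⟨h2, h1.2 h2.symm⟩
  by_cases hea : h e = h a
  · by_cases hel : e ∈ lowSet M lab h a
    · obtain ⟨s, hs, hes⟩ := hh S e he
      rcases hlt s hs with h1 | h1
      · exact absurd h1 (not_lt.2 hes)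
      · exact h1.2.2 hel
    · refine hel ⟨hea, ?_⟩
      refine M.closure_subset_closure_of_subset_closure ?_ he
      rintro _ ⟨s, hs, rfl⟩
      rcases hlt s hs with h1 | h1
      · exact subset_closure_image hlab _ ⟨s, Or.inr (lt_of_lt_of_eq h1 hea), rfl⟩
      · exact h1.2.1.2
  · obtain ⟨s, hs, hes⟩ := hh S e he
    rcases hlt s hs with h1 | h1
    · exact absurd h1 (not_lt.2 hes)
    · exact hea (h1.1.symm.trans h1.2.1.1)

lemma RefinesBy.ncard_lt {B : Type*} [LinearOrder B] [Finite T] {h : T → A}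
    (hlab : ∀ a, lab a ∈ M.E) {a : T} {g : T → B} (hg : RefinesBy h (lowSet M lab h a) g)
    (ha : ¬ IsTight M lab h a) : (Set.range h).ncard < (Set.range g).ncard := by
  by_contra! hcon
  rw [IsTight] at ha
  push Not at ha
  obtain ⟨b, hb, hb'⟩ := ha
  have h1 := le_of_ncard_range_le (fun p q => hg.le (p := p) (q := q)) hcon hb.le
  rw [hg] at h1
  rcases h1 with h1 | h1
  · exact h1.ne hb
  · exact hb' (h1.2 (mem_lowSet_self hlab h a)).2

/-- A level that is not tight could be split, giving more levels than the rank. -/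
lemma IsLev.isTight_of_ncard [Finite T] {h : T → ℝ} (hh : IsLev M lab h)
    (hlab : ∀ a, lab a ∈ M.E) (hr : M.eRank ≤ (Set.range h).ncard) (a : T) :
    IsTight M lab h a := by
  by_contra hcon
  obtain ⟨g, hg⟩ := exists_refinesBy h (lowSet M lab h a)
  have h1 := (hh.refine hlab hg).ncard_range_le hlab
  have h2 := hg.ncard_lt hlab hcon
  have h3 := h1.trans hr
  rw [Nat.cast_le] at h3
  omega

/-- The maximal refinements of a function with one level less than the rank. -/
lemma IsLev.exists_refinesBy_lowSet [Finite T] {h g : T → ℝ} (hh : IsLev M lab h)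
    (hlab : ∀ a, lab a ∈ M.E) (hspan : M.E ⊆ M.closure (Set.range lab))
    (hr : M.eRank = ((Set.range h).ncard + 1 : ℕ)) (hg : IsLev M lab g)
    (hgr : M.eRank = (Set.range g).ncard) (hgh : ∀ p q, g p ≤ g q → h p ≤ h q) :
    ∃ b, ¬ IsTight M lab h b ∧ RefinesBy h (lowSet M lab h b) g := by
  obtain ⟨a, ha⟩ := exists_not_isTight h hspan (by rw [hr]; exact_mod_cast Nat.lt_succ_self _)
  -- `b` is lowest for `g` on a level of `h` that is not tight. All levels of `g` are tight, so the
  -- part of this level tied with `b` in `g` is exactly the low set of `b`.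
  obtain ⟨b, hb, hmin⟩ := Set.exists_min_image {b | h b = h a} g (Set.toFinite _) ⟨a, rfl⟩
  have hb : h b = h a := hb
  have hbt : ¬ IsTight M lab h b := by rwa [hh.isTight_congr hlab hb]
  refine ⟨b, hbt, ?_⟩
  have hbelow : below g b = below h b := by
    ext d
    change g d < g b ↔ h d < h b
    constructor
    · intro h1
      refine lt_of_le_of_ne (hgh _ _ h1.le) fun h2 => ?_
      exact absurd (hmin d (h2.trans hb)) (not_le.2 h1)
    · intro h1
      by_contra h2
      exact absurd (hgh _ _ (not_lt.1 h2)) (not_le.2 h1)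
  have hlow : ∀ c, h c = h b → (c ∈ lowSet M lab h b ↔ g c ≤ g b) := by
    intro c hc
    constructor
    · intro h1
      obtain ⟨s, hs, hcs⟩ := hg _ _ h1.2
      rcases hs with rfl | hs
      · exact hcs
      · exact absurd ((hgh _ _ hcs).trans_lt hs) (by rw [hc]; exact lt_irrefl _)
    · intro h1
      have h2 : g c = g b := le_antisymm h1 (hmin c (hc.trans hb))
      refine ⟨hc, ?_⟩
      rw [← hbelow]
      exact hg.isTight_of_ncard hlab hgr.le b c h2
  obtain ⟨g', hg'⟩ := exists_refinesBy h (lowSet M lab h b)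
  have hgg' : ∀ p q, g p ≤ g q → g' p ≤ g' q := by
    intro p q hpq
    rw [hg']
    rcases (hgh p q hpq).lt_or_eq with h1 | h1
    · exact Or.inl h1
    · refine Or.inr ⟨h1, fun hq => ?_⟩
      rw [hlow p (h1.trans hq.1)]
      exact hpq.trans ((hlow q hq.1).1 hq)
  -- `g'` has more levels than `h`, hence at least as many as `g`; as `g` refines `g'`, the two
  -- orders coincide.
  have hcard : (Set.range g).ncard ≤ (Set.range g').ncard := by
    have h1 := hg'.ncard_lt hlab hbt
    have h2 : ((Set.range g).ncard : ℕ∞) = ((Set.range h).ncard + 1 : ℕ) := hgr.symm.trans hr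
    rw [Nat.cast_inj] at h2
    omega
  intro p q
  rw [← hg']
  exact ⟨hgg' p q, le_of_ncard_range_le hgg' hcard⟩

end Levels

end TropMod
end

noncomputable section

namespace TropMod

/-! ### The fan of a matroid is an effective cycle -/

section Fan

variable {α κ : Type*} {N : Matroid α} {lab : Option κ → α}

/-- The points whose homogeneous coordinates have flats as sublevel sets. -/
def levPoints (N : Matroid α) (lab : Option κ → α) : Set (κ → ℝ) := {y | IsLev N lab (homog y)}

lemma levPoints_cone {y : κ → ℝ} (hy : y ∈ levPoints N lab) : cone y ⊆ levPoints N lab :=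
  fun _ hx => IsLev.coarsen hy hx

/-- The elements of lower order in the block of `E` that is split by `F`. -/
def lowPart (E F : Set (κ → ℝ)) : Set (Option κ) :=
  {b | ∃ c, (∀ x ∈ E, homog x b = homog x c) ∧ ∃ x ∈ F, homog x b < homog x c}

open Classical in
/-- The primitive vector from `E` into `F`. -/
def normalVec (E F : Set (κ → ℝ)) : κ → ℤ := dehomog fun b => if b ∈ lowPart E F then -1 else 0

/-- Primitive vectors are indexed by faces, so `lowPart` mentions only sets; here it is read off at
representatives of the two cones. -/
lemma mem_lowPart_cone {y y' : κ → ℝ} {b : Option κ} :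
    b ∈ lowPart (cone y) (cone y') ↔ ∃ c, homog y b = homog y c ∧ homog y' b < homog y' c := by
  refine exists_congr fun c => and_congr ⟨fun h => h y (mem_cone_self y),
    fun h x hx => homog_eq_of_mem_cone hx h⟩ ⟨?_, fun h => ⟨y', mem_cone_self y', h⟩⟩
  rintro ⟨x, hx, hlt⟩
  by_contra hcon
  exact absurd (hx _ _ (not_lt.1 hcon)) (not_le.2 hlt)

/-- On a tight level the splitting is trivial and `lowPart` would be empty; this is the role of
`hb`. -/
lemma lowPart_eq_lowSet {y y' : κ → ℝ} {b : Option κ}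
    (hb : ¬ IsTight N lab (homog y) b)
    (hr : RefinesBy (homog y) (lowSet N lab (homog y) b) (homog y')) :
    lowPart (cone y) (cone y') = lowSet N lab (homog y) b := by
  ext p
  rw [mem_lowPart_cone]
  constructor
  · rintro ⟨c, hpc, hlt⟩
    rw [← not_le, hr] at hlt
    push Not at hlt
    exact (hlt.2 hpc.symm).1
  · intro hp
    rw [IsTight] at hb
    push Not at hb
    obtain ⟨c, hc, hc'⟩ := hb
    refine ⟨c, hp.1.trans hc.symm, ?_⟩
    rw [← not_le, hr]
    rintro (h | h)
    · exact h.ne (hc.trans hp.1.symm)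
    · exact hc' (h.2 hp).2

lemma homog_dehomog_le_iff (g : Option κ → ℝ) (a b : Option κ) :
    homog (dehomog g) a ≤ homog (dehomog g) b ↔ g a ≤ g b := by
  rw [homog_dehomog, homog_dehomog, sub_le_sub_iff_right]

variable [Finite κ]

lemma exists_refinement (hlab : ∀ a, lab a ∈ N.E) {y : κ → ℝ} (hy : y ∈ levPoints N lab)
    {a : Option κ} (ha : ¬ IsTight N lab (homog y) a) :
    ∃ y' ∈ levPoints N lab, y ∈ cone y' ∧ levels y < levels y' ∧
      RefinesBy (homog y) (lowSet N lab (homog y) a) (homog y') := by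
  obtain ⟨g, hg⟩ := exists_refinesBy (homog y) (lowSet N lab (homog y) a)
  have hg' : RefinesBy (homog y) (lowSet N lab (homog y) a) (homog (dehomog g)) := by
    intro p q
    rw [homog_dehomog_le_iff]
    exact hg p q
  exact ⟨dehomog g, IsLev.refine hy hlab hg', fun p q => hg'.le, hg'.ncard_lt hlab ha, hg'⟩

lemma levels_le_of_levPoints (hlab : ∀ a, lab a ∈ N.E) {r : ℕ} (hr : N.eRank = r)
    {y : κ → ℝ} (hy : y ∈ levPoints N lab) : levels y ≤ r := by
  have h := IsLev.ncard_range_le hy hlab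
  rw [hr, Nat.cast_le] at h
  exact h

/-- Purity of the fan: as long as there are fewer levels than the rank, some level can be split. -/
lemma exists_maximal_refinement (hlab : ∀ a, lab a ∈ N.E)
    (hspan : N.E ⊆ N.closure (Set.range lab)) {r : ℕ} (hr : N.eRank = r)
    {y : κ → ℝ} (hy : y ∈ levPoints N lab) :
    ∃ y' ∈ levPoints N lab, y ∈ cone y' ∧ levels y' = r := by
  induction hn : r - levels y using Nat.strong_induction_on generalizing y with
  | _ n ih =>
    have hle := levels_le_of_levPoints hlab hr hy
    rcases hle.lt_or_eq with hlt | heq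
    · obtain ⟨a, ha⟩ := exists_not_isTight (homog y) hspan (by rw [hr]; exact_mod_cast hlt)
      obtain ⟨y', hy', hyy', hlev, -⟩ := exists_refinement hlab hy ha
      obtain ⟨z, hz, hyz, hzl⟩ := ih (r - levels y') (by omega) hy' rfl
      exact ⟨z, hz, cone_subset hyz hyy', hzl⟩
    · exact ⟨y, hy, mem_cone_self y, heq⟩

/-- A lattice vector of the finer cone takes two values on the split level, `w_b` on the lower half
and `w_c` on the upper one. Subtracting `w_c - w_b` times the normal vector makes them equal, so the
normal vector generates the quotient of the lattices. -/
lemma isPrimitiveVector_normalVec (hlab : ∀ a, lab a ∈ N.E) {y y' : κ → ℝ} {b : Option κ}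
    (hb : ¬ IsTight N lab (homog y) b)
    (hr : RefinesBy (homog y) (lowSet N lab (homog y) b) (homog y')) :
    IsPrimitiveVector (cone y) (cone y') (normalVec (cone y) (cone y')) := by
  classical
  have hv : ∀ a, homog (normalVec (cone y) (cone y')) a
      = (if a ∈ lowSet N lab (homog y) b then -1 else 0)
        - (if none ∈ lowSet N lab (homog y) b then -1 else 0) := by
    intro a
    rw [normalVec, homog_dehomog, lowPart_eq_lowSet hb hr]
  have hb' := hb
  rw [IsTight] at hb'
  push Not at hb'
  obtain ⟨c, hc, hc'⟩ := hb'
  have hcl : c ∉ lowSet N lab (homog y) b := fun h => hc' h.2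
  have heq : ∀ p q, homog y p = homog y q →
      (p ∈ lowSet N lab (homog y) b ↔ q ∈ lowSet N lab (homog y) b) →
      homog y' p = homog y' q := by
    intro p q hpq h
    apply le_antisymm
    · rw [hr]; exact Or.inr ⟨hpq, h.2⟩
    · rw [hr]; exact Or.inr ⟨hpq.symm, h.1⟩
  have hsub : y ∈ cone y' := fun p q => hr.le
  refine ⟨le_antisymm ?_ ?_, ?_⟩
  · intro w hw
    rw [mem_lattice_cone] at hw
    rw [AddSubgroup.mem_sup]
    refine ⟨w - (homog w c - homog w b) • normalVec (cone y) (cone y'), ?_,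
      (homog w c - homog w b) • normalVec (cone y) (cone y'),
      AddSubgroup.zsmul_mem_zmultiples _ _, by abel⟩
    rw [mem_lattice_cone]
    have key : ∀ p q, homog y p = homog y q → p ∈ lowSet N lab (homog y) b →
        q ∉ lowSet N lab (homog y) b → homog w q - homog w p = homog w c - homog w b := by
      intro p q hpq hp hq
      rw [hw p b (heq p b hp.1 (by simp [hp, mem_lowSet_self hlab])),
        hw q c (heq q c (hpq.symm.trans (hp.1.trans hc.symm)) (by simp [hq, hcl]))]
    have hcoord : ∀ p, homog (w - (homog w c - homog w b) • normalVec (cone y) (cone y')) p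
        = homog w p - (homog w c - homog w b) * homog (normalVec (cone y) (cone y')) p := by
      intro p
      cases p <;> simp
    intro p q hpq
    rw [hcoord, hcoord, hv, hv]
    by_cases hp : p ∈ lowSet N lab (homog y) b <;> by_cases hq : q ∈ lowSet N lab (homog y) b
    · simp only [hp, hq, if_true]
      rw [hw p q (heq p q hpq (by simp [hp, hq]))]
    · have := key p q hpq hp hq
      simp only [hp, hq, if_true, if_false]
      linarith
    · have := key q p hpq.symm hq hp
      simp only [hp, hq, if_true, if_false]
      linarith
    · simp only [hp, hq, if_false]
      rw [hw p q (heq p q hpq (by simp [hp, hq]))]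
  · rw [sup_le_iff, AddSubgroup.zmultiples_le]
    constructor
    · intro w hw
      rw [mem_lattice_cone] at hw ⊢
      intro p q hpq
      exact hw p q (homog_eq_of_mem_cone hsub hpq)
    · rw [mem_lattice_cone]
      intro p q hpq
      rw [hv, hv]
      have h1 : p ∈ lowSet N lab (homog y) b ↔ q ∈ lowSet N lab (homog y) b := by
        have h2 := (hr p q).1 hpq.le
        have h3 := (hr q p).1 hpq.ge
        have h4 := homog_eq_of_mem_cone hsub hpq
        simp only [h4, lt_irrefl, false_or, true_and] at h2 h3
        exact ⟨h3, h2⟩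
      simp only [h1]
  · obtain ⟨ε, hε, h⟩ := exists_pos_add_smul_mem_cone
      (w := fun a => (normalVec (cone y) (cone y') a : ℝ)) hsub (by
        intro p q hpq hle
        rw [homog_intCast, homog_intCast, hv, hv, Int.cast_le]
        have h2 := (hr p q).1 hle
        simp only [hpq, lt_irrefl, false_or, true_and] at h2
        by_cases hq : q ∈ lowSet N lab (homog y) b
        · simp [hq, h2 hq]
        · simp only [hq, if_false]
          split_ifs <;> simp)
    exact ⟨y, mem_cone_self y, ε, hε, h⟩

open Classical in
/-- The facets of a complex. -/
def facets (k : ℕ) (K : Finset (Set (κ → ℝ))) : Finset (Set (κ → ℝ)) := K.filter fun σ => dim σ = k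

/-- The chain of all facets, with weight one. -/
def facetChain (k : ℕ) (K : Finset (Set (κ → ℝ))) : Chain κ :=
  Finsupp.indicator (facets k K) fun _ _ => 1

omit [Finite κ] in
lemma facetChain_apply_of_mem {k : ℕ} {K : Finset (Set (κ → ℝ))} {σ : Set (κ → ℝ)}
    (h : σ ∈ facets k K) : facetChain k K σ = 1 := by
  rw [facetChain, Finsupp.indicator_of_mem h]

omit [Finite κ] in
lemma support_facetChain (k : ℕ) (K : Finset (Set (κ → ℝ))) :
    (facetChain k K).support = facets k K := by
  ext σ
  rw [Finsupp.mem_support_iff]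
  by_cases h : σ ∈ facets k K
  · simp [h, facetChain_apply_of_mem h]
  · simp [h, facetChain]

omit [Finite κ] in
lemma facetChain_sum {A : Type*} [AddCommMonoid A] (k : ℕ) (K : Finset (Set (κ → ℝ)))
    (f : Set (κ → ℝ) → ℤ → A) : (facetChain k K).sum f = ∑ σ ∈ facets k K, f σ 1 := by
  rw [Finsupp.sum, support_facetChain]
  exact Finset.sum_congr rfl fun σ hσ => by rw [facetChain_apply_of_mem hσ]

/-- The Bergman fan of `N` in its finite stratum, with the fine subdivision. -/
def levFan (N : Matroid α) (lab : Option κ → α) : Finset (Set (κ → ℝ)) :=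
  coneFan (levPoints N lab)

lemma mem_facets_levFan {k : ℕ} {σ : Set (κ → ℝ)} :
    σ ∈ facets k (levFan N lab) ↔ ∃ y ∈ levPoints N lab, levels y = k + 1 ∧ cone y = σ := by
  classical
  rw [facets, Finset.mem_filter, levFan, mem_coneFan]
  constructor
  · rintro ⟨⟨y, hy, rfl⟩, hd⟩
    exact ⟨y, hy, by rw [← dim_cone, hd], rfl⟩
  · rintro ⟨y, hy, hl, rfl⟩
    refine ⟨⟨y, hy, rfl⟩, ?_⟩
    have := dim_cone y
    omega

lemma exists_of_mem_facets {k : ℕ} (hlab : ∀ a, lab a ∈ N.E)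
    (hspan : N.E ⊆ N.closure (Set.range lab)) (hr : N.eRank = (k + 1 : ℕ))
    {y : κ → ℝ} (hy : y ∈ levPoints N lab) (hl : levels y = k) {F : Set (κ → ℝ)}
    (hF : F ∈ facets k (levFan N lab)) (hyF : cone y ⊆ F) :
    ∃ y' ∈ levPoints N lab, levels y' = k + 1 ∧ cone y' = F ∧ ∃ b,
      ¬ IsTight N lab (homog y) b ∧
      RefinesBy (homog y) (lowSet N lab (homog y) b) (homog y') ∧
      lowPart (cone y) F = lowSet N lab (homog y) b := by
  obtain ⟨y', hy', hl', rfl⟩ := mem_facets_levFan.1 hF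
  obtain ⟨b, hb, hr⟩ := IsLev.exists_refinesBy_lowSet hy hlab hspan
    (by change N.eRank = (levels y + 1 : ℕ); rw [hr, hl]) hy'
    (by change N.eRank = levels y'; rw [hr, hl']) (cone_subset_iff.1 hyF)
  exact ⟨y', hy', hl', rfl, b, hb, hr, lowPart_eq_lowSet hb hr⟩

open Classical in
-- Facets around the ridge correspond to splittings into low sets, which partition a level that is
-- not tight: each of its elements is in exactly one lower half, while elements of tight levels are
-- in none.
lemma sum_lowPart {k : ℕ} (hlab : ∀ a, lab a ∈ N.E)
    (hspan : N.E ⊆ N.closure (Set.range lab)) (hr : N.eRank = (k + 1 : ℕ))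
    {y : κ → ℝ} (hy : y ∈ levPoints N lab) (hl : levels y = k) (c : Option κ) :
    (∑ F ∈ facets k (levFan N lab), if cone y ⊆ F ∧ c ∈ lowPart (cone y) F then (1 : ℤ) else 0)
      = if IsTight N lab (homog y) c then 0 else 1 := by
  split_ifs with hc
  · apply Finset.sum_eq_zero
    intro F hF
    rw [if_neg]
    rintro ⟨hyF, hcF⟩
    obtain ⟨y', hy', hl', rfl, b, hb, hr, hlow⟩ := exists_of_mem_facets hlab hspan hr hy hl hF hyF
    rw [hlow] at hcF
    exact hb (IsLev.isTight_of_mem_lowSet hy hcF hc)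
  · obtain ⟨y', hy', hyy', hlt, href⟩ := exists_refinement hlab hy hc
    have hle := levels_le_of_levPoints hlab hr hy'
    rw [Finset.sum_eq_single (cone y')]
    · rw [if_pos]
      exact ⟨cone_subset hyy', by
        rw [lowPart_eq_lowSet hc href]; exact mem_lowSet_self hlab _ _⟩
    · intro F hF hne
      rw [if_neg]
      rintro ⟨hyF, hcF⟩
      obtain ⟨y₁, hy₁, hl₁, rfl, b, hb, hr₁, hlow⟩ :=
        exists_of_mem_facets hlab hspan hr hy hl hF hyF
      rw [hlow] at hcF
      rw [← IsLev.lowSet_eq hy hcF] at hr₁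
      exact hne (cone_eq_of_iff fun p q => by rw [hr₁ p q, href p q])
    · intro h
      exact absurd (mem_facets_levFan.2 ⟨y', hy', by omega, rfl⟩) h

omit [Finite κ] in
lemma homog_finsetSum {β : Type*} (s : Finset β) (x : β → κ → ℤ) (a : Option κ) :
    homog (∑ i ∈ s, x i) a = ∑ i ∈ s, homog (x i) a := by
  cases a <;> simp

open Classical in
lemma homog_sum_normalVec {k : ℕ} (hlab : ∀ a, lab a ∈ N.E)
    (hspan : N.E ⊆ N.closure (Set.range lab)) (hr : N.eRank = (k + 1 : ℕ))
    {y : κ → ℝ} (hy : y ∈ levPoints N lab) (hl : levels y = k) (c : Option κ) :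
    homog ((facetChain k (levFan N lab)).sum
      fun F n => if cone y ⊆ F then n • normalVec (cone y) F else 0) c
      = (if IsTight N lab (homog y) none then 0 else 1)
        - (if IsTight N lab (homog y) c then 0 else 1) := by
  rw [← sum_lowPart hlab hspan hr hy hl, ← sum_lowPart hlab hspan hr hy hl, facetChain_sum,
    homog_finsetSum, ← Finset.sum_sub_distrib]
  refine Finset.sum_congr rfl fun F _ => ?_
  by_cases hF : cone y ⊆ F
  · simp only [hF, if_true, true_and, one_smul, normalVec, homog_dehomog]
    split_ifs <;> simp
  · simp only [hF, if_false, false_and]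
    cases c <;> simp

open Classical in
-- Balancing: the coordinates of the sum depend only on whether the level is tight, so they are
-- constant on levels.
lemma sum_normalVec_mem_lattice {k : ℕ} (hlab : ∀ a, lab a ∈ N.E)
    (hspan : N.E ⊆ N.closure (Set.range lab)) (hr : N.eRank = (k + 1 : ℕ))
    {y : κ → ℝ} (hy : y ∈ levPoints N lab) (hl : levels y = k) :
    ((facetChain k (levFan N lab)).sum
      fun F n => if cone y ⊆ F then n • normalVec (cone y) F else 0) ∈ lattice (cone y) := by
  rw [mem_lattice_cone]
  intro a b hab
  rw [homog_sum_normalVec hlab hspan hr hy hl, homog_sum_normalVec hlab hspan hr hy hl]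
  simp only [IsLev.isTight_congr hy hlab hab]

lemma isPrimitiveVector_of_mem_facets {k : ℕ} (hlab : ∀ a, lab a ∈ N.E)
    (hspan : N.E ⊆ N.closure (Set.range lab)) (hr : N.eRank = (k + 1 : ℕ))
    {y : κ → ℝ} (hy : y ∈ levPoints N lab) (hl : levels y = k) {F : Set (κ → ℝ)}
    (hF : F ∈ facets k (levFan N lab)) (hyF : cone y ⊆ F) :
    IsPrimitiveVector (cone y) F (normalVec (cone y) F) := by
  obtain ⟨y', hy', hl', rfl, b, hb, hr, -⟩ := exists_of_mem_facets hlab hspan hr hy hl hF hyF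
  exact isPrimitiveVector_normalVec hlab hb hr

lemma isEffectiveCycle_levFan {k : ℕ} (hlab : ∀ a, lab a ∈ N.E)
    (hspan : N.E ⊆ N.closure (Set.range lab)) (hr : N.eRank = (k + 1 : ℕ)) :
    IsEffectiveCycle k (levFan N lab) (facetChain k (levFan N lab)) where
  isComplex := isComplex_coneFan fun _ hy => levPoints_cone hy
  pure := by
    intro σ hσ
    obtain ⟨y, hy, rfl⟩ := mem_coneFan.1 hσ
    obtain ⟨y', hy', hyy', hl⟩ := exists_maximal_refinement hlab hspan hr hy
    refine ⟨cone y', mem_coneFan.2 ⟨y', hy', rfl⟩, ?_, cone_subset hyy'⟩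
    have := dim_cone y'
    omega
  weight_mem := by
    intro τ hτ
    rw [support_facetChain, facets, Finset.mem_filter] at hτ
    exact hτ
  weight_pos := by
    intro τ hτ hd
    rw [facetChain_apply_of_mem (by rw [facets, Finset.mem_filter]; exact ⟨hτ, hd⟩)]
    exact one_pos
  balanced := by
    intro E hE hd
    obtain ⟨y, hy, rfl⟩ := mem_coneFan.1 hE
    have hl : levels y = k := by rw [← dim_cone, hd]
    refine ⟨normalVec (cone y), ?_, sum_normalVec_mem_lattice hlab hspan hr hy hl⟩
    intro F hF hyF
    rw [support_facetChain] at hF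
    exact isPrimitiveVector_of_mem_facets hlab hspan hr hy hl hF hyF

end Fan

end TropMod
end

noncomputable section

namespace TropMod

/-! ### Modifications along piecewise integral linear functions -/

section Pairing

variable {κ : Type*}

/-- The value of an integral linear form. -/
def pairing {R : Type*} [CommRing R] (m : κ →₀ ℤ) (x : κ → R) : R := m.sum fun a n => (n : R) * x a

lemma pairing_add_left {R : Type*} [CommRing R] (m m' : κ →₀ ℤ) (x : κ → R) :
    pairing (m + m') x = pairing m x + pairing m' x :=
  Finsupp.sum_add_index' (by simp) (by intros; push_cast; ring)

lemma pairing_sub_left {R : Type*} [CommRing R] (m m' : κ →₀ ℤ) (x : κ → R) :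
    pairing (m - m') x = pairing m x - pairing m' x :=
  Finsupp.sum_sub_index (by intros; push_cast; ring)

lemma pairing_finsetSum_left {R β : Type*} [CommRing R] (s : Finset β) (m : β → κ →₀ ℤ)
    (x : κ → R) : pairing (∑ i ∈ s, m i) x = ∑ i ∈ s, pairing (m i) x := by
  classical
  induction s using Finset.induction_on with
  | empty => simp [pairing]
  | insert i s hi ih => rw [Finset.sum_insert hi, Finset.sum_insert hi, pairing_add_left, ih]

lemma pairing_add {R : Type*} [CommRing R] (m : κ →₀ ℤ) (x y : κ → R) :
    pairing m (x + y) = pairing m x + pairing m y := by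
  rw [pairing, pairing, pairing, ← Finsupp.sum_add]
  exact Finsupp.sum_congr fun a _ => by rw [Pi.add_apply]; ring

lemma pairing_smul {R : Type*} [CommRing R] (m : κ →₀ ℤ) (c : R) (x : κ → R) :
    pairing m (c • x) = c * pairing m x := by
  rw [pairing, pairing, Finsupp.mul_sum]
  exact Finsupp.sum_congr fun a _ => by rw [Pi.smul_apply, smul_eq_mul]; ring

lemma pairing_intCast (m : κ →₀ ℤ) (u : κ → ℤ) :
    pairing m (fun a => (u a : ℝ)) = ((pairing m u : ℤ) : ℝ) := by
  simp [pairing, Finsupp.sum]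

lemma pairing_coordForm {R : Type*} [CommRing R] (a : Option κ) (x : κ → R) :
    pairing (coordForm a) x = homog x a := by
  cases a <;> simp [coordForm, pairing]

/-- `pairing` as a linear map. -/
def pairingLin (m : κ →₀ ℤ) : (κ → ℝ) →ₗ[ℝ] ℝ where
  toFun := pairing m
  map_add' := pairing_add m
  map_smul' := pairing_smul m

end Pairing

/-! ### Lattices, primitive vectors and balancing for graphs and undergraphs -/

section Graph

variable {ι : Type*} {I : Set ι}

/-- The point over `x` with last coordinate `t`. -/
def addCoord {R : Type*} (x : {a // a ∉ I} → R) (t : R) : {b : Option ι // b ∉ some '' I} → R :=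
  fun b => match b with
  | ⟨none, _⟩ => t
  | ⟨some a, h⟩ => x ⟨a, fun ha => h ⟨a, ha, rfl⟩⟩

/-- Forgetting the last coordinate of a lattice vector. -/
def latticeBase (u : {b : Option ι // b ∉ some '' I} → ℤ) : {a // a ∉ I} → ℤ :=
  fun a => u ⟨some a.1, by simpa using a.2⟩

/-- The last coordinate of a lattice vector. -/
def latticeHeight (u : {b : Option ι // b ∉ some '' I} → ℤ) : ℤ := u ⟨none, by simp⟩

@[simp] lemma base_addCoord (x : {a // a ∉ I} → ℝ) (t : ℝ) : base (addCoord x t) = x := rfl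

@[simp] lemma height_addCoord (x : {a // a ∉ I} → ℝ) (t : ℝ) : height (addCoord x t) = t := rfl

@[simp] lemma latticeBase_addCoord (x : {a // a ∉ I} → ℤ) (t : ℤ) :
    latticeBase (addCoord x t) = x := rfl

lemma addCoord_base (y : {b : Option ι // b ∉ some '' I} → ℝ) :
    addCoord (base y) (height y) = y := by
  funext b
  obtain ⟨b, hb⟩ := b
  cases b <;> rfl

lemma addCoord_latticeBase (u : {b : Option ι // b ∉ some '' I} → ℤ) :
    addCoord (latticeBase u) (latticeHeight u) = u := by
  funext b
  obtain ⟨b, hb⟩ := b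
  cases b <;> rfl

lemma addCoord_add {R : Type*} [Add R] (x x' : {a // a ∉ I} → R) (t t' : R) :
    addCoord (x + x') (t + t') = addCoord x t + addCoord x' t' := by
  funext b
  obtain ⟨b, hb⟩ := b
  cases b <;> rfl

lemma addCoord_smul {R S : Type*} [SMul S R] (c : S) (x : {a // a ∉ I} → R) (t : R) :
    addCoord (c • x) (c • t) = c • addCoord x t := by
  funext b
  obtain ⟨b, hb⟩ := b
  cases b <;> rfl

/-- The linear parametrisation of the graph of a linear form. -/
def graphLin (m : {a // a ∉ I} →₀ ℤ) :
    ({a // a ∉ I} → ℝ) →ₗ[ℝ] ({b : Option ι // b ∉ some '' I} → ℝ) where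
  toFun x := addCoord x (pairing m x)
  map_add' x x' := by rw [pairing_add, addCoord_add]
  map_smul' c x := by
    rw [pairing_smul, RingHom.id_apply, ← addCoord_smul, smul_eq_mul]

/-- Forgetting the last coordinate, as a linear map. -/
def baseLin : ({b : Option ι // b ∉ some '' I} → ℝ) →ₗ[ℝ] ({a // a ∉ I} → ℝ) where
  toFun := base
  map_add' _ _ := rfl
  map_smul' _ _ := rfl

variable {g : ({a // a ∉ I} → ℝ) → ℝ} {σ : Set ({a // a ∉ I} → ℝ)} {m : {a // a ∉ I} →₀ ℤ}

lemma graphOver_eq_image (hg : ∀ x ∈ σ, g x = pairing m x) :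
    graphOver g σ = graphLin m '' σ := by
  ext y
  constructor
  · rintro ⟨h1, h2⟩
    refine ⟨base y, h1, ?_⟩
    change addCoord (base y) (pairing m (base y)) = y
    rw [← hg _ h1, ← h2, addCoord_base]
  · rintro ⟨x, hx, rfl⟩
    exact ⟨hx, (hg x hx).symm⟩

lemma base_image_graphOver : base '' graphOver g σ = σ := by
  ext x
  constructor
  · rintro ⟨y, hy, rfl⟩
    exact hy.1
  · intro hx
    exact ⟨addCoord x (g x), ⟨hx, rfl⟩, rfl⟩

lemma vectorSpan_graphOver (hg : ∀ x ∈ σ, g x = pairing m x) :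
    vectorSpan ℝ (graphOver g σ) = (vectorSpan ℝ σ).map (graphLin m) := by
  rw [graphOver_eq_image hg]
  exact ((graphLin m).toAffineMap.map_vectorSpan).symm

lemma addCoord_mem_lattice_graphOver (hg : ∀ x ∈ σ, g x = pairing m x)
    {u : {a // a ∉ I} → ℤ} {t : ℤ} :
    addCoord u t ∈ lattice (graphOver g σ) ↔ u ∈ lattice σ ∧ t = pairing m u := by
  change (fun b => ((addCoord u t b : ℤ) : ℝ)) ∈ vectorSpan ℝ (graphOver g σ) ↔
    (fun b => (u b : ℝ)) ∈ vectorSpan ℝ σ ∧ _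
  have hcast : (fun b => ((addCoord u t b : ℤ) : ℝ)) = addCoord (fun a => (u a : ℝ)) (t : ℝ) := by
    funext b
    obtain ⟨b, hb⟩ := b
    cases b <;> rfl
  rw [vectorSpan_graphOver hg, hcast, Submodule.mem_map]
  constructor
  · rintro ⟨x, hx, hxu⟩
    have h1 : x = fun a => (u a : ℝ) := congrArg base hxu
    have h2 : pairing m x = t := congrArg height hxu
    subst h1
    rw [pairing_intCast, Int.cast_inj] at h2
    exact ⟨hx, h2.symm⟩
  · rintro ⟨hu, rfl⟩
    exact ⟨_, hu, by rw [← pairing_intCast]; rfl⟩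

lemma mem_lattice_graphOver (hg : ∀ x ∈ σ, g x = pairing m x)
    {u : {b : Option ι // b ∉ some '' I} → ℤ} :
    u ∈ lattice (graphOver g σ) ↔
      latticeBase u ∈ lattice σ ∧ latticeHeight u = pairing m (latticeBase u) := by
  rw [← addCoord_mem_lattice_graphOver hg, addCoord_latticeBase]

lemma graphOver_subset_underGraph : graphOver g σ ⊆ underGraph g σ := fun _ h => ⟨h.1, h.2.le⟩

/-- The span of the undergraph is that of the graph together with the vertical direction, so it
imposes no condition on the height. -/
lemma mem_lattice_underGraph (hσ : σ.Nonempty) (hg : ∀ x ∈ σ, g x = pairing m x)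
    {u : {b : Option ι // b ∉ some '' I} → ℤ} :
    u ∈ lattice (underGraph g σ) ↔ latticeBase u ∈ lattice σ := by
  change (fun b => (u b : ℝ)) ∈ vectorSpan ℝ (underGraph g σ) ↔
    base (fun b => (u b : ℝ)) ∈ vectorSpan ℝ σ
  generalize (fun b => (u b : ℝ)) = v
  constructor
  · intro hv
    have h1 : vectorSpan ℝ (underGraph g σ) ≤ (vectorSpan ℝ σ).comap baseLin := by
      rw [vectorSpan_def, Submodule.span_le]
      rintro _ ⟨x, hx, x', hx', rfl⟩
      exact vsub_mem_vectorSpan ℝ hx.1 hx'.1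
    exact h1 hv
  · intro hv
    have h1 : graphLin m (base v) ∈ vectorSpan ℝ (underGraph g σ) := by
      apply vectorSpan_mono ℝ (graphOver_subset_underGraph (g := g) (σ := σ))
      rw [vectorSpan_graphOver hg]
      exact Submodule.mem_map_of_mem hv
    obtain ⟨x, hx⟩ := hσ
    have h2 : addCoord (I := I) 0 (1 : ℝ) ∈ vectorSpan ℝ (underGraph g σ) := by
      have h3 : addCoord x (g x) ∈ underGraph g σ := ⟨hx, le_refl _⟩
      have h4 : addCoord x (g x - 1) ∈ underGraph g σ :=
        ⟨hx, by rw [height_addCoord, base_addCoord]; linarith⟩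
      have h5 := vsub_mem_vectorSpan ℝ h3 h4
      have h6 : addCoord x (g x) = addCoord 0 1 + addCoord x (g x - 1) := by
        rw [← addCoord_add]
        congr 1 <;> simp
      rwa [h6, vsub_eq_sub, add_sub_cancel_right] at h5
    have h3 : v = graphLin m (base v) + (height v - pairing m (base v)) • addCoord 0 1 := by
      rw [← addCoord_smul]
      change v = addCoord (base v) (pairing m (base v)) + _
      rw [← addCoord_add]
      conv_lhs => rw [← addCoord_base v]
      congr 1 <;> simp
    rw [h3]
    exact Submodule.add_mem _ h1 (Submodule.smul_mem _ _ h2)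

lemma graphOver_subset_graphOver {τ : Set ({a // a ∉ I} → ℝ)} :
    graphOver g τ ⊆ graphOver g σ ↔ τ ⊆ σ := by
  constructor
  · intro h
    rw [← base_image_graphOver (g := g) (σ := τ), ← base_image_graphOver (g := g) (σ := σ)]
    exact Set.image_mono h
  · exact fun h y hy => ⟨h hy.1, hy.2⟩

lemma graphOver_subset_underGraph_iff {τ : Set ({a // a ∉ I} → ℝ)} :
    graphOver g τ ⊆ underGraph g σ ↔ τ ⊆ σ := by
  constructor
  · intro h x hx
    exact (h (show addCoord x (g x) ∈ graphOver g τ from ⟨hx, rfl⟩)).1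
  · exact fun h y hy => ⟨h hy.1, hy.2.le⟩

lemma sum_mapDomain_add_mapDomain {A B C G : Type*} [AddCommMonoid G] (w : A →₀ ℤ) (ω : B →₀ ℤ)
    (p : A → C) (q : B → C) (f : C → ℤ → G) (h0 : ∀ c, f c 0 = 0)
    (hadd : ∀ c n n', f c (n + n') = f c n + f c n') :
    (w.mapDomain p + ω.mapDomain q).sum f
      = (w.sum fun a n => f (p a) n) + ω.sum fun b n => f (q b) n := by
  rw [Finsupp.sum_add_index' h0 hadd, Finsupp.sum_mapDomain_index h0 hadd,
    Finsupp.sum_mapDomain_index h0 hadd]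

open Classical in
/-- The faces of codimension one of a complex of dimension `k`. -/
def ridges {κ : Type*} (k : ℕ) (K : Finset (Set (κ → ℝ))) : Finset (Set (κ → ℝ)) :=
  K.filter fun E => dim E + 1 = k

open Classical in
/-- The weight of the facet below the codimension one face `E`, for a function that is given by
the integral linear form `m σ` on the polyhedron `σ`. -/
def ridgeWeight {κ : Type*} (w : Chain κ) (v : Set (κ → ℝ) → Set (κ → ℝ) → κ → ℤ)
    (m : Set (κ → ℝ) → κ →₀ ℤ) (E : Set (κ → ℝ)) : ℤ :=
  (w.sum fun F n => if E ⊆ F then n * pairing (m F) (v E F) else 0)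
    - pairing (m E) (w.sum fun F n => if E ⊆ F then n • v E F else 0)

lemma ridgeWeight_sub {κ : Type*} (w : Chain κ) (v : Set (κ → ℝ) → Set (κ → ℝ) → κ → ℤ)
    (m m' : Set (κ → ℝ) → κ →₀ ℤ) (E : Set (κ → ℝ)) :
    ridgeWeight w v (fun σ => m σ - m' σ) E = ridgeWeight w v m E - ridgeWeight w v m' E := by
  classical
  rw [ridgeWeight, ridgeWeight, ridgeWeight, pairing_sub_left]
  have : (w.sum fun F n => if E ⊆ F then n * pairing (m F - m' F) (v E F) else 0)
      = (w.sum fun F n => if E ⊆ F then n * pairing (m F) (v E F) else 0)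
        - w.sum fun F n => if E ⊆ F then n * pairing (m' F) (v E F) else 0 := by
    rw [← Finsupp.sum_sub]
    refine Finsupp.sum_congr fun F _ => ?_
    split_ifs
    · rw [pairing_sub_left]; ring
    · ring
  rw [this]
  ring

/-- The chain of codimension one faces with the weights `ω`. -/
def ridgeChain {κ : Type*} (k : ℕ) (K : Finset (Set (κ → ℝ))) (ω : Set (κ → ℝ) → ℤ) : Chain κ :=
  Finsupp.indicator (ridges k K) fun E _ => ω E

lemma ridgeChain_apply {κ : Type*} {k : ℕ} {K : Finset (Set (κ → ℝ))} {ω : Set (κ → ℝ) → ℤ}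
    {E : Set (κ → ℝ)} (hE : E ∈ ridges k K) : ridgeChain k K ω E = ω E := by
  rw [ridgeChain, Finsupp.indicator_of_mem hE]

lemma ridgeChain_sum {κ G : Type*} [AddCommMonoid G] (k : ℕ) (K : Finset (Set (κ → ℝ)))
    (ω : Set (κ → ℝ) → ℤ) (f : Set (κ → ℝ) → ℤ → G) (h0 : ∀ c, f c 0 = 0) :
    (ridgeChain k K ω).sum f = ∑ E ∈ ridges k K, f E (ω E) := by
  rw [ridgeChain, Finsupp.sum_of_support_subset _ (Finsupp.support_indicator_subset _ _) _ fun E _ => h0 E]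
  exact Finset.sum_congr rfl fun E hE => by
    rw [← ridgeChain_apply (ω := ω) hE]; rfl

/-- The modification along a piecewise integral linear function. -/
def graphChain (k : ℕ) (K : Finset (Set ({a // a ∉ I} → ℝ))) (w : Chain {a // a ∉ I})
    (ω : Set ({a // a ∉ I} → ℝ) → ℤ) (g : ({a // a ∉ I} → ℝ) → ℝ) :
    Chain {b : Option ι // b ∉ some '' I} :=
  w.mapDomain (graphOver g) + (ridgeChain k K ω).mapDomain (underGraph g)

/-- The lattice of a graph is the graph of the linear form over the lattice of the base. The forms
on `E` and `F` agree on the lattice of `E` because the graph over `E` lies in the one over `F`. -/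
lemma isPrimitiveVector_graphOver {E F : Set ({a // a ∉ I} → ℝ)} {mE mF : {a // a ∉ I} →₀ ℤ}
    {v : {a // a ∉ I} → ℤ} (hEF : E ⊆ F) (hE : ∀ x ∈ E, g x = pairing mE x)
    (hF : ∀ x ∈ F, g x = pairing mF x) (hv : IsPrimitiveVector E F v) :
    IsPrimitiveVector (graphOver g E) (graphOver g F) (addCoord v (pairing mF v)) := by
  obtain ⟨hlat, x, hx, ε, hε, hxε⟩ := hv
  have hle : lattice (graphOver g E) ≤ lattice (graphOver g F) := fun u hu =>
    vectorSpan_mono ℝ (graphOver_subset_graphOver.2 hEF) hu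
  refine ⟨le_antisymm ?_ ?_, ?_⟩
  · intro u hu
    rw [mem_lattice_graphOver hF, hlat, AddSubgroup.mem_sup] at hu
    obtain ⟨⟨e, he, z, hz, hez⟩, hh⟩ := hu
    obtain ⟨n, rfl⟩ := AddSubgroup.mem_zmultiples_iff.1 hz
    have h1 : addCoord e (pairing mE e) ∈ lattice (graphOver g E) :=
      (addCoord_mem_lattice_graphOver hE).2 ⟨he, rfl⟩
    have h2 : pairing mE e = pairing mF e :=
      ((addCoord_mem_lattice_graphOver hF).1 (hle h1)).2
    rw [AddSubgroup.mem_sup]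
    refine ⟨_, h1, n • addCoord v (pairing mF v), AddSubgroup.zsmul_mem_zmultiples _ _, ?_⟩
    rw [← addCoord_smul, ← addCoord_add, h2, hez, ← addCoord_latticeBase u, hh, ← hez, pairing_add]
    congr 2
    have := pairing_smul mF n v
    rw [this, smul_eq_mul]
  · rw [sup_le_iff, AddSubgroup.zmultiples_le]
    refine ⟨hle, (addCoord_mem_lattice_graphOver hF).2 ⟨?_, rfl⟩⟩
    rw [hlat]
    exact AddSubgroup.mem_sup_right (AddSubgroup.mem_zmultiples v)
  · refine ⟨addCoord x (g x), ⟨hx, rfl⟩, ε, hε, hxε, ?_⟩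
    change g x + ε * ((pairing mF v : ℤ) : ℝ) = g fun a => x a + ε * (v a : ℝ)
    rw [hF _ hxε, hF _ (hEF hx), ← pairing_intCast, ← pairing_smul, ← pairing_add]
    rfl

lemma isPrimitiveVector_underGraph {E : Set ({a // a ∉ I} → ℝ)} {mE : {a // a ∉ I} →₀ ℤ}
    (hne : E.Nonempty) (hE : ∀ x ∈ E, g x = pairing mE x) :
    IsPrimitiveVector (graphOver g E) (underGraph g E) (addCoord 0 (-1)) := by
  obtain ⟨x, hx⟩ := hne
  refine ⟨le_antisymm ?_ ?_, ?_⟩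
  · intro u hu
    rw [mem_lattice_underGraph ⟨x, hx⟩ hE] at hu
    rw [AddSubgroup.mem_sup]
    refine ⟨addCoord (latticeBase u) (pairing mE (latticeBase u)),
      (addCoord_mem_lattice_graphOver hE).2 ⟨hu, rfl⟩,
      (pairing mE (latticeBase u) - latticeHeight u) • addCoord 0 (-1),
      AddSubgroup.zsmul_mem_zmultiples _ _, ?_⟩
    rw [← addCoord_smul, ← addCoord_add]
    conv_rhs => rw [← addCoord_latticeBase u]
    congr 1 <;> simp
  · rw [sup_le_iff, AddSubgroup.zmultiples_le]
    refine ⟨fun u hu => vectorSpan_mono ℝ graphOver_subset_underGraph hu, ?_⟩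
    rw [mem_lattice_underGraph ⟨x, hx⟩ hE, latticeBase_addCoord]
    exact AddSubgroup.zero_mem _
  · refine ⟨addCoord x (g x), ⟨hx, rfl⟩, 1, one_pos, ?_⟩
    have h1 : base (fun b => addCoord x (g x) b + 1 * ((addCoord (I := I) 0 (-1) b : ℤ) : ℝ))
        = x := by
      funext a
      change x a + 1 * ((0 : ℤ) : ℝ) = x a
      simp
    refine ⟨by rw [h1]; exact hx, ?_⟩
    rw [h1]
    change g x + 1 * ((-1 : ℤ) : ℝ) ≤ g x
    simp

/-- The lifted primitive vectors sum to a vector over an element of the lattice of `E`, whose height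
exceeds the value of `m E` by `ridgeWeight`; that multiple of the downward vertical vector corrects
it. By `hmax`, the only undergraph containing the graph over `E` is the one over `E` itself. -/
lemma isGraphModification_graphChain {k : ℕ} {K : Finset (Set ({a // a ∉ I} → ℝ))}
    {w : Chain {a // a ∉ I}} (hne : ∀ σ ∈ K, σ.Nonempty) (hw : ∀ σ ∈ w.support, σ ∈ K)
    (hmax : ∀ E ∈ ridges k K, ∀ E' ∈ ridges k K, E ⊆ E' → E = E')
    {v : Set ({a // a ∉ I} → ℝ) → Set ({a // a ∉ I} → ℝ) → {a // a ∉ I} → ℤ}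
    (hv : ∀ E ∈ ridges k K, ∀ F ∈ w.support, E ⊆ F → IsPrimitiveVector E F (v E F))
    (hbal : ∀ E ∈ ridges k K,
      haveI := Classical.propDecidable
      (w.sum fun F n => if E ⊆ F then n • v E F else 0) ∈ lattice E)
    {m : Set ({a // a ∉ I} → ℝ) → {a // a ∉ I} →₀ ℤ}
    (hg : ∀ σ ∈ K, ∀ x ∈ σ, g x = pairing (m σ) x) :
    IsGraphModification k K w g (graphChain k K w (ridgeWeight w v m) g) := by
  classical
  refine ⟨ridgeChain k K (ridgeWeight w v m), ?_, rfl, ?_⟩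
  · intro E hE
    have := Finsupp.support_indicator_subset _ _ hE
    rw [ridges, Finset.mem_filter] at this
    exact this
  intro E hEK hd
  have hE : E ∈ ridges k K := by rw [ridges, Finset.mem_filter]; exact ⟨hEK, hd⟩
  -- The vector must be a function of the facet as a set: graphs are recognised by all heights being
  -- equal to `g`, and their base is recovered by projection.
  let V : Set ({b : Option ι // b ∉ some '' I} → ℝ) → {b : Option ι // b ∉ some '' I} → ℤ :=
    fun F => if ∀ y ∈ F, height y = g (base y)
      then addCoord (v E (base '' F)) (pairing (m (base '' F)) (v E (base '' F)))
      else addCoord 0 (-1)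
  have hVg : ∀ F, V (graphOver g F) = addCoord (v E F) (pairing (m F) (v E F)) := by
    intro F
    simp only [V]
    rw [if_pos fun y hy => hy.2, base_image_graphOver]
  have hVu : ∀ E' ∈ K, V (underGraph g E') = addCoord 0 (-1) := by
    intro E' hE'
    simp only [V]
    rw [if_neg]
    intro h
    obtain ⟨x, hx⟩ := hne E' hE'
    have h1 : g x - 1 = g x := h (addCoord x (g x - 1))
      ⟨hx, by rw [height_addCoord, base_addCoord]; linarith⟩
    linarith
  refine ⟨V, ?_, ?_⟩
  · intro F hF hEF
    rcases Finset.mem_union.1 (Finsupp.support_add hF) with h | h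
    · obtain ⟨F, hFw, rfl⟩ := Finset.mem_image.1 (Finsupp.mapDomain_support h)
      rw [hVg]
      rw [graphOver_subset_graphOver] at hEF
      exact isPrimitiveVector_graphOver hEF (hg E hEK) (hg F (hw F hFw)) (hv E hE F hFw hEF)
    · obtain ⟨E', hE', rfl⟩ := Finset.mem_image.1 (Finsupp.mapDomain_support h)
      rw [graphOver_subset_underGraph_iff] at hEF
      obtain rfl := hmax E hE E' (Finsupp.support_indicator_subset _ _ hE') hEF
      rw [hVu E hEK]
      exact isPrimitiveVector_underGraph (hne E hEK) (hg E hEK)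
  · rw [graphChain, sum_mapDomain_add_mapDomain _ _ _ _ _ (by intro c; simp)
      (by intro c n n'; split_ifs; exacts [add_smul _ _ _, (add_zero _).symm])]
    have h1 : (w.sum fun F n => if graphOver g E ⊆ graphOver g F then n • V (graphOver g F) else 0)
        = addCoord (w.sum fun F n => if E ⊆ F then n • v E F else 0)
          (w.sum fun F n => if E ⊆ F then n * pairing (m F) (v E F) else 0) := by
      have h3 : ∀ F ∈ w.support, (if graphOver g E ⊆ graphOver g F
          then w F • V (graphOver g F) else 0)
          = addCoord (if E ⊆ F then w F • v E F else 0)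
            (if E ⊆ F then w F * pairing (m F) (v E F) else 0) := by
        intro F _
        rw [hVg]
        by_cases h : E ⊆ F
        · rw [if_pos (graphOver_subset_graphOver.2 h), if_pos h, if_pos h, ← addCoord_smul,
            smul_eq_mul]
        · rw [if_neg (mt graphOver_subset_graphOver.1 h), if_neg h, if_neg h]
          funext b
          obtain ⟨b, hb⟩ := b
          cases b <;> rfl
      rw [Finsupp.sum, Finset.sum_congr rfl h3]
      funext b
      obtain ⟨b, hb⟩ := b
      cases b <;> simp [addCoord, Finsupp.sum, Finset.sum_apply]
    have h2 : ((ridgeChain k K (ridgeWeight w v m)).sum fun E' n =>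
        if graphOver g E ⊆ underGraph g E' then n • V (underGraph g E') else 0)
        = ridgeWeight w v m E • addCoord 0 (-1) := by
      rw [ridgeChain_sum _ _ _ _ (by intro c; simp), Finset.sum_eq_single E]
      · rw [if_pos graphOver_subset_underGraph, hVu E hEK]
      · intro E' hE' hne'
        rw [if_neg]
        rw [graphOver_subset_underGraph_iff]
        exact fun h => hne' (hmax E hE E' hE' h).symm
      · exact fun h => absurd hE h
    rw [h1, h2, ← addCoord_smul, ← addCoord_add, addCoord_mem_lattice_graphOver (hg E hEK)]
    rw [smul_zero, add_zero]
    refine ⟨?_, ?_⟩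
    · convert hbal E hE
    · rw [ridgeWeight]
      simp only [smul_eq_mul]
      ring_nf

end Graph

end TropMod
end

noncomputable section

namespace TropMod

/-! ### The boundary of graphs of linear forms on cones -/

section Boundary

open Filter Topology

variable {ι : Type*} {I : Set ι}

/-- The point of `𝕋^{n+1}` over `z` with last coordinate `-∞`. -/
def liftBot (z : ι → TT) : Option ι → TT := fun b => b.elim ⊥ z

lemma toT_of_mem {κ : Type*} {J : Set κ} {x : {a // a ∉ J} → ℝ} {a : κ} (h : a ∈ J) :
    toT J x a = ⊥ := by
  simp [toT, h]

lemma toT_of_notMem {κ : Type*} {J : Set κ} {x : {a // a ∉ J} → ℝ} {a : κ} (h : a ∉ J) :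
    toT J x a = ((x ⟨a, h⟩ : ℝ) : TT) := by
  simp [toT, h]

lemma toT_eq_bot_iff {κ : Type*} {J : Set κ} {x : {a // a ∉ J} → ℝ} {a : κ} :
    toT J x a = ⊥ ↔ a ∈ J := by
  by_cases h : a ∈ J
  · simp [toT_of_mem, h]
  · simp [toT_of_notMem h, h]

lemma sedentarity_toT {κ : Type*} (J : Set κ) (x : {a // a ∉ J} → ℝ) :
    sedentarity (toT J x) = J := by
  ext a
  exact toT_eq_bot_iff

lemma toT_injective {κ : Type*} (J : Set κ) : Function.Injective (toT J) := by
  intro x x' h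
  funext a
  have := congrFun h a.1
  rw [toT_of_notMem a.2, toT_of_notMem a.2] at this
  exact WithBot.coe_injective this

lemma homog_toT (x : {a // a ∉ I} → ℝ) (a : Option {a // a ∉ I}) :
    homog (toT I x) (a.map Subtype.val) = ((homog x a : ℝ) : TT) := by
  cases a with
  | none => rfl
  | some a => exact toT_of_notMem a.2

/-- `z` lies in the closure of the cone of `y` in `𝕋^n`. -/
def OrderLim (y : {a // a ∉ I} → ℝ) (z : ι → TT) : Prop :=
  (∀ a ∈ I, z a = ⊥) ∧ ∀ a b : Option {a // a ∉ I}, homog y a ≤ homog y b →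
    homog z (a.map Subtype.val) ≤ homog z (b.map Subtype.val)

lemma orderLim_toT {y x : {a // a ∉ I} → ℝ} : OrderLim y (toT I x) ↔ x ∈ cone y := by
  refine ⟨fun h a b hab => ?_, fun h => ⟨fun a ha => toT_of_mem ha, fun a b hab => ?_⟩⟩
  · have := h.2 a b hab
    rwa [homog_toT, homog_toT, WithBot.coe_le_coe] at this
  · rw [homog_toT, homog_toT, WithBot.coe_le_coe]
    exact h a b hab

lemma isClosed_orderLim (y : {a // a ∉ I} → ℝ) : IsClosed {z : ι → TT | OrderLim y z} := by
  have hcont : ∀ a : Option ι, Continuous fun z : ι → TT => homog z a := by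
    intro a
    cases a with
    | none => exact continuous_const
    | some a => exact continuous_apply a
  simp only [OrderLim, Set.ofPred_and, Set.ofPred_forall]
  refine (isClosed_iInter fun a => isClosed_iInter fun _ =>
    isClosed_eq (continuous_apply a) continuous_const).inter
    (isClosed_iInter fun a => isClosed_iInter fun b => isClosed_iInter fun _ =>
      isClosed_le (hcont _) (hcont _))

lemma continuous_delta : Continuous (delta : (Option ι → TT) → ι → TT) :=
  continuous_pi fun a => continuous_apply (some a)

lemma delta_toT (p : {b : Option ι // b ∉ some '' I} → ℝ) :
    delta (toT (some '' I) p) = toT I (base p) := by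
  funext a
  by_cases h : a ∈ I
  · rw [toT_of_mem h]
    exact toT_of_mem (Set.mem_image_of_mem _ h)
  · rw [toT_of_notMem h]
    exact toT_of_notMem (by simpa using h)

lemma orderLim_of_mem_closure {y : {a // a ∉ I} → ℝ}
    {F : Set ({b : Option ι // b ∉ some '' I} → ℝ)} (hF : ∀ p ∈ F, base p ∈ cone y)
    {q : Option ι → TT} (hq : q ∈ closure (toT (some '' I) '' F)) : OrderLim y (delta q) := by
  have : closure (toT (some '' I) '' F) ⊆ delta ⁻¹' {z : ι → TT | OrderLim y z} := by
    apply closure_minimal _ ((isClosed_orderLim y).preimage continuous_delta)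
    rintro _ ⟨p, hp, rfl⟩
    change OrderLim y (delta _)
    rw [delta_toT, orderLim_toT]
    exact hF p hp
  exact this hq

variable {z : ι → TT}

/-- The finite coordinates of the stratum of `liftBot z`, as coordinates of the stratum of `I`. -/
def finiteCoord (hz : ∀ a ∈ I, z a = ⊥) :
    {b : Option ι // b ∉ sedentarity (liftBot z)} → {a // a ∉ I} :=
  fun b => match b with
  | ⟨none, h⟩ => absurd rfl h
  | ⟨some a, h⟩ => ⟨a, fun ha => h (hz a ha)⟩

lemma homog_comp {κ κ' R : Type*} [Zero R] (x : κ → R) (f : κ' → κ) (b : Option κ') :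
    homog (x ∘ f) b = homog x (b.map f) := by
  cases b <;> rfl

lemma coord_cases (hz : ∀ a ∈ I, z a = ⊥) (a : Option {a // a ∉ I}) :
    (∃ a', a = some a' ∧ z a' = ⊥) ∨ ∃ b, a = Option.map (finiteCoord hz) b := by
  cases a with
  | none => exact Or.inr ⟨none, rfl⟩
  | some a =>
    by_cases h : z a = ⊥
    · exact Or.inl ⟨a, rfl, h⟩
    · exact Or.inr ⟨some ⟨some a.1, h⟩, rfl⟩

lemma homog_finiteCoord_ne_bot (hz : ∀ a ∈ I, z a = ⊥)
    (b : Option {b : Option ι // b ∉ sedentarity (liftBot z)}) :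
    homog z ((b.map (finiteCoord hz)).map Subtype.val) ≠ ⊥ := by
  cases b with
  | none => exact WithBot.coe_ne_bot
  | some b =>
    obtain ⟨b, hb⟩ := b
    cases b with
    | none => exact absurd rfl hb
    | some a => exact hb

/-- Coordinates that tend to `-∞` lie strictly below those that stay finite. -/
lemma OrderLim.not_le {y : {a // a ∉ I} → ℝ} (h : OrderLim y z)
    (b : Option {b : Option ι // b ∉ sedentarity (liftBot z)}) {a : {a // a ∉ I}}
    (ha : z a = ⊥) : ¬ homog y (b.map (finiteCoord h.1)) ≤ y a := by
  intro hle
  have := h.2 _ (some a) hle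
  rw [Option.map_some, homog_some, ha, le_bot_iff] at this
  exact homog_finiteCoord_ne_bot h.1 b this

open Classical in
/-- A sequence in the cone of `y` converging to a point of the stratum of `z`. -/
def approx (y : {a // a ∉ I} → ℝ)
    (x : {b : Option ι // b ∉ sedentarity (liftBot z)} → ℝ) (n : ℕ) : {a // a ∉ I} → ℝ :=
  -- All vanishing coordinates decrease at the same speed, which preserves their order in `y`.
  fun a => if h : z a = ⊥ then y a - n else x ⟨some a.1, h⟩

lemma tendsto_coe_bot {t : ℕ → ℝ} (ht : Tendsto t atTop atBot) :
    Tendsto (fun n => ((t n : ℝ) : TT)) atTop (𝓝 ⊥) := by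
  rw [tendsto_order]
  refine ⟨fun a ha => absurd ha not_lt_bot, fun a ha => ?_⟩
  obtain ⟨r, rfl⟩ := WithBot.ne_bot_iff_exists.1 ha.ne'
  filter_upwards [ht.eventually_lt_atBot r] with n hn
  exact WithBot.coe_lt_coe.2 hn

lemma approx_of_eq_bot {y : {a // a ∉ I} → ℝ}
    {x : {b : Option ι // b ∉ sedentarity (liftBot z)} → ℝ} {n : ℕ} {a : {a // a ∉ I}}
    (h : z a = ⊥) : approx y x n a = y a - n := by
  simp [approx, h]

lemma approx_of_ne_bot {y : {a // a ∉ I} → ℝ}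
    {x : {b : Option ι // b ∉ sedentarity (liftBot z)} → ℝ} {n : ℕ} {a : {a // a ∉ I}}
    (h : z a ≠ ⊥) : approx y x n a = x ⟨some a.1, h⟩ := by
  simp [approx, h]

lemma homog_approx (hz : ∀ a ∈ I, z a = ⊥) (y : {a // a ∉ I} → ℝ)
    (x : {b : Option ι // b ∉ sedentarity (liftBot z)} → ℝ) (n : ℕ)
    (b : Option {b : Option ι // b ∉ sedentarity (liftBot z)}) :
    homog (approx y x n) (b.map (finiteCoord hz)) = homog x b := by
  cases b with
  | none => rfl
  | some b =>
    obtain ⟨b, hb⟩ := b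
    cases b with
    | none => exact absurd rfl hb
    | some a => exact approx_of_ne_bot (a := ⟨a, _⟩) hb

lemma eventually_approx_mem_cone [Finite ι] {y : {a // a ∉ I} → ℝ} (h : OrderLim y z)
    {x : {b : Option ι // b ∉ sedentarity (liftBot z)} → ℝ}
    (hx : x ∈ cone (y ∘ finiteCoord h.1)) : ∀ᶠ n in atTop, approx y x n ∈ cone y := by
  have : ∀ a b : Option {a // a ∉ I}, ∀ᶠ n in atTop, homog y a ≤ homog y b →
      homog (approx y x n) a ≤ homog (approx y x n) b := by
    intro a b
    rcases coord_cases h.1 a with ⟨a, rfl, ha⟩ | ⟨a, rfl⟩ <;>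
      rcases coord_cases h.1 b with ⟨b, rfl, hb⟩ | ⟨b, rfl⟩
    · refine Eventually.of_forall fun n hab => ?_
      rw [homog_some, homog_some, approx_of_eq_bot ha, approx_of_eq_bot hb]
      exact sub_le_sub_right hab _
    · filter_upwards [tendsto_natCast_atTop_atTop.eventually_ge_atTop (y a - homog x b)]
        with n hn _
      rw [homog_some, approx_of_eq_bot ha, homog_approx]
      linarith
    · exact Eventually.of_forall fun n hab => absurd hab (h.not_le a hb)
    · refine Eventually.of_forall fun n hab => ?_
      rw [homog_approx, homog_approx]
      apply hx
      rwa [homog_comp, homog_comp]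
  have h2 := eventually_all.2 fun a => eventually_all.2 (this a)
  exact h2

lemma mem_closure_of_tendsto_approx [Finite ι] {y : {a // a ∉ I} → ℝ} (h : OrderLim y z)
    {x : {b : Option ι // b ∉ sedentarity (liftBot z)} → ℝ}
    (hx : x ∈ cone (y ∘ finiteCoord h.1)) {F : Set ({b : Option ι // b ∉ some '' I} → ℝ)}
    {t : ℕ → ℝ} (ht : Tendsto t atTop atBot)
    (hF : ∀ n, approx y x n ∈ cone y → addCoord (approx y x n) (t n) ∈ F) :
    toT (sedentarity (liftBot z)) x ∈ closure (toT (some '' I) '' F) := by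
  refine mem_closure_of_tendsto (b := atTop)
    (f := fun n => toT (some '' I) (addCoord (approx y x n) (t n))) ?_
    ((eventually_approx_mem_cone h hx).mono fun n hn => ⟨_, hF n hn, rfl⟩)
  rw [tendsto_pi_nhds]
  intro b
  cases b with
  | none =>
    rw [toT_of_mem (show none ∈ sedentarity (liftBot z) from rfl)]
    have h1 : ∀ n, toT (some '' I) (addCoord (approx y x n) (t n)) none = ((t n : ℝ) : TT) :=
      fun n => toT_of_notMem (by simp)
    simp only [h1]
    exact tendsto_coe_bot ht
  | some a =>
    by_cases ha : a ∈ I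
    · rw [toT_of_mem (show some a ∈ sedentarity (liftBot z) from h.1 a ha)]
      have h1 : ∀ n, toT (some '' I) (addCoord (approx y x n) (t n)) (some a) = ⊥ :=
        fun n => toT_of_mem (Set.mem_image_of_mem _ ha)
      simp only [h1]
      exact tendsto_const_nhds
    · have h1 : ∀ n, toT (some '' I) (addCoord (approx y x n) (t n)) (some a)
          = ((approx y x n ⟨a, ha⟩ : ℝ) : TT) := fun n => toT_of_notMem (by simpa using ha)
      simp only [h1]
      by_cases hb : z a = ⊥
      · rw [toT_of_mem (show some a ∈ sedentarity (liftBot z) from hb)]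
        simp only [approx_of_eq_bot (a := ⟨a, ha⟩) hb]
        refine tendsto_coe_bot ?_
        exact tendsto_atBot_add_const_left _ _
          (tendsto_neg_atTop_atBot.comp tendsto_natCast_atTop_atTop)
      · rw [toT_of_notMem (show some a ∉ sedentarity (liftBot z) from hb)]
        simp only [approx_of_ne_bot (a := ⟨a, ha⟩) hb]
        exact tendsto_const_nhds

/-- The last coordinate is lost at the boundary, so only the order of the remaining finite
coordinates matters; that all such points are reached is left to `hcl`, which has different reasons
for graphs and undergraphs. -/
lemma boundaryFace_eq_cone [Finite ι] {y : {a // a ∉ I} → ℝ} (h : OrderLim y z)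
    {F : Set ({b : Option ι // b ∉ some '' I} → ℝ)} (hF : ∀ p ∈ F, base p ∈ cone y)
    (hcl : ∀ x ∈ cone (y ∘ finiteCoord h.1),
      toT (sedentarity (liftBot z)) x ∈ closure (toT (some '' I) '' F)) :
    boundaryFace (some '' I) (sedentarity (liftBot z)) F = cone (y ∘ finiteCoord h.1) := by
  refine Set.Subset.antisymm (fun x hx a b hab => ?_) hcl
  have h1 := orderLim_of_mem_closure hF hx
  rw [homog_comp, homog_comp] at hab
  have h2 := h1.2 _ _ hab
  have key : ∀ b : Option {b : Option ι // b ∉ sedentarity (liftBot z)},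
      homog (delta (toT (sedentarity (liftBot z)) x))
        ((b.map (finiteCoord h.1)).map Subtype.val) = ((homog x b : ℝ) : TT) := by
    intro b
    cases b with
    | none => rfl
    | some b =>
      obtain ⟨b, hb⟩ := b
      cases b with
      | none => exact absurd rfl hb
      | some a => exact toT_of_notMem hb
  rwa [key, key, WithBot.coe_le_coe] at h2

/-- The number of levels splits into the finite ones and those going to `-∞`. -/
lemma levels_eq_add [Finite ι] {y : {a // a ∉ I} → ℝ} (h : OrderLim y z) :
    levels y = levels (y ∘ finiteCoord h.1) + (y '' {a | z a = ⊥}).ncard := by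
  rw [levels, levels, ← Set.ncard_union_eq _ (Set.toFinite _) (Set.toFinite _)]
  · congr 1
    ext v
    constructor
    · rintro ⟨a, rfl⟩
      rcases coord_cases h.1 a with ⟨a, rfl, ha⟩ | ⟨a, rfl⟩
      · exact Or.inr ⟨a, ha, rfl⟩
      · exact Or.inl ⟨a, homog_comp _ _ _⟩
    · rintro (⟨a, rfl⟩ | ⟨a, -, rfl⟩)
      · exact ⟨_, (homog_comp _ _ _).symm⟩
      · exact ⟨some a, rfl⟩
  · rw [Set.disjoint_left]
    rintro _ ⟨b, rfl⟩ ⟨a, ha, hab⟩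
    refine h.not_le b ha ?_
    rw [← homog_comp]
    exact hab.ge

open Classical in
/-- Minus the slope of an integral linear form in the direction of the coordinates that are
`-∞` at `z`. -/
def botCoeff (m : {a // a ∉ I} →₀ ℤ) (z : ι → TT) : ℤ := m.sum fun a n => if z a = ⊥ then n else 0

lemma botCoeff_sub (m m' : {a // a ∉ I} →₀ ℤ) (z : ι → TT) :
    botCoeff (m - m') z = botCoeff m z - botCoeff m' z :=
  Finsupp.sum_sub_index (by intros; split_ifs <;> simp)

lemma botCoeff_nonneg {m : {a // a ∉ I} →₀ ℤ} (hm : ∀ a, 0 ≤ m a) (z : ι → TT) :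
    0 ≤ botCoeff m z :=
  Finset.sum_nonneg fun a _ => by
    dsimp only
    split_ifs
    exacts [hm a, le_rfl]

lemma pairing_approx (m : {a // a ∉ I} →₀ ℤ) (y : {a // a ∉ I} → ℝ)
    (x : {b : Option ι // b ∉ sedentarity (liftBot z)} → ℝ) (n : ℕ) :
    pairing m (approx y x n) = pairing m (approx y x 0) - n * botCoeff m z := by
  rw [pairing, pairing, botCoeff, Finsupp.sum, Finsupp.sum, Finsupp.sum, Int.cast_sum,
    Finset.mul_sum, ← Finset.sum_sub_distrib]
  refine Finset.sum_congr rfl fun a _ => ?_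
  by_cases h : z a = ⊥
  · rw [approx_of_eq_bot h, approx_of_eq_bot h, if_pos h]
    push_cast
    ring
  · rw [approx_of_ne_bot h, approx_of_ne_bot h, if_neg h]
    push_cast
    ring

lemma tendsto_pairing_approx (m : {a // a ∉ I} →₀ ℤ)
    (y : {a // a ∉ I} → ℝ) (x : {b : Option ι // b ∉ sedentarity (liftBot z)} → ℝ) {c : ℝ}
    (hc : 0 < botCoeff m z + c) :
    Tendsto (fun n : ℕ => pairing m (approx y x n) - n * c) atTop atBot := by
  have : (fun n : ℕ => pairing m (approx y x n) - n * c)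
      = fun n : ℕ => pairing m (approx y x 0) + -(n * (botCoeff m z + c)) := by
    funext n
    rw [pairing_approx]
    ring
  rw [this]
  exact tendsto_atBot_add_const_left _ _ (tendsto_neg_atTop_atBot.comp
    (tendsto_natCast_atTop_atTop.atTop_mul_const hc))

/-! ### Boundary faces and multiplicities of graph and undergraph facets -/

variable {g : ({a // a ∉ I} → ℝ) → ℝ} {y : {a // a ∉ I} → ℝ} {m : {a // a ∉ I} →₀ ℤ}

lemma liftBot_mem_closure_iff {F : Set ({b : Option ι // b ∉ some '' I} → ℝ)} :
    (∃ x, toT (sedentarity (liftBot z)) x = liftBot z ∧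
      (liftBot z ∈ closure (toT (some '' I) '' F) ↔
        x ∈ boundaryFace (some '' I) (sedentarity (liftBot z)) F)) := by
  have h : toT (sedentarity (liftBot z)) (fun b => (liftBot z b.1).unbot b.2) = liftBot z := by
    funext b
    by_cases hb : b ∈ sedentarity (liftBot z)
    · rw [toT_of_mem hb]
      exact hb.symm
    · rw [toT_of_notMem hb]
      exact WithBot.coe_unbot _ _
  exact ⟨_, h, by rw [boundaryFace, Set.mem_ofPred_eq, h]⟩

lemma mem_cone_finiteCoord (h : OrderLim y z)
    {x : {b : Option ι // b ∉ sedentarity (liftBot z)} → ℝ}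
    (hx : toT (sedentarity (liftBot z)) x = liftBot z) : x ∈ cone (y ∘ finiteCoord h.1) := by
  intro a b hab
  rw [homog_comp, homog_comp] at hab
  have key : ∀ b : Option {b : Option ι // b ∉ sedentarity (liftBot z)},
      homog z ((b.map (finiteCoord h.1)).map Subtype.val) = ((homog x b : ℝ) : TT) := by
    intro b
    cases b with
    | none => rfl
    | some b =>
      obtain ⟨b, hb⟩ := b
      cases b with
      | none => exact absurd rfl hb
      | some a =>
        exact (congrFun hx (some a)).symm.trans (toT_of_notMem hb)
  have := h.2 _ _ hab
  rwa [key, key, WithBot.coe_le_coe] at this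

/-- Along `approx` the height of the graph falls linearly with rate `botCoeff m z`; positivity makes
it tend to `-∞`. -/
lemma toT_mem_closure_graphOver [Finite ι] (hg : ∀ x ∈ cone y, g x = pairing m x)
    (h : OrderLim y z) (hpos : 0 < botCoeff m z)
    {x : {b : Option ι // b ∉ sedentarity (liftBot z)} → ℝ}
    (hx : x ∈ cone (y ∘ finiteCoord h.1)) :
    toT (sedentarity (liftBot z)) x ∈ closure (toT (some '' I) '' graphOver g (cone y)) := by
  refine mem_closure_of_tendsto_approx h hx
    (tendsto_pairing_approx m y x (c := 0)
      (by rw [add_zero]; exact_mod_cast hpos)) fun n hn => ⟨hn, ?_⟩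
  rw [height_addCoord, base_addCoord, hg _ hn]
  ring

lemma toT_mem_closure_underGraph [Finite ι] (hm : ∀ a, 0 ≤ m a)
    (hg : ∀ x ∈ cone y, g x = pairing m x)
    (h : OrderLim y z) {x : {b : Option ι // b ∉ sedentarity (liftBot z)} → ℝ}
    (hx : x ∈ cone (y ∘ finiteCoord h.1)) :
    toT (sedentarity (liftBot z)) x ∈ closure (toT (some '' I) '' underGraph g (cone y)) := by
  have h0 : (0 : ℝ) ≤ botCoeff m z := by exact_mod_cast botCoeff_nonneg hm z
  -- The rate `botCoeff m z` may be zero, so the sequence descends below the graph by an additional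
  -- `n`; hence `c := 1`.
  refine mem_closure_of_tendsto_approx h hx
    (tendsto_pairing_approx m y x (c := 1) (by linarith)) fun n hn => ⟨hn, ?_⟩
  rw [height_addCoord, base_addCoord, hg _ hn]
  have : (0 : ℝ) ≤ n := Nat.cast_nonneg n
  linarith

/-- With nonnegative coefficients, `botCoeff m z = 0` means that every variable of `m` is finite at
`z`. The height of the graph is then bounded below near `z` and cannot tend to `-∞`. -/
lemma liftBot_notMem_closure_graphOver (hm : ∀ a, 0 ≤ m a)
    (hg : ∀ x ∈ cone y, g x = pairing m x) (h0 : botCoeff m z = 0) :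
    liftBot z ∉ closure (toT (some '' I) '' graphOver g (cone y)) := by
  classical
  have hne : ∀ a ∈ m.support, z a ≠ ⊥ := by
    intro a ha hza
    have h1 := (Finset.sum_eq_zero_iff_of_nonneg (fun a _ => by
      dsimp only
      split_ifs
      exacts [hm a, le_rfl])).1 h0 a ha
    dsimp only at h1
    rw [if_pos hza] at h1
    exact Finsupp.mem_support_iff.1 ha h1
  rw [mem_closure_iff_frequently]
  intro hfreq
  let r : {a // a ∉ I} → ℝ := fun a => (z a).unbotD 0 - 1
  have h1 : ∀ᶠ p in 𝓝 (liftBot z), ∀ a ∈ m.support, ((r a : ℝ) : TT) < p (some a.1) := by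
    rw [Filter.eventually_all_finset]
    intro a ha
    refine (continuous_apply (some a.1)).continuousAt.eventually (lt_mem_nhds ?_)
    change ((r a : ℝ) : TT) < z a
    obtain ⟨s, hs⟩ := WithBot.ne_bot_iff_exists.1 (hne a ha)
    simp only [r]
    rw [← hs, WithBot.unbotD_coe, WithBot.coe_lt_coe]
    linarith
  have h2 : ∀ᶠ p in 𝓝 (liftBot z), p none < ((pairing m r : ℝ) : TT) :=
    (continuous_apply (A := fun _ : Option ι => TT) none).continuousAt.eventually
      (gt_mem_nhds (WithBot.bot_lt_coe _))
  apply hfreq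
  filter_upwards [h1, h2] with p hp1 hp2
  rintro ⟨q, ⟨hq1, hq2⟩, rfl⟩
  rw [hg _ hq1] at hq2
  have h3 : toT (some '' I) q none = ((height q : ℝ) : TT) := toT_of_notMem (by simp)
  rw [h3, WithBot.coe_lt_coe, hq2] at hp2
  refine absurd hp2 (_root_.not_lt.2 ?_)
  refine Finset.sum_le_sum fun a ha => ?_
  have h4 := hp1 a ha
  have h5 : toT (some '' I) q (some a.1) = ((base q a : ℝ) : TT) :=
    toT_of_notMem (by simpa using a.2)
  rw [h5, WithBot.coe_lt_coe] at h4
  exact mul_le_mul_of_nonneg_left h4.le (by exact_mod_cast hm a)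

open Classical in
lemma coordProj_apply (hz : ∀ a ∈ I, z a = ⊥) (u : {b : Option ι // b ∉ some '' I} → ℤ) :
    coordProj (some '' I) (sedentarity (liftBot z)) none u
      = (latticeHeight u, latticeBase u ∘ finiteCoord hz) := by
  refine Prod.ext ?_ ?_
  · change (if h : none ∈ some '' I then 0 else u ⟨none, h⟩) = _
    rw [dif_neg (by simp)]
    rfl
  · funext b
    obtain ⟨b, hb⟩ := b
    cases b with
    | none => exact absurd rfl hb
    | some a =>
      exact dif_neg _

open Classical in
/-- A lattice vector with the given finite coordinates, the others being `c`. -/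
def fillIn (I : Set ι) (z : ι → TT) (c : ℤ) (w : {b : Option ι // b ∉ sedentarity (liftBot z)} → ℤ) :
    {a // a ∉ I} → ℤ :=
  fun a => if h : z a = ⊥ then c else w ⟨some a.1, h⟩

lemma fillIn_of_eq_bot {c : ℤ} {w : {b : Option ι // b ∉ sedentarity (liftBot z)} → ℤ}
    {a : {a // a ∉ I}} (h : z a = ⊥) : fillIn I z c w a = c := by
  simp [fillIn, h]

lemma homog_fillIn (hz : ∀ a ∈ I, z a = ⊥) {c : ℤ}
    {w : {b : Option ι // b ∉ sedentarity (liftBot z)} → ℤ}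
    (b : Option {b : Option ι // b ∉ sedentarity (liftBot z)}) :
    homog (fillIn I z c w) (b.map (finiteCoord hz)) = homog w b := by
  cases b with
  | none => rfl
  | some b =>
    obtain ⟨b, hb⟩ := b
    cases b with
    | none => exact absurd rfl hb
    | some a =>
      change fillIn I z c w ⟨a, _⟩ = _
      have hb' : ¬ z a = ⊥ := hb
      simp only [fillIn, hb', dif_neg, not_false_eq_true]
      rfl

lemma fillIn_mem_lattice [Finite ι] (h : OrderLim y z) {c : ℤ}
    {w : {b : Option ι // b ∉ sedentarity (liftBot z)} → ℤ}
    (hw : w ∈ lattice (cone (y ∘ finiteCoord h.1))) : fillIn I z c w ∈ lattice (cone y) := by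
  rw [mem_lattice_cone] at hw ⊢
  intro a b hab
  rcases coord_cases h.1 a with ⟨a, rfl, ha⟩ | ⟨a, rfl⟩ <;>
    rcases coord_cases h.1 b with ⟨b, rfl, hb⟩ | ⟨b, rfl⟩
  · rw [homog_some, homog_some, fillIn_of_eq_bot ha, fillIn_of_eq_bot hb]
  · exact absurd hab.ge (h.not_le b ha)
  · exact absurd hab.le (h.not_le a hb)
  · rw [homog_fillIn, homog_fillIn]
    apply hw
    rwa [homog_comp, homog_comp]

lemma fillIn_comp (hz : ∀ a ∈ I, z a = ⊥) {c : ℤ}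
    {w : {b : Option ι // b ∉ sedentarity (liftBot z)} → ℤ} :
    fillIn I z c w ∘ finiteCoord hz = w := by
  funext b
  exact homog_fillIn hz (some b)

lemma pairing_eq_of_comp_eq (hz : ∀ a ∈ I, z a = ⊥) {u : {a // a ∉ I} → ℤ} {c : ℤ}
    (hu : ∀ a : {a // a ∉ I}, z a = ⊥ → u a = c) :
    pairing m u = pairing m (fillIn I z 0 (u ∘ finiteCoord hz)) + c * botCoeff m z := by
  rw [pairing, pairing, botCoeff, Finsupp.sum, Finsupp.sum, Finsupp.sum,
    Finset.mul_sum, ← Finset.sum_add_distrib]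
  refine Finset.sum_congr rfl fun a _ => ?_
  by_cases h : z a = ⊥
  · rw [fillIn_of_eq_bot h, hu a h, if_pos h]
    push_cast
    ring
  · have : fillIn I z 0 (u ∘ finiteCoord hz) a = u a := by
      exact (dif_neg h).trans rfl
    rw [this, if_neg h]
    ring

/-- All coordinates going to `-∞` have the same value. -/
def OneLevel (y : {a // a ∉ I} → ℝ) (z : ι → TT) : Prop :=
  ∀ a b : {a // a ∉ I}, z a = ⊥ → z b = ⊥ → y a = y b

lemma comp_finiteCoord_mem_lattice [Finite ι] (hz : ∀ a ∈ I, z a = ⊥) {u : {a // a ∉ I} → ℤ}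
    (hu : u ∈ lattice (cone y)) : u ∘ finiteCoord hz ∈ lattice (cone (y ∘ finiteCoord hz)) := by
  rw [mem_lattice_cone] at hu ⊢
  intro a b hab
  rw [homog_comp, homog_comp] at hab ⊢
  exact hu _ _ hab

/-- The coordinates discarded at the boundary form one level, so on a lattice vector they share one
integer value `c`. It shifts the height by `c` times `botCoeff m z`, and the height is otherwise
determined by the remaining coordinates. -/
lemma boundaryIndex_graphOver [Finite ι] (hg : ∀ x ∈ cone y, g x = pairing m x)
    (h : OrderLim y z) (h1 : OneLevel y z) (hpos : 0 < botCoeff m z)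
    (hbF : boundaryFace (some '' I) (sedentarity (liftBot z)) (graphOver g (cone y))
      = cone (y ∘ finiteCoord h.1)) :
    (boundaryIndex (some '' I) (sedentarity (liftBot z)) none (graphOver g (cone y)) : ℤ)
      = botCoeff m z := by
  -- The height minus its value for `c = 0`: the image of the lattice is cut out by divisibility of
  -- `φ` by the coefficient.
  let φ : ℤ × ({b : Option ι // b ∉ sedentarity (liftBot z)} → ℤ) →+ ℤ :=
    { toFun := fun q => q.1 - pairing m (fillIn I z 0 q.2)
      map_zero' := by
        have : fillIn I z 0 0 = (0 : {a // a ∉ I} → ℤ) := by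
          funext a
          by_cases ha : z a = ⊥ <;> simp [fillIn, ha]
        rw [Prod.fst_zero, Prod.snd_zero, this]
        simp [pairing]
      map_add' := by
        intro q q'
        have : fillIn I z 0 (q.2 + q'.2) = fillIn I z 0 q.2 + fillIn I z 0 q'.2 := by
          funext a
          by_cases ha : z a = ⊥ <;> simp [fillIn, ha]
        rw [Prod.fst_add, Prod.snd_add, this, pairing_add]
        ring }
  have hH : (lattice (graphOver g (cone y))).map
      (coordProj (some '' I) (sedentarity (liftBot z)) none)
      = ((⊤ : AddSubgroup ℤ).prod (lattice (cone (y ∘ finiteCoord h.1)))) ⊓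
        (AddSubgroup.zmultiples (botCoeff m z)).comap φ := by
    ext q
    rw [AddSubgroup.mem_map, AddSubgroup.mem_inf, AddSubgroup.mem_prod, AddSubgroup.mem_comap,
      AddSubgroup.mem_zmultiples_iff]
    constructor
    · rintro ⟨u, hu, rfl⟩
      rw [mem_lattice_graphOver hg] at hu
      rw [coordProj_apply h.1]
      refine ⟨⟨AddSubgroup.mem_top _, comp_finiteCoord_mem_lattice h.1 hu.1⟩, ?_⟩
      obtain ⟨c, hc⟩ : ∃ c, ∀ a : {a // a ∉ I}, z a = ⊥ → latticeBase u a = c := by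
        by_cases hex : ∃ a : {a // a ∉ I}, z a = ⊥
        · obtain ⟨a, ha⟩ := hex
          refine ⟨latticeBase u a, fun b hb => ?_⟩
          exact mem_lattice_cone.1 hu.1 (some b) (some a) (h1 b a hb ha)
        · push Not at hex
          exact ⟨0, fun a ha => absurd ha (hex a)⟩
      refine ⟨c, ?_⟩
      change c • botCoeff m z = latticeHeight u - _
      rw [hu.2, pairing_eq_of_comp_eq h.1 hc, smul_eq_mul]
      ring
    · rintro ⟨⟨-, hw⟩, c, hc⟩
      refine ⟨addCoord (fillIn I z c q.2) q.1, ?_, ?_⟩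
      · rw [addCoord_mem_lattice_graphOver hg]
        refine ⟨fillIn_mem_lattice h hw, ?_⟩
        have h2 : c • botCoeff m z = q.1 - pairing m (fillIn I z 0 q.2) := hc
        rw [pairing_eq_of_comp_eq h.1 (c := c) fun a ha => fillIn_of_eq_bot ha, fillIn_comp]
        rw [smul_eq_mul] at h2
        linarith
      · rw [coordProj_apply h.1, latticeBase_addCoord, fillIn_comp]
        rfl
  have htop : ((⊤ : AddSubgroup ℤ).prod (lattice (cone (y ∘ finiteCoord h.1)))).map φ = ⊤ := by
    rw [eq_top_iff]
    intro s _
    refine ⟨(s, 0), ⟨AddSubgroup.mem_top _, AddSubgroup.zero_mem _⟩, ?_⟩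
    have : fillIn I z 0 0 = (0 : {a // a ∉ I} → ℤ) := by
      funext a
      by_cases ha : z a = ⊥ <;> simp [fillIn, ha]
    change s - pairing m (fillIn I z 0 0) = s
    rw [this]
    simp [pairing]
  -- As `φ` maps onto `ℤ`, the index is that of the multiples of the coefficient in `ℤ`.
  rw [boundaryIndex, hbF, hH, AddSubgroup.inf_relIndex_left, AddSubgroup.relIndex_comap, htop,
    AddSubgroup.relIndex_top_right, Int.index_zmultiples]
  exact Int.natAbs_of_nonneg hpos.le

/-- The dimension drops by the number of levels that go to `-∞`. -/
lemma dim_boundary_iff [Finite ι] {k : ℕ} (hy : levels y = k + 1) (h : OrderLim y z)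
    (hne : ∃ a : {a // a ∉ I}, z a = ⊥) :
    levels (y ∘ finiteCoord h.1) = k ↔ OneLevel y z := by
  have h1 := levels_eq_add h
  have h2 : levels (y ∘ finiteCoord h.1) = k ↔ (y '' {a | z a = ⊥}).ncard = 1 := by omega
  rw [h2, Set.ncard_eq_one]
  constructor
  · rintro ⟨v, hv⟩ a b ha hb
    have ha' : y a ∈ y '' {a | z a = ⊥} := ⟨a, ha, rfl⟩
    have hb' : y b ∈ y '' {a | z a = ⊥} := ⟨b, hb, rfl⟩
    rw [hv] at ha' hb'
    exact ha'.trans hb'.symm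
  · intro h3
    obtain ⟨a, ha⟩ := hne
    refine ⟨y a, Set.Subset.antisymm ?_ ?_⟩
    · rintro _ ⟨b, hb, rfl⟩
      exact h3 b a hb ha
    · rintro _ rfl
      exact ⟨a, ha, rfl⟩

open Classical in
/-- The contribution of a graph facet to the intersection with the last hyperplane. -/
lemma graphOver_contribution [Finite ι] {k : ℕ} (hy : levels y = k + 1) (hm : ∀ a, 0 ≤ m a)
    (hg : ∀ x ∈ cone y, g x = pairing m x) :
    (if liftBot z ∈ closure (toT (some '' I) '' graphOver g (cone y)) ∧
        dim (boundaryFace (some '' I) (sedentarity (liftBot z)) (graphOver g (cone y))) + 1 = k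
      then (boundaryIndex (some '' I) (sedentarity (liftBot z)) none (graphOver g (cone y)) : ℤ)
      else 0) = if OrderLim y z ∧ OneLevel y z then botCoeff m z else 0 := by
  -- For coefficient zero the closure of the graph misses the point, in accordance with the value
  -- zero on the right.
  rcases (botCoeff_nonneg hm z).eq_or_lt with h0 | hpos
  · rw [if_neg fun hc => liftBot_notMem_closure_graphOver hm hg h0.symm hc.1, ← h0]
    simp
  · by_cases h : OrderLim y z
    · have hne : ∃ a : {a // a ∉ I}, z a = ⊥ := by
        by_contra! hcon
        have : botCoeff m z = 0 := Finset.sum_eq_zero fun a _ => if_neg (hcon a)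
        exact hpos.ne' this
      have hbF := boundaryFace_eq_cone h (F := graphOver g (cone y)) (fun p hp => hp.1)
        fun x hx => toT_mem_closure_graphOver hg h hpos hx
      have hcl : liftBot z ∈ closure (toT (some '' I) '' graphOver g (cone y)) := by
        obtain ⟨x, hx, hiff⟩ := liftBot_mem_closure_iff (z := z) (F := graphOver g (cone y))
        rw [hiff, hbF]
        exact mem_cone_finiteCoord h hx
      by_cases h1 : OneLevel y z
      · rw [if_pos ⟨hcl, by rw [hbF, dim_cone, dim_boundary_iff hy h hne]; exact h1⟩,
          if_pos ⟨h, h1⟩, boundaryIndex_graphOver hg h h1 hpos hbF]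
      · rw [if_neg fun hc => h1 ?_, if_neg fun hc => h1 hc.2]
        have := hc.2
        rwa [hbF, dim_cone, dim_boundary_iff hy h hne] at this
    · rw [if_neg fun hc => h ?_, if_neg fun hc => h hc.1]
      exact orderLim_of_mem_closure (fun p hp => hp.1) hc.1

open Classical in
/-- The contribution of a facet below a codimension one face to the intersection with the last
hyperplane. -/
lemma underGraph_contribution [Finite ι] {k : ℕ} (hy : levels y = k) (hm : ∀ a, 0 ≤ m a)
    (hg : ∀ x ∈ cone y, g x = pairing m x) :
    (if liftBot z ∈ closure (toT (some '' I) '' underGraph g (cone y)) ∧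
        dim (boundaryFace (some '' I) (sedentarity (liftBot z)) (underGraph g (cone y))) + 1 = k
      then (boundaryIndex (some '' I) (sedentarity (liftBot z)) none (underGraph g (cone y)) : ℤ)
      else 0) = if OrderLim y z ∧ ∀ a : {a // a ∉ I}, z a ≠ ⊥ then 1 else 0 := by
  by_cases h : OrderLim y z
  · have hbF := boundaryFace_eq_cone h (F := underGraph g (cone y)) (fun p hp => hp.1)
      fun x hx => toT_mem_closure_underGraph hm hg h hx
    have hcl : liftBot z ∈ closure (toT (some '' I) '' underGraph g (cone y)) := by
      obtain ⟨x, hx, hiff⟩ := liftBot_mem_closure_iff (z := z) (F := underGraph g (cone y))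
      rw [hiff, hbF]
      exact mem_cone_finiteCoord h hx
    have hlev := levels_eq_add h
    by_cases h1 : ∀ a : {a // a ∉ I}, z a ≠ ⊥
    · have hemp : y '' {a | z a = ⊥} = ∅ := by
        rw [Set.image_eq_empty]
        exact Set.eq_empty_of_forall_notMem fun a ha => h1 a ha
      rw [hemp, Set.ncard_empty, hy] at hlev
      rw [if_pos ⟨hcl, by rw [hbF, dim_cone]; omega⟩, if_pos ⟨h, h1⟩]
      have hH : (lattice (underGraph g (cone y))).map
          (coordProj (some '' I) (sedentarity (liftBot z)) none)
          = (⊤ : AddSubgroup ℤ).prod (lattice (cone (y ∘ finiteCoord h.1))) := by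
        ext q
        rw [AddSubgroup.mem_map, AddSubgroup.mem_prod]
        constructor
        · rintro ⟨u, hu, rfl⟩
          rw [mem_lattice_underGraph ⟨y, mem_cone_self y⟩ hg] at hu
          rw [coordProj_apply h.1]
          exact ⟨AddSubgroup.mem_top _, comp_finiteCoord_mem_lattice h.1 hu⟩
        · rintro ⟨-, hw⟩
          refine ⟨addCoord (fillIn I z 0 q.2) q.1, ?_, ?_⟩
          · rw [mem_lattice_underGraph ⟨y, mem_cone_self y⟩ hg, latticeBase_addCoord]
            exact fillIn_mem_lattice h hw
          · rw [coordProj_apply h.1, latticeBase_addCoord, fillIn_comp]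
            rfl
      rw [boundaryIndex, hbF, hH, AddSubgroup.relIndex_self, Nat.cast_one]
    -- The base is already of codimension one; losing a level as well makes the boundary face too
    -- small to count.
    · rw [if_neg fun hc => h1 ?_, if_neg fun hc => h1 hc.2]
      have h2 := hc.2
      rw [hbF, dim_cone] at h2
      intro a ha
      have h3 : 0 < (y '' {a | z a = ⊥}).ncard :=
        (Set.ncard_pos (Set.toFinite _)).2 ⟨y a, a, ha, rfl⟩
      omega
  · rw [if_neg fun hc => h ?_, if_neg fun hc => h hc.1]
    exact orderLim_of_mem_closure (fun p hp => hp.1) hc.1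

end Boundary

end TropMod
end

noncomputable section

namespace TropMod

/-! ### Points of Bergman fans -/

section Bergman

open Filter Topology

variable {α : Type*} {M : Matroid α}

/-- The tropical incidence relations of `M`. -/
def IsTrop (M : Matroid α) (X : α → TT) : Prop :=
  ∀ S e, e ∈ M.closure S → X e = ⊥ ∨ ∃ a ∈ S, a ∈ M.E ∧ X e ≤ X a

lemma IsTrop.eq_bot_of_isLoop {X : α → TT} (h : IsTrop M X) {a : α} (ha : M.IsLoop a) :
    X a = ⊥ := by
  rcases h ∅ a ha with h | ⟨b, hb, -⟩
  · exact h
  · exact absurd hb (Set.notMem_empty b)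

lemma not_subset_loops {e : α} {S : Set α} (he : ¬ M.IsLoop e) (hS : e ∈ M.closure S) :
    ∃ a ∈ S, a ∈ M.E ∧ ¬ M.IsLoop a := by
  by_contra! hcon
  apply he
  rw [← M.closure_inter_ground] at hS
  have : M.closure (S ∩ M.E) ⊆ M.loops := by
    rw [← M.closure_loops]
    exact M.closure_subset_closure fun a ha => hcon a ha.1 ha.2
  exact this hS

open Classical in
/-- Extension of homogeneous coordinates to the whole type. -/
def extendBot {E : Set α} (y : E → TT) : α → TT := fun a => if h : a ∈ E then y ⟨a, h⟩ else ⊥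

lemma extendBot_of_mem {E : Set α} {y : E → TT} {a : α} (h : a ∈ E) :
    extendBot y a = y ⟨a, h⟩ := dif_pos h

lemma continuous_extendBot {E : Set α} (a : α) :
    Continuous fun y : HomCoord E => extendBot y.1 a := by
  by_cases h : a ∈ E
  · simp only [extendBot_of_mem h]
    exact (continuous_apply _).comp continuous_subtype_val
  · simp only [extendBot, h, dif_neg, not_false_eq_true]
    exact continuous_const

/-- Finiteness of the ground set makes the existential quantifier in each relation a finite union of
closed conditions. -/
lemma isClosed_isTrop [M.Finite] : IsClosed {y : HomCoord M.E | IsTrop M (extendBot y.1)} := by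
  simp only [IsTrop, Set.ofPred_forall]
  refine isClosed_iInter fun S => isClosed_iInter fun e => isClosed_iInter fun _ => ?_
  rw [Set.ofPred_or]
  refine (isClosed_eq (continuous_extendBot e) continuous_const).union ?_
  have : {y : HomCoord M.E | ∃ a ∈ S, a ∈ M.E ∧ extendBot y.1 e ≤ extendBot y.1 a}
      = ⋃ a ∈ S ∩ M.E, {y : HomCoord M.E | extendBot y.1 e ≤ extendBot y.1 a} := by
    ext y
    simp [and_assoc]
  rw [this]
  exact (M.ground_finite.subset Set.inter_subset_right).isClosed_biUnion fun a _ =>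
    isClosed_le (continuous_extendBot e) (continuous_extendBot a)

lemma isTrop_shift {y y' : HomCoord M.E} {t : ℝ} (h : ∀ a, y'.1 a = y.1 a + (t : TT))
    (hy : IsTrop M (extendBot y.1)) : IsTrop M (extendBot y'.1) := by
  intro S e he
  have heE := M.mem_ground_of_mem_closure he
  rcases hy S e he with h1 | ⟨a, ha, haE, hle⟩
  · left
    rw [extendBot_of_mem heE] at h1 ⊢
    rw [h, h1, WithBot.bot_add]
  · right
    refine ⟨a, ha, haE, ?_⟩
    rw [extendBot_of_mem heE, extendBot_of_mem haE] at hle ⊢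
    rw [h, h]
    gcongr

lemma isTrop_coneVector {m : ℕ} {F : Fin m → Set α} {c : Fin m → ℝ} (hF : StrictMono F)
    (hflat : ∀ l, (M ＼ M.loops).IsFlat (F l)) (hc : ∀ l, 0 ≤ c l) :
    IsTrop M (extendBot (coneVector M F c)) := by
  classical
  intro S e he
  have heE := M.mem_ground_of_mem_closure he
  rw [extendBot_of_mem heE]
  by_cases hloop : e ∈ M.loops
  · exact Or.inl (if_pos hloop)
  right
  have hex : ∃ a ∈ S, a ∈ M.E ∧ a ∉ M.loops ∧ ∀ l, a ∈ F l → e ∈ F l := by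
    by_cases hne : ∃ l, e ∉ F l
    -- Take the largest flat of the chain missing `e`. It cannot contain all nonloops of `S`, and an
    -- element of `S` outside it lies only in flats that contain `e`.
    · obtain ⟨l, hl, hmax⟩ := Set.exists_max_image {l | e ∉ F l} id (Set.toFinite _) hne
      by_contra! hcon
      have hsub : ∀ a ∈ S, a ∈ M.E → a ∉ M.loops → a ∈ F l := by
        intro a haS haE haL
        obtain ⟨l', hl', hel'⟩ := hcon a haS haE haL
        exact hF.monotone (hmax l' hel') hl'
      apply hl
      rw [← (hflat l).closure, M.delete_closure_eq]
      refine ⟨?_, hloop⟩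
      have h1 : e ∈ M.closure ((S ∩ M.E) \ M.loops) := by
        rwa [M.closure_sdiff_loops_eq, M.closure_inter_ground]
      refine M.closure_subset_closure ?_ h1
      rintro a ⟨⟨haS, haE⟩, haL⟩
      exact ⟨hsub a haS haE haL, haL⟩
    · push Not at hne
      obtain ⟨a, ha, haE, haL⟩ := not_subset_loops hloop he
      exact ⟨a, ha, haE, haL, fun l _ => hne l⟩
  obtain ⟨a, ha, haE, haL, hle⟩ := hex
  refine ⟨a, ha, haE, ?_⟩
  rw [extendBot_of_mem haE]
  rw [coneVector, coneVector, if_neg hloop, if_neg haL, WithBot.coe_le_coe, neg_le_neg_iff]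
  refine Finset.sum_le_sum fun l _ => ?_
  by_cases hal : a ∈ F l
  · rw [if_pos hal, if_pos (hle l hal)]
  · rw [if_neg hal]
    split_ifs
    exacts [hc l, le_rfl]

/-- If the coefficients of a chain of sublevel sets are the gaps between consecutive values, the sum
at a point telescopes to the largest value minus its own. -/
lemma sum_telescope : ∀ (m : ℕ) (t : Fin (m + 1) → ℝ) (q : Fin (m + 1)),
    (∑ l : Fin m, if q ≤ l.castSucc then t l.succ - t l.castSucc else 0)
      = t (Fin.last m) - t q := by
  intro m
  induction m with
  | zero =>
    intro t q
    have hq : q = Fin.last 0 := Fin.fin_one_eq_zero q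
    simp [hq]
  | succ m ih =>
    intro t q
    rw [Fin.sum_univ_castSucc]
    rcases Fin.eq_castSucc_or_eq_last q with ⟨q, rfl⟩ | rfl
    · have := ih (fun l => t l.castSucc) q
      simp only [Fin.castSucc_le_castSucc_iff] at this ⊢
      simp only [← Fin.succ_castSucc] at this ⊢
      rw [this, if_pos (Fin.le_last q), Fin.succ_last]
      ring
    · have h1 : ∀ l : Fin (m + 1), ¬ Fin.last (m + 1) ≤ l.castSucc := fun l =>
        not_le.2 (Fin.castSucc_lt_last l)
      simp [h1]

/-- The points of the union of open cones defining the Bergman fan. -/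
def bergmanCones (M : Matroid α) : Set (TProj M.E) :=
  {p | ∃ (m : ℕ) (F : Fin m → Set α) (c : Fin m → ℝ) (y : HomCoord M.E),
    StrictMono F ∧
    (∀ l, (M ＼ M.loops).IsFlat (F l) ∧ (F l).Nonempty ∧ F l ≠ (M ＼ M.loops).E) ∧
    (∀ l, 0 ≤ c l) ∧
    y.1 = coneVector M F c ∧ p = TProj.mk y}

/-- The chain consists of the sublevel sets at all values except the largest, with the gaps as
coefficients; subtracting the largest value is the change of homogeneous representative. -/
lemma mk_mem_bergmanCones [M.Finite] {y : HomCoord M.E} (hy : IsTrop M (extendBot y.1))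
    (hloop : ∀ a : M.E, y.1 a = ⊥ → M.IsLoop a) : TProj.mk y ∈ bergmanCones M := by
  classical
  have hfinE : Finite M.E := M.ground_finite
  have : Fintype M.E := Fintype.ofFinite M.E
  let r : M.E → ℝ := fun a => (y.1 a).unbotD 0
  have hr : ∀ a : M.E, ¬ M.IsLoop a → y.1 a = ((r a : ℝ) : TT) := by
    intro a ha
    obtain ⟨s, hs⟩ := WithBot.ne_bot_iff_exists.1 (mt (hloop a) ha)
    simp only [r]
    rw [← hs, WithBot.unbotD_coe]
  have hbot : ∀ a : M.E, M.IsLoop a → y.1 a = ⊥ := by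
    intro a ha
    have := hy.eq_bot_of_isLoop ha
    rwa [extendBot_of_mem a.2] at this
  let V : Finset ℝ := (Finset.univ.filter fun a : M.E => ¬ M.IsLoop a).image r
  obtain ⟨a₀, ha₀⟩ := y.2
  have hVne : V.Nonempty := ⟨r a₀, Finset.mem_image_of_mem r (Finset.mem_filter.2
    ⟨Finset.mem_univ _, fun h => ha₀ (hbot a₀ h)⟩)⟩
  obtain ⟨m, hm⟩ : ∃ m, V.card = m + 1 := ⟨V.card - 1, by have := hVne.card_pos; omega⟩
  let t := V.orderEmbOfFin hm
  have htV : ∀ q, ∃ a : M.E, ¬ M.IsLoop a ∧ r a = t q := by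
    intro q
    obtain ⟨a, ha, hat⟩ := Finset.mem_image.1 (V.orderEmbOfFin_mem hm q)
    exact ⟨a, (Finset.mem_filter.1 ha).2, hat⟩
  have hVt : ∀ a : M.E, ¬ M.IsLoop a → ∃ q, t q = r a := by
    intro a ha
    have h1 : r a ∈ V := Finset.mem_image_of_mem r (Finset.mem_filter.2 ⟨Finset.mem_univ _, ha⟩)
    have h2 : r a ∈ Set.range t := by rw [Finset.range_orderEmbOfFin]; exact h1
    exact h2
  let F : Fin m → Set α := fun l => {a | ∃ h : a ∈ M.E, ¬ M.IsLoop a ∧ r ⟨a, h⟩ ≤ t l.castSucc}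
  let c : Fin m → ℝ := fun l => t l.succ - t l.castSucc
  have hcone : ∀ a : M.E, y.1 a = coneVector M F c a + ((t (Fin.last m) : ℝ) : TT) := by
    intro a
    by_cases ha : M.IsLoop a
    · rw [hbot a ha, coneVector, if_pos (show a.1 ∈ M.loops from ha), WithBot.bot_add]
    · rw [hr a ha, coneVector, if_neg (show a.1 ∉ M.loops from ha), ← WithBot.coe_add, WithBot.coe_inj]
      obtain ⟨q, hq⟩ := hVt a ha
      have h2 : ∀ l : Fin m, a.1 ∈ F l ↔ q ≤ l.castSucc := by
        intro l
        rw [← t.le_iff_le, hq]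
        exact ⟨fun ⟨_, _, h⟩ => h, fun h => ⟨a.2, ha, h⟩⟩
      have h3 : ∀ s : ℝ, s = t (Fin.last m) - t q → r a = -s + t (Fin.last m) := by
        intro s hs
        rw [hs, hq]
        ring
      apply h3
      rw [← sum_telescope m t q]
      refine Finset.sum_congr rfl fun l _ => ?_
      by_cases hl : q ≤ l.castSucc
      · rw [if_pos hl, if_pos ((h2 l).2 hl)]
      · rw [if_neg hl, if_neg (mt (h2 l).1 hl)]
  have hne : ∃ a, coneVector M F c a ≠ ⊥ := by
    refine ⟨a₀, fun h => ha₀ ?_⟩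
    rw [hcone, h, WithBot.bot_add]
  refine ⟨m, F, c, ⟨coneVector M F c, hne⟩, ?_, ?_, ?_, rfl, ?_⟩
  · intro l l' hll
    refine ⟨fun a ⟨h, hl, hle⟩ => ⟨h, hl, hle.trans (t.monotone (Fin.castSucc_le_castSucc_iff.2
      hll.le))⟩, fun hcon => ?_⟩
    obtain ⟨a, ha, hat⟩ := htV l'.castSucc
    obtain ⟨_, _, hle⟩ := hcon (show a.1 ∈ F l' from ⟨a.2, ha, hat.le⟩)
    have hle' : r a ≤ t l.castSucc := hle
    rw [hat, t.le_iff_le, Fin.castSucc_le_castSucc_iff] at hle'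
    exact absurd hll (not_lt.2 hle')
  · intro l
    refine ⟨?_, ?_, ?_⟩
    · rw [Matroid.isFlat_iff_closure_eq, M.delete_closure_eq]
      apply Set.Subset.antisymm
      · rintro e ⟨he, hel⟩
        have heE := M.mem_ground_of_mem_closure he
        rcases hy _ _ he with h1 | ⟨a, ⟨⟨haE, haL, hle⟩, -⟩, -, hea⟩
        · rw [extendBot_of_mem heE] at h1
          exact absurd (hloop _ h1) hel
        · rw [extendBot_of_mem heE, extendBot_of_mem haE, hr ⟨a, haE⟩ haL, hr ⟨e, heE⟩ hel,
            WithBot.coe_le_coe] at hea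
          exact ⟨heE, hel, hea.trans hle⟩
      · intro a ha
        obtain ⟨haE, haL, -⟩ := id ha
        exact ⟨M.mem_closure_of_mem' ⟨ha, haL⟩ haE, haL⟩
    · obtain ⟨a, ha, hat⟩ := htV l.castSucc
      exact ⟨a, a.2, ha, hat.le⟩
    · obtain ⟨a, ha, hat⟩ := htV l.succ
      intro h
      have h1 : a.1 ∈ F l := by rw [h]; exact ⟨a.2, ha⟩
      obtain ⟨_, _, hle⟩ := h1
      have hle' : r a ≤ t l.castSucc := hle
      rw [hat, t.le_iff_le] at hle'
      exact absurd (Fin.castSucc_lt_succ (i := l)) (not_lt.2 hle')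
  · intro l
    exact sub_nonneg.2 (t.monotone (Fin.castSucc_lt_succ (i := l)).le)
  · refine Quotient.sound (s := homSetoid M.E) ?_
    exact (homSetoid M.E).symm ⟨_, hcone⟩

/-- The incidence relations are closed and hold on the open cones. Conversely, replacing `-∞` by
`-n` at all nonloops keeps the relations for large `n` and gives points of the open cones that
converge. -/
lemma mk_mem_bergmanFan_iff [M.Finite] {y : HomCoord M.E} :
    TProj.mk y ∈ bergmanFan M ↔ IsTrop M (extendBot y.1) := by
  classical
  constructor
  · intro h
    let C : Set (TProj M.E) := {p | ∃ y : HomCoord M.E, TProj.mk y = p ∧ IsTrop M (extendBot y.1)}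
    have hpre : ∀ y : HomCoord M.E, TProj.mk y ∈ C → IsTrop M (extendBot y.1) := by
      rintro y ⟨y', hyy', hy'⟩
      obtain ⟨t, ht⟩ := Quotient.exact (s := homSetoid M.E) hyy'
      exact isTrop_shift ht hy'
    have hC : IsClosed C := by
      have hq : IsQuotientMap (TProj.mk : HomCoord M.E → TProj M.E) := isQuotientMap_quot_mk
      rw [← hq.isClosed_preimage]
      convert isClosed_isTrop (M := M) using 1
      ext y
      exact ⟨hpre y, fun hy => ⟨y, rfl, hy⟩⟩
    have hsub : bergmanFan M ⊆ C := by
      apply closure_minimal _ hC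
      rintro p ⟨m, F, c, y, hF, hflat, hc, hy, rfl⟩
      refine ⟨y, rfl, ?_⟩
      rw [hy]
      exact isTrop_coneVector hF (fun l => (hflat l).1) hc
    exact hpre y (hsub h)
  · intro hy
    have hfinE : Finite M.E := M.ground_finite
    let Y : ℕ → M.E → TT := fun n a =>
      if y.1 a = ⊥ ∧ ¬ M.IsLoop a then ((-(n : ℝ) : ℝ) : TT) else y.1 a
    have hYne : ∀ n a, y.1 a ≠ ⊥ → Y n a = y.1 a := fun n a h => if_neg fun hc => h hc.1
    obtain ⟨a₀, ha₀⟩ := y.2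
    let Y' : ℕ → HomCoord M.E := fun n => ⟨Y n, a₀, by rw [hYne n a₀ ha₀]; exact ha₀⟩
    have hlim : Tendsto Y' atTop (𝓝 y) := by
      rw [tendsto_subtype_rng, tendsto_pi_nhds]
      intro a
      by_cases h : y.1 a = ⊥ ∧ ¬ M.IsLoop a
      · have h1 : ∀ n, (Y' n).1 a = ((-(n : ℝ) : ℝ) : TT) := fun n => if_pos h
        simp only [h1, h.1]
        exact tendsto_coe_bot (tendsto_neg_atTop_atBot.comp tendsto_natCast_atTop_atTop)
      · have h1 : ∀ n, (Y' n).1 a = y.1 a := fun n => if_neg h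
        simp only [h1]
        exact tendsto_const_nhds
    have hcont : Continuous (TProj.mk : HomCoord M.E → TProj M.E) := continuous_quot_mk
    refine mem_closure_of_tendsto ((hcont.tendsto y).comp hlim) ?_
    -- From here on `-n` is below all finite coordinates, so the perturbed point has the same order.
    have hev : ∀ᶠ n : ℕ in atTop, ∀ a : M.E, y.1 a ≠ ⊥ → ((-(n : ℝ) : ℝ) : TT) ≤ y.1 a := by
      rw [eventually_all]
      intro a
      by_cases h : y.1 a = ⊥
      · exact Eventually.of_forall fun n hn => absurd h hn
      · obtain ⟨s, hs⟩ := WithBot.ne_bot_iff_exists.1 h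
        filter_upwards [tendsto_natCast_atTop_atTop.eventually_ge_atTop (-s)] with n hn _
        rw [← hs, WithBot.coe_le_coe]
        linarith
    filter_upwards [hev] with n hn
    refine mk_mem_bergmanCones (y := Y' n) ?_ ?_
    · intro S e he
      have heE := M.mem_ground_of_mem_closure he
      rw [extendBot_of_mem heE]
      by_cases hel : M.IsLoop e
      · left
        have h1 := hy.eq_bot_of_isLoop hel
        rw [extendBot_of_mem heE] at h1
        exact (if_neg fun hc => hc.2 hel).trans h1
      · right
        by_cases heb : y.1 ⟨e, heE⟩ = ⊥
        · obtain ⟨a, ha, haE, haL⟩ := not_subset_loops hel he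
          refine ⟨a, ha, haE, ?_⟩
          rw [extendBot_of_mem haE]
          have h1 : (Y' n).1 ⟨e, heE⟩ = ((-(n : ℝ) : ℝ) : TT) := if_pos ⟨heb, hel⟩
          rw [h1]
          by_cases hab : y.1 ⟨a, haE⟩ = ⊥
          · have h2 : (Y' n).1 ⟨a, haE⟩ = ((-(n : ℝ) : ℝ) : TT) := if_pos ⟨hab, haL⟩
            rw [h2]
          · have h2 : (Y' n).1 ⟨a, haE⟩ = _ := hYne n _ hab
            rw [h2]
            exact hn _ hab
        · rcases hy S e he with h1 | ⟨a, ha, haE, hle⟩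
          · rw [extendBot_of_mem heE] at h1
            exact absurd h1 heb
          · refine ⟨a, ha, haE, ?_⟩
            rw [extendBot_of_mem heE, extendBot_of_mem haE] at hle
            have hab : y.1 ⟨a, haE⟩ ≠ ⊥ := fun h => heb (by rw [h] at hle; exact le_bot_iff.1 hle)
            rw [extendBot_of_mem haE]
            have h1 : (Y' n).1 ⟨e, heE⟩ = _ := hYne n _ heb
            have h2 : (Y' n).1 ⟨a, haE⟩ = _ := hYne n _ hab
            rw [h1, h2]
            exact hle
    · intro a ha
      by_contra hcon
      by_cases hab : y.1 a = ⊥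
      · have h1 : (Y' n).1 a = ((-(n : ℝ) : ℝ) : TT) := if_pos ⟨hab, hcon⟩
        rw [h1] at ha
        exact WithBot.coe_ne_bot ha
      · have h1 : (Y' n).1 a = _ := hYne n a hab
        exact hab (h1.symm.trans ha)

open Classical in
/-- Homogeneous coordinates, on the whole type, of a point of the chart `U_j`. -/
def chartCoord {E : Set α} {j : α} (x : ChartIndex E j → TT) : α → TT :=
  fun a => if a = j then 0 else if h : a ∈ E ∧ a ≠ j then x ⟨a, h⟩ else ⊥

lemma chartCoord_self {E : Set α} {j : α} (x : ChartIndex E j → TT) : chartCoord x j = 0 :=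
  if_pos rfl

lemma chartCoord_coe {E : Set α} {j : α} (x : ChartIndex E j → TT) (a : ChartIndex E j) :
    chartCoord x a.1 = x a := by
  rw [chartCoord, if_neg a.2.2, dif_pos a.2]

lemma mem_bergmanChart_iff [M.Finite] {j : α} (hj : j ∈ M.E) {x : ChartIndex M.E j → TT} :
    x ∈ bergmanChart M hj ↔ IsTrop M (chartCoord x) := by
  classical
  change chartPoint hj x ∈ bergmanFan M ↔ _
  rw [chartPoint, mk_mem_bergmanFan_iff]
  have : ∀ a ∈ M.E, extendBot (E := M.E) (fun a => if h : a.1 = j then (0 : TT)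
      else x ⟨a.1, a.2, h⟩) a = chartCoord x a := by
    intro a ha
    rw [extendBot_of_mem ha]
    by_cases h : a = j
    · simp [chartCoord, h]
    · simp [chartCoord, h, ha]
  refine forall_congr' fun S => forall_congr' fun e => forall_congr' fun he => ?_
  rw [this e (M.mem_ground_of_mem_closure he)]
  refine or_congr Iff.rfl (exists_congr fun a => and_congr_right fun _ => ?_)
  refine and_congr_right fun haE => ?_
  rw [this a haE]

end Bergman

end TropMod
end

noncomputable section

namespace TropMod

/-! ### Deletion and contraction of an element -/

section Minors

variable {α T : Type*} {A : Type*} [LinearOrder A] {M : Matroid α} {lab : T → α} {i : α}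

lemma mem_closure_delete_iff {S : Set α} {e : α} (hS : i ∉ S) (he : e ≠ i) :
    e ∈ (M ＼ {i}).closure S ↔ e ∈ M.closure S := by
  rw [M.delete_closure_eq, Set.sdiff_singleton_eq_self hS]
  exact ⟨fun h => h.1, fun h => ⟨h, he⟩⟩

lemma mem_closure_contract_iff {S : Set α} {e : α} :
    e ∈ (M ／ {i}).closure S ↔ e ∈ M.closure (insert i S) ∧ e ≠ i := by
  rw [M.contract_closure_eq, Set.union_singleton]
  rfl

lemma isLev_delete_iff (hi : ∀ a, lab a ≠ i) {h : T → A} :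
    IsLev (M ＼ {i}) lab h ↔ IsLev M lab h := by
  refine forall_congr' fun S => forall_congr' fun e => ?_
  rw [mem_closure_delete_iff _ (hi e)]
  rintro ⟨a, -, ha⟩
  exact hi a ha

lemma isLev_contract_iff (hi : ∀ a, lab a ≠ i) {h : T → A} :
    IsLev (M ／ {i}) lab h ↔
      ∀ S e, lab e ∈ M.closure (insert i (lab '' S)) → ∃ a ∈ S, h e ≤ h a := by
  refine forall_congr' fun S => forall_congr' fun e => ?_
  rw [mem_closure_contract_iff, and_iff_left (hi e)]

lemma IsLev.of_contract (hi : ∀ a, lab a ≠ i) {h : T → A} (hh : IsLev (M ／ {i}) lab h) :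
    IsLev M lab h := fun S e he =>
  (isLev_contract_iff hi).1 hh S e (M.closure_subset_closure (Set.subset_insert _ _) he)

lemma eRank_contract_add_one_le (hi : M.IsNonloop i) : (M ／ {i}).eRank + 1 ≤ M.eRank := by
  obtain ⟨B, hB⟩ := (M ／ {i}).exists_isBase
  obtain ⟨hiB, hind⟩ := hi.contractElem_indep_iff.1 hB.indep
  rw [← hB.encard_eq_eRank, ← Set.encard_insert_of_notMem hiB]
  exact hind.encard_le_eRank

/-- The levels of `i` that are compatible with `h`: `h a` is the largest value which can be given
to `i`. -/
def IsThreshold (M : Matroid α) (i : α) (lab : T → α) (h : T → A) (a : T) : Prop :=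
  i ∈ M.closure (lab '' {c | h c ≤ h a}) ∧ ∀ S, i ∈ M.closure (lab '' S) → ∃ s ∈ S, h a ≤ h s

/-- A threshold element found at one point serves on its whole closed cone, so that the threshold
function is a coordinate there. -/
lemma IsThreshold.coarsen {B : Type*} [LinearOrder B] {h : T → A} {g : T → B} {a : T}
    (ha : IsThreshold M i lab h a) (hg : ∀ p q, h p ≤ h q → g p ≤ g q) :
    IsThreshold M i lab g a := by
  refine ⟨M.closure_subset_closure (Set.image_mono fun c hc => hg c a hc) ha.1, fun S hS => ?_⟩
  obtain ⟨s, hs, hle⟩ := ha.2 S hS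
  exact ⟨s, hs, hg a s hle⟩

lemma IsThreshold.eq {h : T → A} {a b : T} (ha : IsThreshold M i lab h a)
    (hb : IsThreshold M i lab h b) : h a = h b := by
  have key : ∀ a b, IsThreshold M i lab h a → IsThreshold M i lab h b → h a ≤ h b := by
    intro a b ha hb
    obtain ⟨s, hs, hle⟩ := ha.2 _ hb.1
    exact hle.trans hs
  exact le_antisymm (key a b ha hb) (key b a hb ha)

lemma IsThreshold.notMem_closure_below {h : T → A} {a : T} (ha : IsThreshold M i lab h a) :
    i ∉ M.closure (lab '' below h a) := by
  intro hcon
  obtain ⟨s, hs, hle⟩ := ha.2 _ hcon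
  exact absurd hs (not_lt.2 hle)

/-- The level of an additional element. -/
lemma isLev_option_iff (hlab : ∀ a, lab a ∈ M.E) (hi : ∀ a, lab a ≠ i) {h : T → A} {t : A} {a : T}
    (ha : IsThreshold M i lab h a) :
    IsLev M (fun o : Option T => o.elim i lab) (fun o : Option T => o.elim t h) ↔
      IsLev M lab h ∧ (t = h a ∨ (t ≤ h a ∧ IsLev (M ／ {i}) lab h)) := by
  have himg : ∀ S : Set T,
      (fun o : Option T => o.elim i lab) '' (some '' S) = lab '' S := by
    intro S
    rw [Set.image_image]
    rfl
  have himg' : ∀ S : Set T, (fun o : Option T => o.elim i lab) '' insert none (some '' S)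
      = insert i (lab '' S) := by
    intro S
    rw [Set.image_insert_eq, himg]
    rfl
  rw [isLev_contract_iff hi]
  constructor
  · intro hL
    have h1 : IsLev M lab h := by
      intro S e he
      rw [← himg] at he
      obtain ⟨_, ⟨s, hs, rfl⟩, hle⟩ := hL _ (some e) he
      exact ⟨s, hs, hle⟩
    refine ⟨h1, ?_⟩
    have h2 : t ≤ h a := by
      have := ha.1
      rw [← himg] at this
      obtain ⟨_, ⟨s, hs, rfl⟩, hle⟩ := hL _ none this
      exact le_trans hle hs
    rcases h2.eq_or_lt with h3 | h3
    · exact Or.inl h3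
    refine Or.inr ⟨h2, fun S e he => ?_⟩
    by_contra! hcon
    have hle : h e ≤ t := by
      rw [← himg'] at he
      obtain ⟨o, ho, hle⟩ := hL _ (some e) he
      rcases ho with rfl | ⟨s, hs, rfl⟩
      · exact hle
      · exact absurd (hcon s hs) (not_lt.2 hle)
    have h4 : lab e ∉ M.closure (lab '' S) := by
      intro h5
      obtain ⟨s, hs, hle⟩ := h1 S e h5
      exact absurd (hcon s hs) (not_lt.2 hle)
    -- By exchange `i` is spanned by elements of level at most `h e ≤ t`, against the threshold
    -- being larger than `t`.
    have h5 := M.mem_closure_insert h4 he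
    rw [← Set.image_insert_eq] at h5
    obtain ⟨s, hs, hle'⟩ := ha.2 _ h5
    have h6 : h s ≤ h e := by
      rcases hs with rfl | hs
      · exact le_rfl
      · exact (hcon s hs).le
    exact absurd (hle'.trans (h6.trans hle)) (not_le.2 h3)
  · rintro ⟨h1, h2⟩ S o ho
    have hta : t ≤ h a := by
      rcases h2 with h2 | h2
      exacts [h2.le, h2.1]
    obtain ⟨S', hS'⟩ : ∃ S' : Set T, S' = {s | some s ∈ S} := ⟨_, rfl⟩
    have hmem : ∀ s ∈ S', some s ∈ S := by rw [hS']; exact fun s hs => hs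
    by_cases hn : none ∈ S
    · have hS : S = insert none (some '' S') := by
        ext o
        cases o <;> simp [hS', hn]
      cases o with
      | none => exact ⟨none, hn, le_rfl⟩
      | some e =>
        rw [hS, himg'] at ho
        rcases h2 with h2 | h2
        · by_contra! hcon
          have h3 : h a < h e := by rw [← h2]; exact hcon none hn
          -- In the relation, `i` is replaced by the elements up to the threshold, which span it and
          -- are all below `e`.
          have h4 : lab e ∈ M.closure (lab '' (S' ∪ {c | h c ≤ h a})) := by
            refine M.closure_subset_closure_of_subset_closure ?_ ho
            refine Set.insert_subset (M.closure_subset_closure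
              (Set.image_mono Set.subset_union_right) ha.1) ?_
            exact (Set.image_mono Set.subset_union_left).trans (subset_closure_image hlab _)
          obtain ⟨s, hs, hle⟩ := h1 _ _ h4
          rcases hs with hs | hs
          · exact absurd (hcon (some s) (hmem s hs)) (not_lt.2 hle)
          · exact absurd (hle.trans hs) (not_le.2 h3)
        · obtain ⟨s, hs, hle⟩ := h2.2 _ _ ho
          exact ⟨some s, hmem s hs, hle⟩
    · have hS : S = some '' S' := by
        ext o
        cases o <;> simp [hS', hn]
      rw [hS, himg] at ho
      cases o with
      | none =>
        obtain ⟨s, hs, hle⟩ := ha.2 _ ho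
        exact ⟨some s, hmem s hs, hta.trans hle⟩
      | some e =>
        obtain ⟨s, hs, hle⟩ := h1 _ _ ho
        exact ⟨some s, hmem s hs, hle⟩

/-- A relation of the contraction that fails at `e` gives, by exchange, that `i` is spanned by `e`
and strictly lower elements. This cannot happen for `e` below the threshold, and above it `i` can be
replaced by elements up to the threshold; only the threshold level itself is left. -/
lemma isLev_contract_iff_forall (hlab : ∀ a, lab a ∈ M.E) (hi : ∀ a, lab a ≠ i) {h : T → A}
    (hh : IsLev M lab h) {a : T} (ha : IsThreshold M i lab h a) :
    IsLev (M ／ {i}) lab h ↔ ∀ e, h e = h a → i ∉ M.closure (lab '' insert e (below h a)) := by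
  rw [isLev_contract_iff hi]
  constructor
  · intro hL e he hcon
    rw [Set.image_insert_eq] at hcon
    obtain ⟨s, hs, hle⟩ := hL _ _ (M.mem_closure_insert ha.notMem_closure_below hcon)
    rw [he] at hle
    exact absurd hs (not_lt.2 hle)
  · intro hno S e he
    by_contra! hcon
    have hnot : lab e ∉ M.closure (lab '' S) := by
      intro h5
      obtain ⟨s, hs, hle⟩ := hh S e h5
      exact absurd (hcon s hs) (not_lt.2 hle)
    rcases lt_or_ge (h a) (h e) with hlt | hge
    · have h4 : lab e ∈ M.closure (lab '' (S ∪ {c | h c ≤ h a})) := by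
        refine M.closure_subset_closure_of_subset_closure ?_ he
        refine Set.insert_subset (M.closure_subset_closure
          (Set.image_mono Set.subset_union_right) ha.1) ?_
        exact (Set.image_mono Set.subset_union_left).trans (subset_closure_image hlab _)
      obtain ⟨s, hs, hle⟩ := hh _ _ h4
      rcases hs with hs | hs
      · exact absurd (hcon s hs) (not_lt.2 hle)
      · exact absurd (hle.trans hs) (not_le.2 hlt)
    · have h5 := M.mem_closure_insert hnot he
      rw [← Set.image_insert_eq] at h5
      rcases hge.eq_or_lt with heq | hlt
      · refine hno e heq (M.closure_subset_closure (Set.image_mono ?_) h5)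
        refine Set.insert_subset_insert fun s hs => ?_
        change h s < h a
        rw [← heq]
        exact hcon s hs
      · obtain ⟨s, hs, hle⟩ := ha.2 _ h5
        rcases hs with rfl | hs
        · exact absurd hle (not_le.2 hlt)
        · exact absurd (hle.trans (hcon s hs).le) (not_le.2 hlt)

/-- After a splitting, the threshold falls to the lower half exactly when the lower half and the
levels below it already span `i`. -/
lemma IsLev.mem_lowSet_iff_of_isThreshold {B : Type*} [LinearOrder B] (hlab : ∀ a, lab a ∈ M.E)
    {h : T → A} {g : T → B} {a b : T} (hg : RefinesBy h (lowSet M lab h b) g)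
    (ha : IsThreshold M i lab g a) :
    a ∈ lowSet M lab h b ↔ h b = h a ∧ i ∈ M.closure (lab '' insert b (below h a)) := by
  constructor
  · intro hab
    refine ⟨hab.1.symm, M.closure_subset_closure_of_subset_closure ?_ ha.1⟩
    rintro _ ⟨c, hc, rfl⟩
    rw [below_congr hab.1]
    rcases (hg c a).1 hc with h1 | ⟨-, h2⟩
    · refine subset_closure_image hlab _ ⟨c, Or.inr ?_, rfl⟩
      change h c < h b
      rw [← hab.1]
      exact h1
    · exact (h2 hab).2
  · rintro ⟨hba, hcl⟩
    obtain ⟨s, hs, hle⟩ := ha.2 _ hcl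
    rcases hs with rfl | hs
    · rcases (hg a s).1 hle with h1 | ⟨-, h2⟩
      · exact absurd h1 (not_lt.2 hba.le)
      · exact h2 (mem_lowSet_self hlab h s)
    · rcases (hg a s).1 hle with h1 | ⟨h1, -⟩
      · exact absurd h1 (not_lt.2 (le_of_lt hs))
      · exact absurd hs (not_lt.2 h1.le)

/-- Exactly one of the splittings of a level makes `i` determine an element of this level. -/
lemma lowSet_eq_of_mem_closure {h : T → A}
    {a b c : T} (hab : h b = h a) (hac : h c = h a)
    (hn : i ∉ M.closure (lab '' below h a))
    (hb : i ∈ M.closure (lab '' insert b (below h a)))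
    (hc : i ∈ M.closure (lab '' insert c (below h a))) :
    lowSet M lab h b = lowSet M lab h c := by
  -- By exchange, a flat covering the one of the lower levels and containing `i` is spanned by `i`
  -- over it, so there is only one.
  have key : ∀ b, i ∈ M.closure (lab '' insert b (below h a)) →
      M.closure (lab '' insert b (below h a)) = M.closure (insert i (lab '' below h a)) := by
    intro b hb
    rw [Set.image_insert_eq] at hb ⊢
    exact (M.closure_insert_congr ⟨hb, hn⟩).symm
  ext d
  rw [lowSet, lowSet, Set.mem_ofPred_eq, Set.mem_ofPred_eq, below_congr hab, below_congr hac,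
    key b hb, key c hc, hab, hac]

end Minors

/-! ### Tropical incidence relations and levels -/

section Trop

variable {α T : Type*} {M : Matroid α}

lemma IsTrop.congr {X X' : α → TT} (h : ∀ a ∈ M.E, X a = X' a) : IsTrop M X ↔ IsTrop M X' := by
  refine forall_congr' fun S => forall_congr' fun e => forall_congr' fun he => ?_
  rw [h e (M.mem_ground_of_mem_closure he)]
  refine or_congr Iff.rfl (exists_congr fun a => and_congr_right fun _ => and_congr_right fun ha => ?_)
  rw [h a ha]

lemma IsTrop.isLev {X : α → TT} (h : IsTrop M X) {l : T → α}
    (hX : ∀ t, X (l t) = ⊥ → ¬ M.IsLoop (l t)) : IsLev M l (X ∘ l) := by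
  intro S e he
  rcases h _ _ he with h0 | ⟨_, ⟨s, hs, rfl⟩, -, hle⟩
  · obtain ⟨_, ⟨s, hs, rfl⟩, -, -⟩ := not_subset_loops (hX e h0) he
    refine ⟨s, hs, ?_⟩
    simp only [Function.comp_apply, h0, bot_le]
  · exact ⟨s, hs, hle⟩

/-- Loops at `-∞` satisfy their relations trivially and can be dropped from spanning sets, so only
the labelled elements matter. -/
lemma isTrop_iff_isLev {X : α → TT} {l : T → α} (hl : ∀ t, l t ∈ M.E)
    (hX : ∀ t, X (l t) = ⊥ → ¬ M.IsLoop (l t))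
    (hcov : ∀ a ∈ M.E, a ∈ Set.range l ∨ (M.IsLoop a ∧ X a = ⊥)) :
    IsTrop M X ↔ IsLev M l (X ∘ l) := by
  refine ⟨fun h => h.isLev hX, fun h S e he => ?_⟩
  rcases hcov e (M.mem_ground_of_mem_closure he) with ⟨t, rfl⟩ | ⟨-, h0⟩
  · right
    have hsub : l t ∈ M.closure (l '' (l ⁻¹' S)) := by
      rw [← M.closure_inter_ground, ← M.closure_sdiff_loops_eq] at he
      refine M.closure_subset_closure ?_ he
      rintro a ⟨⟨haS, haE⟩, haL⟩
      rcases hcov a haE with ⟨s, rfl⟩ | ⟨h1, -⟩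
      · exact ⟨s, haS, rfl⟩
      · exact absurd h1 haL
    obtain ⟨s, hs, hle⟩ := h _ _ hsub
    exact ⟨l s, hs, hl s, hle⟩
  · exact Or.inl h0

lemma isLev_coe_iff {l : T → α} {h : T → ℝ} :
    IsLev M l (fun t => ((h t : ℝ) : TT)) ↔ IsLev M l h :=
  ⟨fun hh => hh.coarsen fun _ _ => WithBot.coe_le_coe.1,
    fun hh => hh.coarsen fun _ _ => WithBot.coe_le_coe.2⟩

lemma IsTrop.encard_le [Finite T] {lab : T → α} {X : α → TT}
    (h : IsTrop M X) (hlab : ∀ o, lab o ∈ M.E) {R : Set TT}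
    (hR : ∀ r ∈ R, ∃ o, ¬ M.IsLoop (lab o) ∧ X (lab o) = r) : R.encard ≤ M.eRank := by
  have hlev := h.isLev (l := fun o : {o : T // ¬ M.IsLoop (lab o)} => lab o.1) fun t _ => t.2
  refine le_trans ?_ (hlev.ncard_range_le fun a => hlab a.1)
  rw [(Set.toFinite _).cast_ncard_eq]
  refine Set.encard_le_encard fun r hr => ?_
  obtain ⟨o, ho, rfl⟩ := hR r hr
  exact ⟨⟨o, ho⟩, rfl⟩

lemma exists_of_mem_range_homog {ι' : Type*} {lab : Option ι' → α} {X : α → TT} {J : Set ι'}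
    {x : {a // a ∉ J} → ℝ} (h : IsTrop M X)
    (hX : ∀ o, X (lab o) = homog (toT J x) o) (o : Option {a // a ∉ J}) :
    ∃ o', ¬ M.IsLoop (lab o') ∧ X (lab o') = ((homog x o : ℝ) : TT) := by
  have h1 : X (lab (o.map Subtype.val)) = ((homog x o : ℝ) : TT) := by rw [hX, homog_toT]
  refine ⟨_, fun hl => ?_, h1⟩
  rw [h.eq_bot_of_isLoop hl] at h1
  exact WithBot.bot_ne_coe h1

/-- A nonloop at `-∞` occupies a level of its own, distinct from the finite ones. This makes the
deeper strata negligible. -/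
lemma IsTrop.levels_add_one_le {ι' : Type*} [Finite ι'] {lab : Option ι' → α} {X : α → TT}
    {J : Set ι'} {x : {a // a ∉ J} → ℝ} (h : IsTrop M X) (hlab : ∀ o, lab o ∈ M.E)
    (hX : ∀ o, X (lab o) = homog (toT J x) o) {p : ι'} (hp : p ∈ J)
    (hpl : ¬ M.IsLoop (lab (some p))) : (levels x : ℕ∞) + 1 ≤ M.eRank := by
  refine le_trans ?_ (h.encard_le hlab
    (R := insert ⊥ ((fun r : ℝ => (r : TT)) '' Set.range (homog x))) ?_)
  · rw [Set.encard_insert_of_notMem, Function.Injective.encard_image fun _ _ => WithBot.coe_inj.1,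
      ← (Set.toFinite _).cast_ncard_eq]
    · rfl
    · rintro ⟨r, -, hr⟩
      exact WithBot.coe_ne_bot hr
  · rintro _ (rfl | ⟨_, ⟨o, rfl⟩, rfl⟩)
    · exact ⟨some p, hpl, by rw [hX]; exact toT_of_mem hp⟩
    · exact exists_of_mem_range_homog h hX o

lemma IsTrop.delete {X : α → TT} (h : IsTrop M X) (i : α) : IsTrop (M ＼ {i}) X := by
  intro S e he
  rw [M.delete_closure_eq] at he
  rcases h _ _ he.1 with h0 | ⟨a, ha, haE, hle⟩
  · exact Or.inl h0
  · exact Or.inr ⟨a, ha.1, ⟨haE, ha.2⟩, hle⟩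

end Trop

end TropMod
end

noncomputable section

namespace TropMod

/-! ### The weights below the ridges -/

section RidgeWeight

variable {α κ : Type*} [Finite κ] {M : Matroid α} {lab : Option κ → α} {i : α} {k : ℕ}

open Classical in
-- A facet counts if and only if the lower half of its splitting, with the levels below, spans `i`.
-- The flat spanned by the lower levels and `i` determines this splitting, so there is at most one;
-- it exists unless the level is tight or no single element of it yields `i`.
lemma sum_threshold_mem_lowPart (hlab : ∀ a, lab a ∈ M.E)
    (hspan : M.E ⊆ M.closure (Set.range lab)) (hr : M.eRank = (k + 1 : ℕ))
    {a : Set (κ → ℝ) → Option κ}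
    (ha : ∀ y ∈ levPoints M lab, IsThreshold M i lab (homog y) (a (cone y)))
    {y : κ → ℝ} (hy : y ∈ levPoints M lab) (hl : levels y = k) :
    (∑ F ∈ facets k (levFan M lab),
      if cone y ⊆ F ∧ a F ∈ lowPart (cone y) F then (1 : ℤ) else 0)
      = if IsTight M lab (homog y) (a (cone y)) ∨ ∀ e, homog y e = homog y (a (cone y)) →
          i ∉ M.closure (lab '' insert e (below (homog y) (a (cone y)))) then 0 else 1 := by
  have hay := ha y hy
  have hF : ∀ F ∈ facets k (levFan M lab), cone y ⊆ F → ∃ y' ∈ levPoints M lab, cone y' = F ∧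
      ∃ b, ¬ IsTight M lab (homog y) b ∧
        RefinesBy (homog y) (lowSet M lab (homog y) b) (homog y') ∧
        (a F ∈ lowPart (cone y) F ↔ homog y b = homog y (a (cone y)) ∧
          i ∈ M.closure (lab '' insert b (below (homog y) (a (cone y))))) := by
    intro F hF hyF
    obtain ⟨y', hy', -, rfl, b, hb, href, hlow⟩ := exists_of_mem_facets hlab hspan hr hy hl hF hyF
    refine ⟨y', hy', rfl, b, hb, href, ?_⟩
    have hay' := ha y' hy'
    have heq : homog y (a (cone y')) = homog y (a (cone y)) :=
      (hay'.coarsen fun p q hpq => href.le hpq).eq hay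
    rw [hlow, IsLev.mem_lowSet_iff_of_isThreshold hlab href hay', below_congr heq, heq]
  split_ifs with hcase
  · refine Finset.sum_eq_zero fun F hFm => if_neg ?_
    rintro ⟨hyF, hmem⟩
    obtain ⟨y', hy', rfl, b, hb, href, hiff⟩ := hF F hFm hyF
    obtain ⟨h1, h2⟩ := hiff.1 hmem
    rcases hcase with ht | hno
    · exact hb ((IsLev.isTight_congr hy hlab h1).2 ht)
    · exact hno b h1 h2
  · push Not at hcase
    obtain ⟨hnt, e, he, hie⟩ := hcase
    have hnte : ¬ IsTight M lab (homog y) e := fun h =>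
      hnt ((IsLev.isTight_congr hy hlab he).1 h)
    obtain ⟨y', hy', hyy', hlt, href⟩ := exists_refinement hlab hy hnte
    have hl' : levels y' = k + 1 := by
      have := levels_le_of_levPoints hlab hr hy'
      omega
    have hFm : cone y' ∈ facets k (levFan M lab) := mem_facets_levFan.2 ⟨y', hy', hl', rfl⟩
    rw [Finset.sum_eq_single (cone y')]
    · refine if_pos ⟨cone_subset hyy', ?_⟩
      have hay' := ha y' hy'
      have heq : homog y (a (cone y')) = homog y (a (cone y)) :=
        (hay'.coarsen fun p q hpq => href.le hpq).eq hay
      rw [lowPart_eq_lowSet hnte href, IsLev.mem_lowSet_iff_of_isThreshold hlab href hay',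
        below_congr heq, heq]
      exact ⟨he, hie⟩
    · intro F hFm' hne
      refine if_neg ?_
      rintro ⟨hyF, hmem⟩
      apply hne
      obtain ⟨y'', hy'', rfl, b, hb, href', hiff⟩ := hF F hFm' hyF
      obtain ⟨h1, h2⟩ := hiff.1 hmem
      have hlow := lowSet_eq_of_mem_closure h1 he hay.notMem_closure_below h2 hie
      rw [hlow] at href'
      exact cone_eq_of_iff fun p q => by rw [href', href]
    · exact fun h => absurd hFm h

open Classical in
-- A facet contributes the indicator of `none` minus that of its threshold, both for the lower half.
-- Subtracting the form of the ridge cancels the terms of `none` and leaves the indicator that the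
-- threshold level is not tight, minus the number of facets whose lower half contains the threshold.
lemma ridgeWeight_threshold (hlab : ∀ a, lab a ∈ M.E) (hi : ∀ a, lab a ≠ i)
    (hspan : M.E ⊆ M.closure (Set.range lab)) (hr : M.eRank = (k + 1 : ℕ))
    {a : Set (κ → ℝ) → Option κ}
    (ha : ∀ y ∈ levPoints M lab, IsThreshold M i lab (homog y) (a (cone y)))
    {y : κ → ℝ} (hy : y ∈ levPoints M lab) (hl : levels y = k) :
    ridgeWeight (facetChain k (levFan M lab)) normalVec (fun σ => coordForm (a σ)) (cone y)
      = if IsLev (M ／ {i}) lab (homog y) then 1 else 0 := by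
  have h1 : ∀ F ∈ facets k (levFan M lab),
      (if cone y ⊆ F then (1 : ℤ) * pairing (coordForm (a F)) (normalVec (cone y) F) else 0)
        = (if cone y ⊆ F ∧ none ∈ lowPart (cone y) F then (1 : ℤ) else 0)
          - if cone y ⊆ F ∧ a F ∈ lowPart (cone y) F then (1 : ℤ) else 0 := by
    intro F _
    by_cases hF : cone y ⊆ F
    · simp only [hF, true_and, if_true, one_mul, pairing_coordForm, normalVec, homog_dehomog]
      split_ifs <;> rfl
    · simp [hF]
  have hay := ha y hy
  rw [ridgeWeight, pairing_coordForm, homog_sum_normalVec hlab hspan hr hy hl, facetChain_sum,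
    Finset.sum_congr rfl h1, Finset.sum_sub_distrib, sum_lowPart hlab hspan hr hy hl,
    sum_threshold_mem_lowPart hlab hspan hr ha hy hl,
    isLev_contract_iff_forall hlab hi hy hay]
  by_cases hno : ∀ e, homog y e = homog y (a (cone y)) →
      i ∉ M.closure (lab '' insert e (below (homog y) (a (cone y))))
  · have hnt : ¬ IsTight M lab (homog y) (a (cone y)) := by
      intro ht
      refine hno _ rfl (M.closure_subset_closure_of_subset_closure ?_ hay.1)
      rintro _ ⟨c, hc, rfl⟩
      rcases (show homog y c ≤ _ from hc).eq_or_lt with h | h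
      · exact ht c h
      · exact subset_closure_image hlab _ ⟨c, Or.inr h, rfl⟩
    rw [if_pos hno, if_pos (Or.inr hno), if_neg hnt]
    ring
  · rw [if_neg hno]
    by_cases ht : IsTight M lab (homog y) (a (cone y))
    · rw [if_pos (Or.inl ht), if_pos ht]
      ring
    · rw [if_neg (not_or.2 ⟨ht, hno⟩), if_neg ht]
      ring

end RidgeWeight

/-! ### Tropical polynomials with dominant monomials -/

section Polynomials

variable {ι : Type*} {I : Set ι}

/-- The exponent vector of a homogeneous coordinate. -/
def coordMonomial {κ : Type*} (a : Option κ) : κ →₀ ℕ := a.elim 0 fun a => Finsupp.single a 1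

/-- The integral linear form of an exponent vector. -/
def toForm {κ : Type*} : (κ →₀ ℕ) →+ κ →₀ ℤ := Finsupp.mapRange.addMonoidHom (Nat.castAddMonoidHom ℤ)

lemma toForm_apply {κ : Type*} (μ : κ →₀ ℕ) (a : κ) : toForm μ a = μ a := rfl

lemma toForm_coordMonomial {κ : Type*} (a : Option κ) :
    toForm (coordMonomial a) = coordForm a := by
  cases a with
  | none => exact map_zero _
  | some a =>
    ext b
    rw [toForm_apply]
    by_cases h : a = b <;> simp [coordMonomial, coordForm, h]

lemma pairing_toForm {κ R : Type*} [CommRing R] (μ : κ →₀ ℕ) (x : κ → R) :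
    pairing (toForm μ) x = μ.sum fun a n => (n : R) * x a := by
  rw [pairing]
  refine (Finsupp.sum_mapRange_index (hf := map_zero _) fun a => by simp).trans ?_
  refine Finsupp.sum_congr fun a _ => ?_
  simp

open Classical in
/-- The tropical polynomial with coefficients zero and the exponents `μ σ`. -/
def polyOf {S : Type*} (K : Finset S) (μ : S → {a // a ∉ I} →₀ ℕ) : TropPoly ι where
  monomials := K.image fun σ => (μ σ).mapDomain Subtype.val
  coeff _ := 0

lemma monomial_toT (μ : {a // a ∉ I} →₀ ℕ) (x : {a // a ∉ I} → ℝ) :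
    ((μ.mapDomain Subtype.val).sum fun a n => n • toT I x a)
      = ((pairing (toForm μ) x : ℝ) : TT) := by
  rw [Finsupp.sum_mapDomain_index (h := fun a n => n • toT I x a)
      (fun a => zero_smul ℕ _) fun a m n => add_smul m n _,
    pairing_toForm, Finsupp.sum, Finsupp.sum, WithBot.coe_sum]
  refine Finset.sum_congr rfl fun a _ => ?_
  rw [toT_of_notMem a.2, ← WithBot.coe_nsmul, nsmul_eq_mul]

lemma polyOf_eval {S : Type*} {K : Finset S} {μ : S → {a // a ∉ I} →₀ ℕ} {σ : S} (hσ : σ ∈ K)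
    {x : {a // a ∉ I} → ℝ}
    (hx : ∀ τ ∈ K, pairing (toForm (μ τ)) x ≤ pairing (toForm (μ σ)) x) :
    (polyOf K μ).eval (toT I x) = ((pairing (toForm (μ σ)) x : ℝ) : TT) := by
  classical
  have h : ∀ τ, (((polyOf K μ).coeff ((μ τ).mapDomain Subtype.val) : ℝ) : TT)
      + (((μ τ).mapDomain Subtype.val).sum fun a n => n • toT I x a)
      = ((pairing (toForm (μ τ)) x : ℝ) : TT) := by
    intro τ
    rw [monomial_toT]
    exact zero_add _
  rw [TropPoly.eval]
  apply le_antisymm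
  · refine Finset.sup_le fun m hm => ?_
    obtain ⟨τ, hτ, rfl⟩ := Finset.mem_image.1 hm
    rw [h, WithBot.coe_le_coe]
    exact hx τ hτ
  · rw [← h σ]
    exact Finset.le_sup (f := fun m => (((polyOf K μ).coeff m : ℝ) : TT)
      + m.sum fun a n => n • toT I x a) (Finset.mem_image_of_mem _ hσ)

variable {K : Finset (Set ({a // a ∉ I} → ℝ))} {μ : Set ({a // a ∉ I} → ℝ) → {a // a ∉ I} →₀ ℕ}

lemma polyOf_isAdapted
    (hμ : ∀ σ ∈ K, ∀ x ∈ σ, ∀ τ ∈ K, pairing (toForm (μ τ)) x ≤ pairing (toForm (μ σ)) x) :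
    (polyOf K μ).IsAdapted I K := fun σ hσ =>
  ⟨(pairingLin (toForm (μ σ))).toAffineMap, fun x hx => polyOf_eval hσ (hμ σ hσ x hx)⟩

lemma polyOf_onStratum
    (hμ : ∀ σ ∈ K, ∀ x ∈ σ, ∀ τ ∈ K, pairing (toForm (μ τ)) x ≤ pairing (toForm (μ σ)) x)
    {σ : Set ({a // a ∉ I} → ℝ)} (hσ : σ ∈ K) {x : {a // a ∉ I} → ℝ} (hx : x ∈ σ) :
    (polyOf K μ).onStratum I x = pairing (toForm (μ σ)) x := by
  rw [TropPoly.onStratum, polyOf_eval hσ (hμ σ hσ x hx), WithBot.unbotD_coe]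

end Polynomials

/-! ### The threshold as a tropical rational function -/

section ThresholdForms

variable {α κ : Type*} [Finite κ] {M : Matroid α} {lab : Option κ → α} {i : α}

/-- The minimum over all sets spanning `i` of the maximal coordinate in the set, as a difference
of two convex piecewise linear functions. -/
lemma exists_threshold_forms (hi : ¬ M.IsLoop i) (hspan : i ∈ M.closure (Set.range lab)) :
    ∃ (a : Set (κ → ℝ) → Option κ) (μ ν : Set (κ → ℝ) → κ →₀ ℕ),
      (∀ y, IsThreshold M i lab (homog y) (a (cone y))) ∧
      (∀ σ, toForm (μ σ) - toForm (ν σ) = coordForm (a σ)) ∧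
      (∀ y, ∀ x ∈ cone y, ∀ y', pairing (toForm (μ (cone y'))) x ≤ pairing (toForm (μ (cone y))) x) ∧
      (∀ y, ∀ x ∈ cone y, ∀ y',
        pairing (toForm (ν (cone y'))) x ≤ pairing (toForm (ν (cone y))) x) := by
  classical
  let 𝒮 : Finset (Set (Option κ)) := (Set.toFinite {S | i ∈ M.closure (lab '' S)}).toFinset
  have h𝒮 : ∀ S, S ∈ 𝒮 ↔ i ∈ M.closure (lab '' S) := fun S => Set.Finite.mem_toFinset _
  have hne : 𝒮.Nonempty := ⟨Set.univ, by rwa [h𝒮, Set.image_univ]⟩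
  have hmax : ∀ (y : κ → ℝ) (S : Set (Option κ)), ∃ c, S ∈ 𝒮 → c ∈ S ∧
      ∀ s ∈ S, homog y s ≤ homog y c := by
    intro y S
    by_cases hS : S ∈ 𝒮
    · obtain ⟨_, ⟨s, hs, rfl⟩, -, -⟩ := not_subset_loops hi ((h𝒮 S).1 hS)
      obtain ⟨c, hc, hle⟩ := Set.exists_max_image S (homog y) (Set.toFinite _) ⟨s, hs⟩
      exact ⟨c, fun _ => ⟨hc, hle⟩⟩
    · exact ⟨none, fun h => absurd h hS⟩
  choose c hc using hmax
  have hmin : ∀ y : κ → ℝ, ∃ S ∈ 𝒮, ∀ S' ∈ 𝒮, homog y (c y S) ≤ homog y (c y S') :=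
    fun y => 𝒮.exists_min_image _ hne
  choose s hs hs' using hmin
  -- The maximisers and minimisers depend on a chosen point; fixing one representative for each cone
  -- makes the forms depend on the cone only.
  let rep : Set (κ → ℝ) → κ → ℝ := fun σ => if h : ∃ y, cone y = σ then h.choose else 0
  have hrep : ∀ y, cone (rep (cone y)) = cone y := by
    intro y
    have h : ∃ y', cone y' = cone y := ⟨y, rfl⟩
    simp only [rep, dif_pos h]
    exact h.choose_spec
  have hc' : ∀ (y x : κ → ℝ), x ∈ cone y → ∀ S ∈ 𝒮, ∀ p ∈ S, homog x p ≤ homog x (c y S) :=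
    fun y x hx S hS p hp => hx _ _ ((hc y S hS).2 p hp)
  have hrepmem : ∀ y, ∀ x ∈ cone y, x ∈ cone (rep (cone y)) := fun y x hx => by rwa [hrep]
  have hform : ∀ (t : Finset (Set (Option κ))) (y : κ → ℝ),
      toForm (∑ S ∈ t, coordMonomial (c y S)) = ∑ S ∈ t, coordForm (c y S) := by
    intro t y
    rw [map_sum]
    exact Finset.sum_congr rfl fun S _ => toForm_coordMonomial _
  have hval : ∀ (t : Finset (Set (Option κ))) (y x : κ → ℝ),
      pairing (toForm (∑ S ∈ t, coordMonomial (c y S))) x = ∑ S ∈ t, homog x (c y S) := by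
    intro t y x
    rw [hform, pairing_finsetSum_left]
    exact Finset.sum_congr rfl fun S _ => pairing_coordForm _ _
  -- `μ` is the sum of the maxima over all spanning sets and `ν` omits the one whose maximum is
  -- minimal; their difference is that minimum.
  refine ⟨fun σ => c (rep σ) (s (rep σ)), fun σ => ∑ S ∈ 𝒮, coordMonomial (c (rep σ) S),
    fun σ => ∑ S ∈ 𝒮.erase (s (rep σ)), coordMonomial (c (rep σ) S), ?_, ?_, ?_, ?_⟩
  · intro y
    have h : IsThreshold M i lab (homog (rep (cone y)))
        (c (rep (cone y)) (s (rep (cone y)))) := by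
      refine ⟨M.closure_subset_closure (Set.image_mono ?_)
        ((h𝒮 (s (rep (cone y)))).1 (hs _)), fun S hS => ?_⟩
      · exact (hc _ _ (hs _)).2
      · rw [← h𝒮] at hS
        exact ⟨_, (hc _ S hS).1, hs' _ S hS⟩
    exact h.coarsen (hrepmem y y (mem_cone_self y))
  · intro σ
    rw [hform, hform, Finset.sum_erase_eq_sub (hs _)]
    abel
  · intro y x hx y'
    rw [hval, hval]
    exact Finset.sum_le_sum fun S hS => hc' _ x (hrepmem y x hx) S hS _ (hc _ S hS).1
  · intro y x hx y'
    have hx' := hrepmem y x hx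
    simp only [hval]
    set z := rep (cone y)
    set z' := rep (cone y')
    -- First the maximisers of `z'` are replaced by those of `z`; then the omitted set is changed to
    -- the one of smallest maximum, which increases the remaining sum.
    have h1 : ∑ S ∈ 𝒮.erase (s z'), homog x (c z' S) ≤ ∑ S ∈ 𝒮.erase (s z'), homog x (c z S) :=
      Finset.sum_le_sum fun S hS =>
        hc' _ x hx' S (Finset.mem_of_mem_erase hS) _ (hc _ S (Finset.mem_of_mem_erase hS)).1
    refine h1.trans ?_
    rw [Finset.sum_erase_eq_sub (hs _), Finset.sum_erase_eq_sub (hs _)]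
    exact sub_le_sub_left (hx' _ _ (hs' z _ (hs z'))) _

end ThresholdForms

end TropMod
end

noncomputable section

namespace TropMod

/-! ### Weights of cone complexes -/

section Weights

variable {ι : Type*} {I : Set ι}

lemma chainWeight_toT (A : Chain {a // a ∉ I}) (x : {a // a ∉ I} → ℝ) :
    haveI := Classical.propDecidable
    chainWeight I A (toT I x) = A.sum fun σ n => if x ∈ σ then n else 0 := by
  classical
  refine Finsupp.sum_congr fun σ _ => ?_
  refine if_congr ⟨?_, fun h => ⟨x, h, rfl⟩⟩ rfl rfl
  rintro ⟨y, hy, hxy⟩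
  rwa [← toT_injective I hxy]

lemma chainWeight_toT_of_ne {J : Set ι} (hJ : J ≠ I) (A : Chain {a // a ∉ I})
    (x : {a // a ∉ J} → ℝ) : chainWeight I A (toT J x) = 0 := by
  classical
  refine Finset.sum_eq_zero fun σ _ => if_neg ?_
  rintro ⟨y, -, hxy⟩
  apply hJ
  rw [← sedentarity_toT J x, ← hxy, sedentarity_toT]

lemma OrderLim.congr_cone {y y' : {a // a ∉ I} → ℝ} {z : ι → TT} (hc : cone y = cone y')
    (h : OrderLim y z) : OrderLim y' z :=
  ⟨h.1, fun a b hab => h.2 a b ((hc ▸ mem_cone_self y : y ∈ cone y') a b hab)⟩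

lemma OneLevel.congr_cone {y y' : {a // a ∉ I} → ℝ} {z : ι → TT} (hc : cone y = cone y')
    (h : OneLevel y z) : OneLevel y' z := fun a b ha hb =>
  homog_eq_of_mem_cone (a := some a) (b := some b)
    (hc.symm ▸ mem_cone_self y' : y' ∈ cone y) (h a b ha hb)

/-- `z` lies in the closure of the cone `σ`, in a stratum reached by moving one level to `-∞`. -/
def IsSimpleLim (σ : Set ({a // a ∉ I} → ℝ)) (z : ι → TT) : Prop :=
  ∃ y, cone y = σ ∧ OrderLim y z ∧ OneLevel y z

lemma isSimpleLim_cone {y : {a // a ∉ I} → ℝ} {z : ι → TT} :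
    IsSimpleLim (cone y) z ↔ OrderLim y z ∧ OneLevel y z :=
  ⟨fun ⟨_, hc, h1, h2⟩ => ⟨h1.congr_cone hc, h2.congr_cone hc⟩, fun h => ⟨y, rfl, h⟩⟩

variable {α : Type*} {M : Matroid α} {k : ℕ}

lemma mem_ridges_levFan {κ : Type*} [Finite κ] {lab : Option κ → α} {σ : Set (κ → ℝ)} :
    σ ∈ ridges k (levFan M lab) ↔ ∃ y ∈ levPoints M lab, levels y = k ∧ cone y = σ := by
  classical
  rw [ridges, Finset.mem_filter, levFan, mem_coneFan]
  constructor
  · rintro ⟨⟨y, hy, rfl⟩, hd⟩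
    exact ⟨y, hy, by rw [← dim_cone, hd], rfl⟩
  · rintro ⟨y, hy, hl, rfl⟩
    exact ⟨⟨y, hy, rfl⟩, by rw [dim_cone, hl]⟩

open Classical in
-- A point with at least `d` levels lies in no cone with `d` levels other than its own.
lemma sum_cones_mem {κ : Type*} [Finite κ] {lab : Option κ → α} {d : ℕ}
    {𝒮 : Finset (Set (κ → ℝ))}
    (h𝒮 : ∀ σ, σ ∈ 𝒮 ↔ ∃ y ∈ levPoints M lab, levels y = d ∧ cone y = σ)
    (c : Set (κ → ℝ) → ℤ) {x : κ → ℝ} (hd : d ≤ levels x) :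
    (∑ σ ∈ 𝒮, if x ∈ σ then c σ else 0)
      = if x ∈ levPoints M lab ∧ levels x = d then c (cone x) else 0 := by
  classical
  have huniq : ∀ σ ∈ 𝒮, x ∈ σ → x ∈ levPoints M lab ∧ levels x = d ∧ cone x = σ := by
    intro σ hσ hx
    obtain ⟨y, hy, hl, rfl⟩ := (h𝒮 σ).1 hσ
    exact ⟨levPoints_cone hy hx, le_antisymm (hl ▸ levels_le hx) hd,
      cone_eq_of_levels_le hx (hl ▸ hd)⟩
  split_ifs with h
  · have hmem : cone x ∈ 𝒮 := (h𝒮 _).2 ⟨x, h.1, h.2, rfl⟩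
    rw [Finset.sum_eq_single_of_mem _ hmem, if_pos (mem_cone_self x)]
    exact fun σ hσ hne => if_neg fun hx => hne (huniq σ hσ hx).2.2.symm
  · exact Finset.sum_eq_zero fun σ hσ => if_neg fun hx =>
      h ⟨(huniq σ hσ hx).1, (huniq σ hσ hx).2.1⟩

open Classical in
lemma chainWeight_graphChain (K : Finset (Set ({a // a ∉ I} → ℝ)))
    (ω : Set ({a // a ∉ I} → ℝ) → ℤ) (g : ({a // a ∉ I} → ℝ) → ℝ)
    (p : {b : Option ι // b ∉ some '' I} → ℝ) :
    chainWeight (some '' I) (graphChain k K (facetChain k K) ω g) (toT (some '' I) p)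
      = (∑ σ ∈ facets k K, if base p ∈ σ then (if height p = g (base p) then 1 else 0) else 0)
        + ∑ E ∈ ridges k K, if base p ∈ E then (if height p ≤ g (base p) then ω E else 0)
          else 0 := by
  rw [chainWeight_toT, graphChain, sum_mapDomain_add_mapDomain, facetChain_sum, ridgeChain_sum]
  · congr 1
    · refine Finset.sum_congr rfl fun σ _ => ?_
      rw [← ite_and]
      exact if_congr Iff.rfl rfl rfl
    · refine Finset.sum_congr rfl fun σ _ => ?_
      rw [← ite_and]
      exact if_congr Iff.rfl rfl rfl
  · intro c; split_ifs <;> rfl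
  · intro c; split_ifs <;> rfl
  · intro c n n'; split_ifs <;> simp

open Classical in
lemma lastHyperplaneWeight_graphChain [Finite ι] {lab : Option {a // a ∉ I} → α}
    (ω : Set ({a // a ∉ I} → ℝ) → ℤ) {g : ({a // a ∉ I} → ℝ) → ℝ}
    {m : Set ({a // a ∉ I} → ℝ) → {a // a ∉ I} →₀ ℤ} (hm : ∀ σ a, 0 ≤ m σ a)
    (hg : ∀ σ ∈ levFan M lab, ∀ x ∈ σ, g x = pairing (m σ) x) (z : ι → TT) :
    lastHyperplaneWeight k
        (graphChain k (levFan M lab) (facetChain k (levFan M lab)) ω g) z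
      = (∑ σ ∈ facets k (levFan M lab), if IsSimpleLim σ z then botCoeff (m σ) z else 0)
        + ∑ E ∈ ridges k (levFan M lab),
          if (∃ y, cone y = E ∧ OrderLim y z) ∧ ∀ a : {a // a ∉ I}, z a ≠ ⊥ then ω E else 0 := by
  have hK : ∀ y ∈ levPoints M lab, cone y ∈ levFan M lab := fun y hy =>
    mem_coneFan.2 ⟨y, hy, rfl⟩
  have hside : none ∉ some '' I ∧ none ∈ sedentarity (liftBot z) := ⟨by simp, rfl⟩
  change hyperplaneWeight k none (some '' I) _ (liftBot z) = _
  rw [hyperplaneWeight, if_pos hside, graphChain, sum_mapDomain_add_mapDomain, facetChain_sum,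
    ridgeChain_sum]
  · congr 1
    · refine Finset.sum_congr rfl fun σ hσ => ?_
      obtain ⟨y, hy, hl, rfl⟩ := mem_facets_levFan.1 hσ
      rw [one_mul, graphOver_contribution hl (hm _) (hg _ (hK y hy))]
      simp only [isSimpleLim_cone]
    · refine Finset.sum_congr rfl fun E hE => ?_
      obtain ⟨y, hy, hl, rfl⟩ := mem_ridges_levFan.1 hE
      have h1 := underGraph_contribution (z := z) hl (hm _) (hg _ (hK y hy))
      have h2 : (∃ y', cone y' = cone y ∧ OrderLim y' z) ↔ OrderLim y z :=
        ⟨fun ⟨_, hc, h⟩ => h.congr_cone hc, fun h => ⟨y, rfl, h⟩⟩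
      rw [h2, ← mul_ite_zero, h1, mul_ite_zero, mul_one]
  · intro c; split_ifs <;> simp
  · intro c; split_ifs <;> simp
  · intro c n n'; split_ifs <;> simp [add_mul]

end Weights

/-! ### Labelled charts -/

section Charts

variable {α ι : Type*} {M : Matroid α} {i : α} {I : Set ι} {L : Option ι → α} {k : ℕ}

/-- The coordinates `ι` of a chart of the Bergman fan of `M ＼ {i}`, labelled by elements of `M`,
the label of `none` being the element of the chart. -/
structure IsChart (M : Matroid α) (i : α) (I : Set ι) (L : Option ι → α) : Prop where
  mem : ∀ o, L o ∈ M.E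
  ne : ∀ o, L o ≠ i
  cover : ∀ a ∈ M.E, a ≠ i → a ∈ Set.range L
  loop_iff : ∀ a, a ∈ I ↔ M.IsLoop (L (some a))
  none_nonloop : ¬ M.IsLoop (L none)
  nonloop : ¬ M.IsLoop i
  mem_ground : i ∈ M.E
  not_coloop : ¬ M.IsColoop i

/-- The labels of the finite coordinates. -/
def finLabel (I : Set ι) (L : Option ι → α) : Option {a // a ∉ I} → α :=
  fun o => L (o.map Subtype.val)

namespace IsChart

lemma finLabel_mem (H : IsChart M i I L) (o : Option {a // a ∉ I}) : finLabel I L o ∈ M.E :=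
  H.mem _

lemma finLabel_ne (H : IsChart M i I L) (o : Option {a // a ∉ I}) : finLabel I L o ≠ i :=
  H.ne _

lemma finLabel_nonloop (H : IsChart M i I L) (o : Option {a // a ∉ I}) :
    ¬ M.IsLoop (finLabel I L o) := by
  cases o with
  | none => exact H.none_nonloop
  | some a => exact fun h => a.2 ((H.loop_iff _).2 h)

lemma mem_range_or (H : IsChart M i I L) {a : α} (ha : a ∈ M.E) (hai : a ≠ i) :
    a ∈ Set.range (finLabel I L) ∨ ∃ b ∈ I, L (some b) = a := by
  obtain ⟨o, rfl⟩ := H.cover a ha hai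
  cases o with
  | none => exact Or.inl ⟨none, rfl⟩
  | some b =>
    by_cases hb : b ∈ I
    · exact Or.inr ⟨b, hb, rfl⟩
    · exact Or.inl ⟨some ⟨b, hb⟩, rfl⟩

/-- Loops are spanned by the empty set, and `i`, not being a coloop, by the other elements. -/
lemma subset_closure (H : IsChart M i I L) : M.E ⊆ M.closure (Set.range (finLabel I L)) := by
  have h1 : M.E \ {i} ⊆ M.closure (Set.range (finLabel I L)) := by
    rintro a ⟨ha, hai⟩
    rcases H.mem_range_or ha hai with h | ⟨b, hb, rfl⟩
    · refine M.subset_closure _ ?_ h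
      rintro _ ⟨o, rfl⟩
      exact H.finLabel_mem o
    · exact M.closure_subset_closure (Set.empty_subset _) ((H.loop_iff b).1 hb)
  intro a ha
  by_cases hai : a = i
  · have h2 := H.not_coloop
    rw [Matroid.isColoop_iff_notMem_closure_compl H.mem_ground, not_not] at h2
    rw [hai]
    exact M.closure_subset_closure_of_subset_closure h1 h2
  · exact h1 ⟨ha, hai⟩

variable {X : α → TT} {z : ι → TT}

lemma homog_eq (hX : ∀ o, X (L o) = homog z o) (o : Option {a // a ∉ I}) :
    X (finLabel I L o) = homog z (o.map Subtype.val) := hX _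

lemma delete_isLoop_iff (H : IsChart M i I L) (o : Option ι) :
    (M ＼ {i}).IsLoop (L o) ↔ M.IsLoop (L o) :=
  mem_closure_delete_iff (Set.notMem_empty i) (H.ne o)

lemma isTrop_delete_iff (H : IsChart M i I L) (hX : ∀ o, X (L o) = homog z o) :
    IsTrop (M ＼ {i}) X ↔ (∀ a ∈ I, z a = ⊥) ∧
      IsLev M (finLabel I L) fun o => homog z (o.map Subtype.val) := by
  have h0 : IsTrop (M ＼ {i}) X → ∀ a ∈ I, z a = ⊥ := by
    intro h a ha
    have := h.eq_bot_of_isLoop ((H.delete_isLoop_iff (some a)).2 ((H.loop_iff a).1 ha))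
    rwa [hX] at this
  have h1 : (∀ a ∈ I, z a = ⊥) → (IsTrop (M ＼ {i}) X ↔
      IsLev M (finLabel I L) fun o => homog z (o.map Subtype.val)) := by
    intro hz
    rw [isTrop_iff_isLev (l := finLabel I L), isLev_delete_iff H.finLabel_ne]
    · rw [show X ∘ finLabel I L = fun o => homog z (o.map Subtype.val) from funext fun o => hX _]
    · exact fun o => ⟨H.finLabel_mem o, H.finLabel_ne o⟩
    · exact fun o _ h => H.finLabel_nonloop o ((H.delete_isLoop_iff _).1 h)
    · rintro a ⟨ha, hai⟩
      rcases H.mem_range_or ha hai with h | ⟨b, hb, rfl⟩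
      · exact Or.inl h
      · exact Or.inr ⟨(H.delete_isLoop_iff _).2 ((H.loop_iff b).1 hb), by rw [hX]; exact hz b hb⟩
  exact ⟨fun h => ⟨h0 h, (h1 (h0 h)).1 h⟩, fun h => (h1 h.1).2 h.2⟩

lemma isTrop_delete_toT_iff (H : IsChart M i I L) {x : {a // a ∉ I} → ℝ}
    (hX : ∀ o, X (L o) = homog (toT I x) o) :
    IsTrop (M ＼ {i}) X ↔ x ∈ levPoints M (finLabel I L) := by
  rw [H.isTrop_delete_iff hX, and_iff_right fun a ha => toT_of_mem ha]
  simp only [homog_toT]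
  exact isLev_coe_iff

lemma isLoop_contract {a : α} (ha : M.IsLoop a) (hai : a ≠ i) : (M ／ {i}).IsLoop a :=
  mem_closure_contract_iff.2 ⟨M.closure_subset_closure (Set.empty_subset _) ha, hai⟩

lemma isTrop_contract_toT_iff (H : IsChart M i I L) {x : {a // a ∉ I} → ℝ}
    (hX : ∀ o, X (L o) = homog (toT I x) o) :
    IsTrop (M ／ {i}) X ↔ IsLev (M ／ {i}) (finLabel I L) (homog x) := by
  have hX' : ∀ o, X (finLabel I L o) = ((homog x o : ℝ) : TT) := fun o => by
    rw [← homog_toT]; exact hX _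
  rw [isTrop_iff_isLev (l := finLabel I L), ← isLev_coe_iff]
  · rw [show X ∘ finLabel I L = fun o => ((homog x o : ℝ) : TT) from funext hX']
  · exact fun o => ⟨H.finLabel_mem o, H.finLabel_ne o⟩
  · intro o ho
    rw [hX'] at ho
    exact absurd ho WithBot.coe_ne_bot
  · rintro a ⟨ha, hai⟩
    rcases H.mem_range_or ha hai with h | ⟨b, hb, rfl⟩
    · exact Or.inl h
    · exact Or.inr ⟨isLoop_contract ((H.loop_iff b).1 hb) hai, by rw [hX]; exact toT_of_mem hb⟩

lemma eRank_delete_le : (M ＼ {i}).eRank ≤ M.eRank := by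
  obtain ⟨B, hB⟩ := (M ＼ {i}).exists_isBase
  rw [← hB.encard_eq_eRank]
  exact (hB.indep.of_delete).encard_le_eRank

variable [Finite ι]

/-- The weights of the Bergman fan of the deletion. -/
lemma sameCycle_delete (H : IsChart M i I L) (hr : M.eRank = (k + 1 : ℕ)) {B : Set (ι → TT)}
    {X : (ι → TT) → α → TT} (hX : ∀ z o, X z (L o) = homog z o)
    (hB : ∀ z, z ∈ B ↔ IsTrop (M ＼ {i}) (X z)) :
    SameCycle k (unitWeight B) (chainWeight I (facetChain k (levFan M (finLabel I L)))) := by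
  classical
  refine sameCycle_of_forall_levels fun J x hx => ?_
  have hE : ∀ o, L o ∈ (M ＼ {i}).E := fun o => ⟨H.mem o, H.ne o⟩
  by_cases hJ : J = I
  · subst hJ
    rw [chainWeight_toT, facetChain_sum]
    have h1 := sum_cones_mem (fun σ => mem_facets_levFan (N := M) (lab := finLabel J L)) (fun _ => 1)
      (show k + 1 ≤ levels x from hx)
    refine Eq.trans ?_ (Eq.trans h1.symm (Finset.sum_congr rfl fun σ _ => rfl))
    rw [unitWeight, hB, H.isTrop_delete_toT_iff (hX _)]
    refine if_congr ⟨fun h => ⟨h, ?_⟩, fun h => h.1⟩ rfl rfl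
    exact le_antisymm (levels_le_of_levPoints H.finLabel_mem hr h) hx
  -- In any other stratum a point of the fan has a nonloop at `-∞`, and then too few finite levels.
  · rw [chainWeight_toT_of_ne hJ]
    refine if_neg fun h => ?_
    rw [hB] at h
    have hIJ : I ⊆ J := by
      intro a ha
      have := ((H.isTrop_delete_iff (hX _)).1 h).1 a ha
      rwa [toT_eq_bot_iff] at this
    obtain ⟨p, hp, hpI⟩ := Set.exists_of_ssubset (hIJ.ssubset_of_ne (Ne.symm hJ))
    have h1 := h.levels_add_one_le hE (hX _) hp fun hl =>
      hpI ((H.loop_iff p).2 ((H.delete_isLoop_iff _).1 hl))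
    have h2 := h1.trans (eRank_delete_le.trans hr.le)
    have h3 : levels x + 1 ≤ k + 1 := by exact_mod_cast h2
    omega

end IsChart

end Charts

end TropMod
end

noncomputable section

namespace TropMod

/-! ### The fan of `M` as a graph modification, and the fan of the contraction as its divisor -/

section ModificationCycles

variable {α ι : Type*} {M : Matroid α} {i : α} {I : Set ι} {L : Option ι → α} {k : ℕ}

lemma levels_le_of_isLev_contract {κ : Type*} [Finite κ] {lab : Option κ → α}
    (hlab : ∀ o, lab o ∈ M.E) (hne : ∀ o, lab o ≠ i) (hi : M.IsNonloop i)
    (hr : M.eRank = (k + 1 : ℕ)) {x : κ → ℝ} (hx : IsLev (M ／ {i}) lab (homog x)) :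
    levels x ≤ k := by
  have h1 := hx.ncard_range_le fun o => (⟨hlab o, hne o⟩ : lab o ∈ (M ／ {i}).E)
  have h2 := (add_le_add_left h1 1).trans ((eRank_contract_add_one_le hi).trans hr.le)
  have h3 : levels x + 1 ≤ k + 1 := by exact_mod_cast h2
  omega

lemma range_homog_subset (p : {b : Option ι // b ∉ some '' I} → ℝ) :
    Set.range (homog p) ⊆ insert (height p) (Set.range (homog (base p))) := by
  rintro _ ⟨o, rfl⟩
  match o with
  | none => exact Or.inr ⟨none, rfl⟩
  | some ⟨none, h⟩ => exact Or.inl rfl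
  | some ⟨some a, h⟩ => exact Or.inr ⟨some ⟨a, fun ha => h ⟨a, ha, rfl⟩⟩, rfl⟩

lemma levels_le_base_add_one [Finite ι] (p : {b : Option ι // b ∉ some '' I} → ℝ) :
    levels p ≤ levels (base p) + 1 :=
  (Set.ncard_le_ncard (range_homog_subset p) (Set.toFinite _)).trans (Set.ncard_insert_le _ _)

lemma levels_le_base [Finite ι] (p : {b : Option ι // b ∉ some '' I} → ℝ)
    (h : height p ∈ Set.range (homog (base p))) : levels p ≤ levels (base p) := by
  refine Set.ncard_le_ncard ((range_homog_subset p).trans ?_) (Set.toFinite _)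
  rw [Set.insert_eq_of_mem h]

namespace IsChart

lemma isNonloop (H : IsChart M i I L) : M.IsNonloop i := by
  rw [← Matroid.not_isLoop_iff H.mem_ground]
  exact H.nonloop

open Classical in
/-- The weights of the Bergman fan as a modification of the Bergman fan of the deletion. -/
lemma sameCycle_graph [Finite ι] (H : IsChart M i I L) (hr : M.eRank = (k + 1 : ℕ))
    {a : Set ({a // a ∉ I} → ℝ) → Option {a // a ∉ I}}
    (ha : ∀ y, IsThreshold M i (finLabel I L) (homog y) (a (cone y)))
    {f : ({a // a ∉ I} → ℝ) → ℝ}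
    (hf : ∀ y ∈ levPoints M (finLabel I L), ∀ x ∈ cone y, f x = homog x (a (cone y)))
    {ω : Set ({a // a ∉ I} → ℝ) → ℤ}
    (hω : ∀ y ∈ levPoints M (finLabel I L), levels y = k →
      ω (cone y) = if IsLev (M ／ {i}) (finLabel I L) (homog y) then 1 else 0)
    {B : Set (Option ι → TT)} {X : (Option ι → TT) → α → TT}
    (hX : ∀ z o, X z (L o) = homog (delta z) o) (hXi : ∀ z, X z i = z none)
    (hB : ∀ z, z ∈ B ↔ IsTrop M (X z)) :
    SameCycle k (unitWeight B) (chainWeight (some '' I)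
      (graphChain k (levFan M (finLabel I L)) (facetChain k (levFan M (finLabel I L))) ω f)) := by
  classical
  refine sameCycle_of_forall_levels fun J p hp => ?_
  by_cases hJ : J = some '' I
  · subst hJ
    obtain ⟨x, hxdef⟩ : ∃ x, x = base p := ⟨_, rfl⟩
    obtain ⟨t, htdef⟩ : ∃ t, t = height p := ⟨_, rfl⟩
    have hlp : levels p ≤ levels x + 1 := hxdef ▸ levels_le_base_add_one p
    have hlp' : t ∈ Set.range (homog x) → levels p ≤ levels x := by
      rw [hxdef, htdef]
      exact levels_le_base p
    -- The matroid description of the fan over `x`: the last coordinate is the threshold, or at most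
    -- the threshold over the contraction.
    have hiff : toT (some '' I) p ∈ B ↔ x ∈ levPoints M (finLabel I L) ∧
        (t = homog x (a (cone x)) ∨ (t ≤ homog x (a (cone x)) ∧
          IsLev (M ／ {i}) (finLabel I L) (homog x))) := by
      have hval : X (toT (some '' I) p) ∘ (fun o : Option (Option {a // a ∉ I}) =>
          o.elim i (finLabel I L)) = fun o => ((o.elim t (homog x) : ℝ) : TT) := by
        funext o
        cases o with
        | none =>
          change X _ i = _
          rw [hXi, toT_of_notMem (by simp), htdef]
          rfl
        | some o =>
          change X _ (L _) = _
          rw [hX, delta_toT, homog_toT, hxdef]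
          rfl
      rw [hB, isTrop_iff_isLev (l := fun o : Option (Option {a // a ∉ I}) =>
          o.elim i (finLabel I L)), hval, isLev_coe_iff,
        isLev_option_iff H.finLabel_mem H.finLabel_ne (ha x)]
      · rfl
      · rintro (_ | o)
        exacts [H.mem_ground, H.finLabel_mem o]
      · rintro (_ | o) -
        exacts [H.nonloop, H.finLabel_nonloop o]
      · intro b hb
        by_cases hbi : b = i
        · exact Or.inl ⟨none, hbi.symm⟩
        rcases H.mem_range_or hb hbi with ⟨o, rfl⟩ | ⟨c, hc, rfl⟩
        · exact Or.inl ⟨some o, rfl⟩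
        · refine Or.inr ⟨(H.loop_iff c).1 hc, ?_⟩
          rw [hX, delta_toT]
          exact toT_of_mem hc
    rw [chainWeight_graphChain, unitWeight, ← hxdef, ← htdef]
    have h2 := sum_cones_mem (fun σ => mem_ridges_levFan (M := M) (lab := finLabel I L))
      (fun E => if t ≤ f x then ω E else 0) (show k ≤ levels x by omega)
    have hk : ∀ h : x ∈ levPoints M (finLabel I L), f x = homog x (a (cone x)) :=
      fun h => hf x h x (mem_cone_self x)
    rcases Nat.lt_or_ge k (levels x) with hl | hl
    · have h1 := sum_cones_mem (fun σ => mem_facets_levFan (N := M) (lab := finLabel I L))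
        (fun _ => if t = f x then 1 else 0) (show k + 1 ≤ levels x from hl)
      refine Eq.trans ?_ (congrArg₂ (· + ·) h1.symm h2.symm)
      rw [if_neg (c := _ ∧ levels x = k) fun h => absurd h.2 hl.ne', add_zero, ← ite_and]
      refine if_congr ?_ rfl rfl
      rw [hiff]
      constructor
      · rintro ⟨h, ht⟩
        refine ⟨⟨h, le_antisymm (levels_le_of_levPoints H.finLabel_mem hr h) hl⟩, ?_⟩
        rw [hk h]
        rcases ht with ht | ⟨-, ht⟩
        · exact ht
        -- `x` has `k + 1` levels, more than the contraction permits, so nothing below the graph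
        -- occurs over it.
        · have := levels_le_of_isLev_contract H.finLabel_mem H.finLabel_ne H.isNonloop hr ht
          omega
      · rintro ⟨⟨h, -⟩, ht⟩
        exact ⟨h, Or.inl (ht.trans (hk h))⟩
    -- Here the last coordinate is a new value, as `p` has more levels than `x`. It therefore
    -- differs from the threshold, and only the part below the ridge of `x` is relevant.
    · have hlx : levels x = k := by omega
      have ht : t ∉ Set.range (homog x) := fun h => by
        have := hlp' h
        omega
      have h1 : (∑ σ ∈ facets k (levFan M (finLabel I L)),
          if x ∈ σ then (if t = f x then (1 : ℤ) else 0) else 0) = 0 := by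
        refine Finset.sum_eq_zero fun σ hσ => ?_
        rw [← ite_and]
        refine if_neg ?_
        rintro ⟨hxσ, htf⟩
        obtain ⟨y, hy, -, rfl⟩ := mem_facets_levFan.1 hσ
        exact ht ⟨_, ((hf y hy x hxσ).symm.trans htf.symm)⟩
      refine Eq.trans ?_ (congrArg₂ (· + ·) h1.symm h2.symm)
      rw [zero_add]
      by_cases h : x ∈ levPoints M (finLabel I L)
      · rw [if_pos (show _ ∧ levels x = k from ⟨h, hlx⟩), hω x h hlx, hk h, ← ite_and]
        refine if_congr ?_ rfl rfl
        rw [hiff, and_iff_right h]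
        refine ⟨?_, Or.inr⟩
        rintro (h' | h')
        · exact absurd ⟨_, h'.symm⟩ ht
        · exact h'
      · rw [if_neg (fun h' => h (hiff.1 h').1), if_neg fun h' => h h'.1]
  · rw [chainWeight_toT_of_ne hJ]
    refine if_neg fun h => ?_
    rw [hB] at h
    have hIJ : some '' I ⊆ J := by
      rintro _ ⟨b, hb, rfl⟩
      have := h.eq_bot_of_isLoop ((H.loop_iff b).1 hb)
      rw [hX] at this
      exact toT_eq_bot_iff.1 this
    obtain ⟨q, hq, hqI⟩ := Set.exists_of_ssubset (hIJ.ssubset_of_ne (Ne.symm hJ))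
    -- The last coordinate is now labelled by `i`, a nonloop, so it too counts as an additional
    -- level when it is `-∞`.
    let L' : Option (Option ι) → α := fun o => o.elim (L none) fun b => b.elim i fun b => L (some b)
    have hL' : ∀ o, L' o ∈ M.E := by
      rintro (_ | _ | b)
      exacts [H.mem _, H.mem_ground, H.mem _]
    have hX' : ∀ z o, X z (L' o) = homog z o := by
      rintro z (_ | _ | b)
      exacts [hX z none, hXi z, hX z (some b)]
    have hql : ¬ M.IsLoop (L' (some q)) := by
      cases q with
      | none => exact H.nonloop
      | some b => exact fun hl => hqI ⟨b, (H.loop_iff b).2 hl, rfl⟩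
    have h2 := (h.levels_add_one_le hL' (hX' _) hq hql).trans hr.le
    have h3 : levels p + 1 ≤ k + 1 := by exact_mod_cast h2
    omega

section Contract

variable {X : α → TT} {z : ι → TT}

lemma eq_bot_of_isTrop_contract (H : IsChart M i I L) (hX : ∀ o, X (L o) = homog z o)
    (h : IsTrop (M ／ {i}) X) {b : ι} (hb : b ∈ I) : z b = ⊥ := by
  have := h.eq_bot_of_isLoop (isLoop_contract ((H.loop_iff b).1 hb) (H.ne _))
  rwa [hX] at this

/-- The elements up to the threshold span `i` and all are `-∞` at `z`. Replacing `i` by them turns a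
relation of the contraction into one of `M` without adding finite values. -/
lemma isTrop_contract_of_orderLim (H : IsChart M i I L) (hX : ∀ o, X (L o) = homog z o)
    {y : {a // a ∉ I} → ℝ} (hy : y ∈ levPoints M (finLabel I L)) (hyz : OrderLim y z)
    {a : Option {a // a ∉ I}} (ha : IsThreshold M i (finLabel I L) (homog y) a)
    (haz : homog z (a.map Subtype.val) = ⊥) : IsTrop (M ／ {i}) X := by
  intro S e he
  obtain ⟨he, hei⟩ := mem_closure_contract_iff.1 he
  by_contra! hcon
  obtain ⟨h0, hlt⟩ := hcon
  have hbot : ∀ b ∈ I, X (L (some b)) = ⊥ := fun b hb => by rw [hX]; exact hyz.1 b hb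
  rcases H.mem_range_or (M.mem_ground_of_mem_closure he) hei with ⟨e, rfl⟩ | ⟨b, hb, rfl⟩
  · have h1 : finLabel I L e ∈ M.closure (finLabel I L ''
        (finLabel I L ⁻¹' S ∪ {c | homog y c ≤ homog y a})) := by
      rw [← M.closure_inter_ground] at he
      refine M.closure_subset_closure_of_subset_closure ?_ he
      rintro s ⟨hs, hsE⟩
      by_cases hsi : s = i
      · rw [hsi]
        exact M.closure_subset_closure (Set.image_mono Set.subset_union_right) ha.1
      have hsS : s ∈ S := hs.resolve_left hsi
      rcases H.mem_range_or hsE hsi with ⟨s, rfl⟩ | ⟨b, hb, rfl⟩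
      · exact subset_closure_image H.finLabel_mem _ ⟨s, Or.inl hsS, rfl⟩
      · exact M.closure_subset_closure (Set.empty_subset _) ((H.loop_iff b).1 hb)
    obtain ⟨s, hs, hle⟩ := hy _ _ h1
    have hle' := hyz.2 _ _ hle
    rcases hs with hs | hs
    · have h2 := hlt _ hs ⟨H.finLabel_mem s, H.finLabel_ne s⟩
      rw [homog_eq hX, homog_eq hX] at h2
      exact absurd hle' (not_le.2 h2)
    · have h2 := hle'.trans (hyz.2 _ _ hs)
      rw [haz, le_bot_iff] at h2
      rw [homog_eq hX] at h0
      exact h0 h2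
  · exact h0 (hbot b hb)

/-- When `M ／ {i}` has loops that are not loops of `M`, its fan lies in a deeper stratum. The facet
of the larger fan over such a point is found by placing all coordinates newly at `-∞` on one level
below the finite ones. -/
lemma exists_facet_of_isTrop_contract [Finite ι] (H : IsChart M i I L) (hr : M.eRank = (k + 1 : ℕ))
    {J : Set ι} {x : {a // a ∉ J} → ℝ} (hX : ∀ o, X (L o) = homog (toT J x) o)
    (h : IsTrop (M ／ {i}) X) (hx : k ≤ levels x) {p : ι} (hpI : p ∉ I) (hpJ : p ∈ J) :
    ∃ y ∈ levPoints M (finLabel I L), levels y = k + 1 ∧ OrderLim y (toT J x) ∧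
      OneLevel y (toT J x) ∧
      (∀ a, IsThreshold M i (finLabel I L) (homog y) a →
        homog (toT J x) (a.map Subtype.val) = ⊥) ∧
      ∀ y', levels y' = k + 1 → OrderLim y' (toT J x) → OneLevel y' (toT J x) →
        cone y' = cone y := by
  classical
  have hE : ∀ o, L o ∈ (M ／ {i}).E := fun o => ⟨H.mem o, H.ne o⟩
  have hIJ : I ⊆ J := fun b hb => toT_eq_bot_iff.1 (H.eq_bot_of_isTrop_contract hX h hb)
  -- The contraction has rank at most `k`, and `x` already has `k` finite levels; a nonloop of the
  -- contraction at `-∞` would be one level too many.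
  have hloop : ∀ b ∈ J, (M ／ {i}).IsLoop (L (some b)) := by
    intro b hb
    by_contra hcon
    have h1 := h.levels_add_one_le hE hX hb hcon
    have h2 := (add_le_add_left h1 1).trans ((eRank_contract_add_one_le H.isNonloop).trans hr.le)
    have h3 : levels x + 1 + 1 ≤ k + 1 := by exact_mod_cast h2
    omega
  obtain ⟨c, hc⟩ : ∃ c : ℝ, ∀ o, c < homog x o := by
    obtain ⟨o, ho⟩ := Finite.exists_min (homog x)
    exact ⟨homog x o - 1, fun o' => by linarith [ho o']⟩
  let y : {a // a ∉ I} → ℝ := fun b => if hb : b.1 ∈ J then c else x ⟨b.1, hb⟩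
  let zo : Option {a // a ∉ I} → TT := fun o => homog (toT J x) (o.map Subtype.val)
  have hcases : ∀ o, (zo o = ⊥ ∧ homog y o = c) ∨ (zo o = ((homog y o : ℝ) : TT) ∧ c < homog y o) := by
    rintro (_ | b)
    · exact Or.inr ⟨rfl, hc none⟩
    · by_cases hb : b.1 ∈ J
      · exact Or.inl ⟨toT_of_mem hb, dif_pos hb⟩
      · have h1 : homog y (some b) = x ⟨b.1, hb⟩ := dif_neg hb
        rw [h1]
        exact Or.inr ⟨toT_of_notMem hb, hc (some ⟨b.1, hb⟩)⟩
  have hle : ∀ o, c ≤ homog y o := fun o => by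
    rcases hcases o with h | h
    exacts [h.2.ge, h.2.le]
  have hzy : ∀ o o', zo o ≠ ⊥ → zo o ≤ zo o' → homog y o ≤ homog y o' := by
    intro o o' h0 hoo
    rcases hcases o with h1 | h1
    · exact absurd h1.1 h0
    rcases hcases o' with h2 | h2
    · rw [h2.1, le_bot_iff] at hoo
      exact absurd hoo h0
    · rwa [h1.1, h2.1, WithBot.coe_le_coe] at hoo
  have hyz : ∀ o o', homog y o ≤ homog y o' → zo o ≤ zo o' := by
    intro o o' hoo
    rcases hcases o with h1 | h1
    · rw [h1.1]
      exact bot_le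
    rcases hcases o' with h2 | h2
    · rw [h2.2] at hoo
      exact absurd hoo (not_le.2 h1.2)
    · rwa [h1.1, h2.1, WithBot.coe_le_coe]
  have hlev : y ∈ levPoints M (finLabel I L) := by
    intro S e he
    by_cases h0 : zo e = ⊥
    · obtain ⟨_, ⟨s, hs, rfl⟩, -, -⟩ := not_subset_loops (H.finLabel_nonloop e) he
      rcases hcases e with h1 | h1
      · exact ⟨s, hs, h1.2 ▸ hle s⟩
      · rw [h0] at h1
        exact absurd h1.1 WithBot.bot_ne_coe
    · have he' : finLabel I L e ∈ (M ／ {i}).closure (finLabel I L '' S) :=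
        mem_closure_contract_iff.2 ⟨M.closure_subset_closure (Set.subset_insert _ _) he,
          H.finLabel_ne e⟩
      rcases h _ _ he' with h1 | ⟨_, ⟨s, hs, rfl⟩, -, h1⟩
      · rw [homog_eq hX] at h1
        exact absurd h1 h0
      · rw [homog_eq hX, homog_eq hX] at h1
        exact ⟨s, hs, hzy e s h0 h1⟩
  have hlevels : levels y = k + 1 := by
    refine le_antisymm (levels_le_of_levPoints H.finLabel_mem hr hlev) ?_
    have h1 : insert c (Set.range (homog x)) ⊆ Set.range (homog y) := by
      rintro _ (rfl | ⟨o, rfl⟩)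
      · exact ⟨some ⟨p, hpI⟩, dif_pos hpJ⟩
      · cases o with
        | none => exact ⟨none, rfl⟩
        | some b => exact ⟨some ⟨b.1, fun hb => b.2 (hIJ hb)⟩, dif_neg b.2⟩
    have h2 := Set.ncard_le_ncard h1 (Set.toFinite _)
    rw [Set.ncard_insert_of_notMem (by rintro ⟨o, ho⟩; exact (hc o).ne' ho)] at h2
    exact (Nat.add_le_add_right hx 1).trans h2
  refine ⟨y, hlev, hlevels, ⟨fun b hb => toT_of_mem (hIJ hb), hyz⟩, ?_, ?_, ?_⟩
  · intro b b' hb hb'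
    have h1 : y b = c := dif_pos (toT_eq_bot_iff.1 hb)
    have h2 : y b' = c := dif_pos (toT_eq_bot_iff.1 hb')
    rw [h1, h2]
  · intro a ha
    have h1 := mem_closure_contract_iff.1 (hloop p hpJ)
    -- The element of `p` is a loop of the contraction but not of `M`, hence parallel to `i`; the
    -- threshold is therefore at most the lowest level `c`.
    have h2 : i ∈ M.closure (finLabel I L '' {some ⟨p, hpI⟩}) := by
      rw [Set.image_singleton, ← insert_empty_eq]
      exact M.mem_closure_insert (H.finLabel_nonloop (some ⟨p, hpI⟩)) h1.1
    obtain ⟨_, rfl, hs⟩ := ha.2 _ h2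
    have h3 : homog y (some ⟨p, hpI⟩) = c := dif_pos hpJ
    rw [h3] at hs
    rcases hcases a with h4 | h4
    · exact h4.1
    · exact absurd hs (not_le.2 h4.2)
  · intro y' hl' hlim hone
    -- The limit order places `y` in the cone of `y'`, and equality of cones follows from the equal
    -- number of levels.
    refine (cone_eq_of_levels_le (x := y) (y := y') ?_ (by rw [hl', hlevels])).symm
    intro o o' hoo
    have h1 : zo o ≤ zo o' := hlim.2 o o' hoo
    by_cases h0 : zo o = ⊥
    · rcases hcases o with h2 | h2
      · rw [h2.2]
        exact hle o'
      · rw [h0] at h2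
        exact absurd h2.1 WithBot.bot_ne_coe
    · exact hzy o o' h0 h1

end Contract

open Classical in
/-- The weights of the Bergman fan of the contraction as a divisor. -/
lemma sameCycle_contract [Finite ι] (H : IsChart M i I L) (hr : M.eRank = (k + 1 : ℕ))
    {a : Set ({a // a ∉ I} → ℝ) → Option {a // a ∉ I}}
    (ha : ∀ y, IsThreshold M i (finLabel I L) (homog y) (a (cone y)))
    {ω : Set ({a // a ∉ I} → ℝ) → ℤ}
    (hω : ∀ y ∈ levPoints M (finLabel I L), levels y = k →
      ω (cone y) = if IsLev (M ／ {i}) (finLabel I L) (homog y) then 1 else 0)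
    {D : (ι → TT) → ℤ}
    (hD : ∀ z,
      D z = (∑ σ ∈ facets k (levFan M (finLabel I L)),
        if IsSimpleLim σ z ∧ homog z ((a σ).map Subtype.val) = ⊥ then 1 else 0)
        + ∑ E ∈ ridges k (levFan M (finLabel I L)),
          if (∃ y, cone y = E ∧ OrderLim y z) ∧ ∀ a : {a // a ∉ I}, z a ≠ ⊥ then ω E else 0)
    {B : Set (ι → TT)} {X : (ι → TT) → α → TT} (hX : ∀ z o, X z (L o) = homog z o)
    (hB : ∀ z, z ∈ B ↔ IsTrop (M ／ {i}) (X z)) :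
    SameCycle (k - 1) (unitWeight B) D := by
  classical
  refine sameCycle_of_forall_levels fun J x hx => ?_
  have hk : k ≤ levels x := by omega
  rw [hD, unitWeight, hB]
  -- If a nonloop coordinate is `-∞`, only graph facets can contribute; otherwise only facets below
  -- ridges can.
  by_cases hfin : ∃ p, p ∉ I ∧ p ∈ J
  · obtain ⟨p, hpI, hpJ⟩ := hfin
    rw [Finset.sum_eq_zero (s := ridges k _), add_zero]
    rotate_left
    · exact fun E _ => if_neg fun h => h.2 ⟨p, hpI⟩ (toT_of_mem hpJ)
    by_cases h : IsTrop (M ／ {i}) (X (toT J x))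
    · rw [if_pos h]
      obtain ⟨y, hy, hl, hlim, hone, hbot, huniq⟩ :=
        H.exists_facet_of_isTrop_contract hr (hX _) h hk hpI hpJ
      have hmem : cone y ∈ facets k (levFan M (finLabel I L)) :=
        mem_facets_levFan.2 ⟨y, hy, hl, rfl⟩
      rw [Finset.sum_eq_single_of_mem _ hmem, if_pos]
      · exact ⟨⟨y, rfl, hlim, hone⟩, hbot _ (ha y)⟩
      · intro σ hσ hne
        refine if_neg ?_
        rintro ⟨⟨y', rfl, hlim', hone'⟩, -⟩
        obtain ⟨y'', -, hl'', hcc⟩ := mem_facets_levFan.1 hσ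
        exact hne (huniq y' ((levels_eq_of_cone_eq hcc).symm.trans hl'') hlim' hone')
    · rw [if_neg h]
      refine (Finset.sum_eq_zero fun σ hσ => if_neg ?_).symm
      rintro ⟨⟨y, rfl, hlim, -⟩, hbot⟩
      obtain ⟨y', hy', -, hcc⟩ := mem_facets_levFan.1 hσ
      have hy : y ∈ levPoints M (finLabel I L) := levPoints_cone hy' (hcc ▸ mem_cone_self y)
      exact h (H.isTrop_contract_of_orderLim (hX _) hy hlim (ha y) hbot)
  · push Not at hfin
    have hne : ∀ b : {a // a ∉ I}, toT J x b.1 ≠ ⊥ := fun b hb =>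
      hfin b.1 b.2 (toT_eq_bot_iff.1 hb)
    rw [Finset.sum_eq_zero (s := facets k _), zero_add]
    · by_cases hJ : J = I
      · subst hJ
        have h2 := sum_cones_mem (fun σ => mem_ridges_levFan (M := M) (lab := finLabel J L)) ω hk
        refine Eq.trans ?_ (h2.symm.trans (Finset.sum_congr rfl fun E _ => if_congr ?_ rfl rfl))
        · rw [H.isTrop_contract_toT_iff (hX _)]
          by_cases h : x ∈ levPoints M (finLabel J L) ∧ levels x = k
          · rw [if_pos h, hω x h.1 h.2]
          · rw [if_neg h]
            refine if_neg fun hc => h ⟨hc.of_contract H.finLabel_ne, le_antisymm ?_ hk⟩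
            exact levels_le_of_isLev_contract H.finLabel_mem H.finLabel_ne H.isNonloop hr hc
        · rw [and_iff_left hne]
          simp only [orderLim_toT]
          rename_i hE
          obtain ⟨y, -, -, rfl⟩ := mem_ridges_levFan.1 hE
          exact ⟨fun h => ⟨y, rfl, h⟩, fun ⟨_, hc, h⟩ => hc ▸ h⟩
      · have hIJ : ¬ ∀ b ∈ I, toT J x b = ⊥ := fun h => hJ (Set.Subset.antisymm
          (fun b hb => by_contra fun hbI => hfin b hbI hb) fun b hb => toT_eq_bot_iff.1 (h b hb))
        rw [if_neg fun h => hIJ fun b hb => H.eq_bot_of_isTrop_contract (hX _) h hb]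
        refine (Finset.sum_eq_zero fun E _ => if_neg ?_).symm
        rintro ⟨⟨y, -, hlim⟩, -⟩
        exact hIJ hlim.1
    · intro σ _
      refine if_neg ?_
      rintro ⟨-, hbot⟩
      cases hσ : a σ with
      | none =>
        rw [hσ] at hbot
        exact WithBot.coe_ne_bot hbot
      | some b =>
        rw [hσ] at hbot
        exact hne b hbot

end IsChart

end ModificationCycles

end TropMod
end

noncomputable section

namespace TropMod

/-! ### The elementary modification -/

section Modification

variable {α ι : Type*} {M : Matroid α} {i : α} {I : Set ι} {L : Option ι → α} {k : ℕ}

lemma isGraphModification_levFan [Finite ι] {lab : Option {a // a ∉ I} → α}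
    (hlab : ∀ a, lab a ∈ M.E) (hspan : M.E ⊆ M.closure (Set.range lab))
    (hr : M.eRank = (k + 1 : ℕ)) {g : ({a // a ∉ I} → ℝ) → ℝ}
    {m : Set ({a // a ∉ I} → ℝ) → {a // a ∉ I} →₀ ℤ}
    (hg : ∀ σ ∈ levFan M lab, ∀ x ∈ σ, g x = pairing (m σ) x) :
    IsGraphModification k (levFan M lab) (facetChain k (levFan M lab)) g
      (graphChain k (levFan M lab) (facetChain k (levFan M lab))
        (ridgeWeight (facetChain k (levFan M lab)) normalVec m) g) := by
  refine isGraphModification_graphChain ?_ ?_ ?_ ?_ ?_ hg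
  · intro σ hσ
    obtain ⟨y, -, rfl⟩ := mem_coneFan.1 hσ
    exact ⟨y, mem_cone_self y⟩
  · intro σ hσ
    rw [support_facetChain, facets, Finset.mem_filter] at hσ
    exact hσ.1
  · intro E hE E' hE' hEE'
    obtain ⟨y, -, hl, rfl⟩ := mem_ridges_levFan.1 hE
    obtain ⟨y', -, hl', rfl⟩ := mem_ridges_levFan.1 hE'
    exact cone_eq_of_levels_le (cone_subset_iff.1 hEE') (by rw [hl, hl'])
  · intro E hE F hF hEF
    obtain ⟨y, hy, hl, rfl⟩ := mem_ridges_levFan.1 hE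
    rw [support_facetChain] at hF
    exact isPrimitiveVector_of_mem_facets hlab hspan hr hy hl hF hEF
  · intro E hE
    obtain ⟨y, hy, hl, rfl⟩ := mem_ridges_levFan.1 hE
    exact sum_normalVec_mem_lattice hlab hspan hr hy hl

lemma IsChart.isElementaryModification [Finite ι] (H : IsChart M i I L)
    (hr : M.eRank = (k + 1 : ℕ)) {B : Set (Option ι → TT)} {C D : Set (ι → TT)}
    {X : (Option ι → TT) → α → TT} {Y : (ι → TT) → α → TT}
    (hX : ∀ z o, X z (L o) = homog (delta z) o) (hXi : ∀ z, X z i = z none)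
    (hY : ∀ z o, Y z (L o) = homog z o) (hB : ∀ z, z ∈ B ↔ IsTrop M (X z))
    (hC : ∀ z, z ∈ C ↔ IsTrop (M ＼ {i}) (Y z)) (hD : ∀ z, z ∈ D ↔ IsTrop (M ／ {i}) (Y z)) :
    IsElementaryModification k (unitWeight B) (unitWeight C) (unitWeight D) := by
  classical
  have hlab := H.finLabel_mem
  have hspan := H.subset_closure
  obtain ⟨a, μ, ν, ha, hμν, hμ, hν⟩ := exists_threshold_forms (M := M) (lab := finLabel I L)
    H.nonloop (hspan H.mem_ground)
  have hdom : ∀ {μ : Set ({a // a ∉ I} → ℝ) → {a // a ∉ I} →₀ ℕ},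
      (∀ y, ∀ x ∈ cone y, ∀ y',
        pairing (toForm (μ (cone y'))) x ≤ pairing (toForm (μ (cone y))) x) →
      ∀ σ ∈ levFan M (finLabel I L), ∀ x ∈ σ, ∀ τ ∈ levFan M (finLabel I L),
        pairing (toForm (μ τ)) x ≤ pairing (toForm (μ σ)) x := by
    intro μ hμ σ hσ x hx τ hτ
    obtain ⟨y, -, rfl⟩ := mem_coneFan.1 hσ
    obtain ⟨y', -, rfl⟩ := mem_coneFan.1 hτ
    exact hμ y x hx y'
  have hP := hdom hμ
  have hQ := hdom hν
  let K := levFan M (finLabel I L)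
  let P : TropPoly ι := polyOf K μ
  let Q : TropPoly ι := polyOf K ν
  let f : ({a // a ∉ I} → ℝ) → ℝ := fun x => P.onStratum I x - Q.onStratum I x
  have hf : ∀ σ ∈ K, ∀ x ∈ σ, f x = pairing (coordForm (a σ)) x := by
    intro σ hσ x hx
    rw [← hμν, pairing_sub_left, ← polyOf_onStratum hP hσ hx, ← polyOf_onStratum hQ hσ hx]
  let chain : (Set ({a // a ∉ I} → ℝ) → {a // a ∉ I} →₀ ℤ) → (({a // a ∉ I} → ℝ) → ℝ) →
      Chain {b : Option ι // b ∉ some '' I} := fun m g =>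
    graphChain k K (facetChain k K) (ridgeWeight (facetChain k K) normalVec m) g
  have hω : ∀ y ∈ levPoints M (finLabel I L), levels y = k →
      ridgeWeight (facetChain k K) normalVec (fun σ => coordForm (a σ)) (cone y)
        = if IsLev (M ／ {i}) (finLabel I L) (homog y) then 1 else 0 := fun y hy hl =>
    ridgeWeight_threshold hlab H.finLabel_ne hspan hr (fun y _ => ha y) hy hl
  refine ⟨I, K, facetChain k K, P, Q,
    lastHyperplaneWeight k (chain (fun σ => toForm (μ σ)) (P.onStratum I)),
    lastHyperplaneWeight k (chain (fun σ => toForm (ν σ)) (Q.onStratum I)),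
    chain (fun σ => coordForm (a σ)) f, isEffectiveCycle_levFan hlab hspan hr,
    H.sameCycle_delete hr hY hC, ⟨polyOf_isAdapted hP, _, ?_, rfl⟩,
    ⟨polyOf_isAdapted hQ, _, ?_, rfl⟩, ?_, ?_, isGraphModification_levFan hlab hspan hr hf,
    H.sameCycle_graph hr ha ?_ hω hX hXi hB⟩
  · exact isGraphModification_levFan hlab hspan hr fun σ hσ x hx => polyOf_onStratum hP hσ hx
  · exact isGraphModification_levFan hlab hspan hr fun σ hσ x hx => polyOf_onStratum hQ hσ hx
  · refine H.sameCycle_contract hr ha hω (fun z => ?_) hY hD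
    have hnn : ∀ (μ : {a // a ∉ I} →₀ ℕ) b, 0 ≤ toForm μ b := fun μ b => by
      rw [toForm_apply]
      exact Int.natCast_nonneg _
    rw [lastHyperplaneWeight_graphChain _ (fun σ => hnn (μ σ))
        (fun σ hσ x hx => polyOf_onStratum hP hσ hx),
      lastHyperplaneWeight_graphChain _ (fun σ => hnn (ν σ))
        (fun σ hσ x hx => polyOf_onStratum hQ hσ hx), add_sub_add_comm,
      ← Finset.sum_sub_distrib, ← Finset.sum_sub_distrib]
    congr 1
    -- The slopes of `P` and `Q` towards the boundary differ by that of the threshold coordinate,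
    -- which is one if this coordinate is `-∞` and zero otherwise.
    · refine Finset.sum_congr rfl fun σ _ => ?_
      by_cases h : IsSimpleLim σ z
      · rw [if_pos h, if_pos h, ← botCoeff_sub, hμν]
        simp only [h, true_and]
        cases a σ with
        | none =>
          rw [if_neg (show ¬ homog z (Option.map Subtype.val none) = ⊥ from WithBot.coe_ne_bot)]
          rfl
        | some b => exact Finsupp.sum_single_index (by split_ifs <;> rfl)
      · simp [h]
    · refine Finset.sum_congr rfl fun E _ => ?_
      split_ifs
      · rw [← ridgeWeight_sub]
        simp only [hμν]
      · rfl
  · intro z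
    rw [unitWeight]
    split_ifs <;> norm_num
  · intro y hy x hx
    rw [hf _ (mem_coneFan.2 ⟨y, hy, rfl⟩) x hx, pairing_coordForm]

lemma sameCycle_of_eq {κ : Type*} {d : ℕ} {W W' : (κ → TT) → ℤ} (h : ∀ z, W z = W' z) :
    SameCycle d W W' := fun _ => ⟨∅, by simp, fun _ hx => absurd (h _) hx⟩

/-- The modification of the empty cycle. -/
lemma isElementaryModification_empty :
    IsElementaryModification k (unitWeight (∅ : Set (Option ι → TT)))
      (unitWeight (∅ : Set (ι → TT))) (unitWeight ∅) := by
  classical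
  have h0 : ∀ {κ : Type _} (z : κ → TT), unitWeight ∅ z = 0 := fun z =>
    if_neg (Set.notMem_empty z)
  have hmod : ∀ g : ({a : ι // a ∉ (∅ : Set ι)} → ℝ) → ℝ, IsGraphModification k ∅ 0 g 0 := by
    intro g
    exact ⟨0, by simp, by simp, by simp⟩
  have hreg : IsRegularDivisor (I := (∅ : Set ι)) k ∅ 0 ⟨∅, 0⟩ fun _ => 0 := by
    refine ⟨fun σ hσ => absurd hσ (Finset.notMem_empty σ), 0, hmod _, ?_⟩
    funext z
    simp [lastHyperplaneWeight, hyperplaneWeight]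
  refine ⟨∅, ∅, 0, ⟨∅, 0⟩, ⟨∅, 0⟩, fun _ => 0, fun _ => 0, 0, ?_, ?_, hreg, hreg, ?_, ?_, hmod _, ?_⟩
  · exact ⟨⟨by simp, by simp, by simp⟩, by simp, by simp, by simp, by simp⟩
  · exact sameCycle_of_eq fun z => by rw [h0]; rfl
  · exact sameCycle_of_eq fun z => by rw [h0]; rfl
  · exact fun z => (h0 z).ge
  · exact sameCycle_of_eq fun z => by rw [h0]; rfl

end Modification

/-! ### Charts of Bergman fans -/

section BergmanCharts

variable {α : Type*} {M : Matroid α} {i j : α}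

lemma not_isTrop_of_isLoop (hj : M.IsLoop j) {X : α → TT} (hX : X j = 0) : ¬ IsTrop M X := by
  intro h
  have := h.eq_bot_of_isLoop hj
  rw [hX] at this
  exact WithBot.coe_ne_bot this

/-- A loop is `-∞` on the whole fan, but the chart normalises the coordinate of `j` to zero. -/
lemma bergmanChart_eq_empty [M.Finite] (hj : j ∈ M.E) (hl : M.IsLoop j) :
    bergmanChart M hj = ∅ := by
  ext x
  rw [mem_bergmanChart_iff]
  exact iff_of_false (not_isTrop_of_isLoop hl (chartCoord_self x)) (Set.notMem_empty x)

/-- The labels of the coordinates of a chart. -/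
def chartLabel {E : Set α} {j : α} (o : Option (ChartIndex E j)) : α := o.elim j Subtype.val

lemma chartCoord_chartLabel {E : Set α} {j : α} (x : ChartIndex E j → TT)
    (o : Option (ChartIndex E j)) : chartCoord x (chartLabel o) = homog x o := by
  cases o with
  | none => exact chartCoord_self x
  | some a => exact chartCoord_coe x a

lemma chartCoord_joinCoord {E : Set α}
    (z : Option (ChartIndex (E \ {i}) j) → TT) (o : Option (ChartIndex (E \ {i}) j)) :
    chartCoord (joinCoord i j z) (chartLabel o) = homog (delta z) o := by
  cases o with
  | none => exact chartCoord_self _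
  | some a =>
    refine (chartCoord_coe (joinCoord i j z) ⟨a.1, a.2.1.1, a.2.2⟩).trans ?_
    exact dif_neg a.2.1.2

lemma chartCoord_joinCoord_self {E : Set α} (hi : i ∈ E) (hji : j ≠ i)
    (z : Option (ChartIndex (E \ {i}) j) → TT) : chartCoord (joinCoord i j z) i = z none :=
  (chartCoord_coe (joinCoord i j z) ⟨i, hi, hji.symm⟩).trans (dif_pos rfl)

lemma isChart_chartLabel (hi : i ∈ M.E) (hloop : ¬ M.IsLoop i) (hcoloop : ¬ M.IsColoop i)
    (hj : j ∈ M.E) (hji : j ≠ i) (hjl : ¬ M.IsLoop j) :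
    IsChart M i {a : ChartIndex (M.E \ {i}) j | M.IsLoop a.1} chartLabel where
  mem := by
    rintro (_ | a)
    exacts [hj, a.2.1.1]
  ne := by
    rintro (_ | a)
    exacts [hji, a.2.1.2]
  cover a ha hai := by
    by_cases haj : a = j
    · exact ⟨none, haj.symm⟩
    · exact ⟨some ⟨a, ⟨ha, hai⟩, haj⟩, rfl⟩
  loop_iff _ := Iff.rfl
  none_nonloop := hjl
  nonloop := hloop
  mem_ground := hi
  not_coloop := hcoloop

end BergmanCharts

end TropMod
end

theorem proposition2p12 {α : Type*} (M : Matroid α) [M.Finite] (k : ℕ)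
    (hrank : M.eRank = ((k + 1 : ℕ) : ℕ∞)) (i : α) (hiE : i ∈ M.E)
    (hloop : ¬ M.IsLoop i) (hcoloop : ¬ M.IsColoop i)
    (j : α) (hj : j ∈ M.E) (hji : j ≠ i) :
    (∀ z : Option (TropMod.ChartIndex (M.E \ {i}) j) → TropMod.TT,
      TropMod.joinCoord i j z ∈ TropMod.bergmanChart M hj →
        TropMod.delta z ∈ TropMod.bergmanChart (M ＼ {i}) (j := j) ⟨hj, hji⟩) ∧
    TropMod.IsElementaryModification (ι := TropMod.ChartIndex (M.E \ {i}) j) k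
      (TropMod.unitWeight
        {z | TropMod.joinCoord i j z ∈ TropMod.bergmanChart M hj})
      (TropMod.unitWeight (TropMod.bergmanChart (M ＼ {i}) (j := j) ⟨hj, hji⟩))
      (TropMod.unitWeight (TropMod.bergmanChart (M ／ {i}) (j := j) ⟨hj, hji⟩)) := by
  have hdel : ∀ x, x ∈ TropMod.bergmanChart (M ＼ {i}) (j := j) ⟨hj, hji⟩ ↔
      TropMod.IsTrop (M ＼ {i}) (TropMod.chartCoord x) := fun x => TropMod.mem_bergmanChart_iff _
  have hcon : ∀ x, x ∈ TropMod.bergmanChart (M ／ {i}) (j := j) ⟨hj, hji⟩ ↔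
      TropMod.IsTrop (M ／ {i}) (TropMod.chartCoord x) := fun x => TropMod.mem_bergmanChart_iff _
  constructor
  · intro z hz
    rw [TropMod.mem_bergmanChart_iff] at hz
    refine (hdel _).2 ((TropMod.IsTrop.congr fun a ha => ?_).1 (hz.delete i))
    obtain ⟨o, rfl⟩ : ∃ o : Option (TropMod.ChartIndex (M.E \ {i}) j), TropMod.chartLabel o = a := by
      by_cases haj : a = j
      · exact ⟨none, haj.symm⟩
      · exact ⟨some ⟨a, ha, haj⟩, rfl⟩
    exact (TropMod.chartCoord_joinCoord z o).trans
      (TropMod.chartCoord_chartLabel (TropMod.delta z) o).symm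
  -- If `j` is a loop it remains one in both minors, and all three charts are empty.
  · by_cases hjl : M.IsLoop j
    · have hdl : (M ＼ {i}).IsLoop j :=
        (TropMod.mem_closure_delete_iff (Set.notMem_empty i) hji).2 hjl
      have h1 : {z : Option (TropMod.ChartIndex (M.E \ {i}) j) → TropMod.TT |
          TropMod.joinCoord i j z ∈ TropMod.bergmanChart M hj} = ∅ := by
        rw [TropMod.bergmanChart_eq_empty hj hjl]
        rfl
      rw [h1]
      have h2 := TropMod.bergmanChart_eq_empty (M := M ＼ {i}) ⟨hj, hji⟩ hdl
      have h3 := TropMod.bergmanChart_eq_empty (M := M ／ {i}) ⟨hj, hji⟩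
        (TropMod.IsChart.isLoop_contract hjl hji)
      erw [h2, h3]
      exact TropMod.isElementaryModification_empty
    · have hfin : Finite (TropMod.ChartIndex (M.E \ {i}) j) :=
        (M.ground_finite.subset fun a (ha : a ∈ M.E \ {i} ∧ a ≠ j) => ha.1.1).to_subtype
      exact (TropMod.isChart_chartLabel hiE hloop hcoloop hj hji hjl).isElementaryModification
        hrank TropMod.chartCoord_joinCoord
        (TropMod.chartCoord_joinCoord_self hiE hji) TropMod.chartCoord_chartLabel
        (fun z => TropMod.mem_bergmanChart_iff hj) hdel hcon
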